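/- Let $k$ be a field of characteristic $0$, let $d \ge 0$, let $S = k[[x_0,\dots,x_d]]$ with $\mathfrak n = (x_0,\dots,x_d)$, and let $f \in \mathfrak n^2$ be nonzero. Put $R = S/(f)$ and let $R^\sharp = S[[u]]/(f+u^2)$ be its double branched cover. Then $R$ has strongly unbounded lattice type if and only if $R^\sharp$ has strongly unbounded lattice type. Here, for $A = R$ or $A = R^\sharp$ (a complete Gorenstein local ring with residue field $k$), a \emph{lattice} is a finitely generated maximal Cohen--Macaulay $A$-module $M$ such that $M_{\mathfrak p}$ and $\mathrm{Hom}_A(M,A)_{\mathfrak p}$ are projective over $A_{\mathfrak p}$ for every non-maximal prime $\mathfrak p$ of $A$. A lattice $Y$ is \emph{lat-injective} if $\mathrm{Ext}^1_A(M,Y)=0$ for all lattices $M$. Let $\alpha : G \to k$ be a minimal lat-approximation of the residue field, that is, a surjection from a lattice $G$ whose kernel has a finite resolution $0\to L_t\to\cdots\to L_0\to \ker\alpha\to 0$ by lat-injectives and such that every endomorphism $g$ of $G$ with $\alpha g=\alpha$ is an isomorphism. The \emph{$\underline{\mathsf h}$-length} of an $A$-module $M$ is the length over $A$ of $\underline{\mathrm{Hom}}_A(M,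 M\oplus G)$, the module $\mathrm{Hom}_A(M,M\oplus G)$ modulo the homomorphisms that factor through a projective module. The ring $A$ has \emph{strongly unbounded lattice type} if there is an infinite sequence of integers $b_1<b_2<\cdots$ such that, for each $i$, there are infinitely many pairwise non-isomorphic indecomposable lattices of $\underline{\mathsf h}$-length $b_i$. -/

import Mathlib

universe u

namespace LatticeType

/-! ### Lattices over a Gorenstein local ring

The ring `R` is regarded as an order over itself. The rings to which these definitions are applied
are hypersurfaces, hence Gorenstein, so the canonical module is `R`. -/

section Lattices

variable (R : Type u) [CommRing R] [IsLocalRing R]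

/-- A module is maximal Cohen-Macaulay if the maximal ideal contains an `M`-regular sequence whose
length is the Krull dimension of `R`. (The zero module is allowed, as usual; for a nonzero
finitely generated module, weakly regular sequences in the maximal ideal are regular.) -/
def IsMaximalCohenMacaulay (M : Type u) [AddCommGroup M] [Module R M] : Prop :=
  ∃ rs : List R, (∀ r ∈ rs, r ∈ IsLocalRing.maximalIdeal R) ∧
    RingTheory.Sequence.IsWeaklyRegular M rs ∧
    ((rs.length : ℕ∞) : WithBot ℕ∞) = ringKrullDim R

/-- A lattice: a finitely generated maximal Cohen-Macaulay module such that both it and its dual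
into the canonical module `R` are projective on the punctured spectrum. -/
structure IsLattice (M : Type u) [AddCommGroup M] [Module R M] : Prop where
  finite : Module.Finite R M
  maximalCohenMacaulay : IsMaximalCohenMacaulay R M
  projective_localization : ∀ (p : Ideal R) [p.IsPrime], p ≠ IsLocalRing.maximalIdeal R →
    Module.Projective (Localization.AtPrime p) (LocalizedModule p.primeCompl M)
  projective_localization_dual : ∀ (p : Ideal R) [p.IsPrime], p ≠ IsLocalRing.maximalIdeal R →
    Module.Projective (Localization.AtPrime p) (LocalizedModule p.primeCompl (M →ₗ[R] R))

/-! ### Approximations by lattices -/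

/-- A lattice `Y` is lat-injective if `Ext¹(M, Y) = 0` for every lattice `M`. -/
def IsLatInjective (Y : Type u) [AddCommGroup Y] [Module R Y] : Prop :=
  IsLattice R Y ∧ ∀ (M : Type u) [AddCommGroup M] [Module R M], IsLattice R M →
    Subsingleton (CategoryTheory.Abelian.Ext (ModuleCat.of R M) (ModuleCat.of R Y) 1)

/-- `Y` has a finite resolution `0 → L_t → ⋯ → L_0 → Y → 0` by lat-injectives. -/
inductive HasFiniteLatInjectiveResolution : ModuleCat.{u} R → Prop
  | of_isLatInjective (Y : ModuleCat.{u} R) (hY : IsLatInjective R Y) :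
      HasFiniteLatInjectiveResolution Y
  | of_exact (K L Y : ModuleCat.{u} R) (i : K →ₗ[R] L) (p : L →ₗ[R] Y)
      (hi : Function.Injective i) (hip : Function.Exact i p) (hp : Function.Surjective p)
      (hL : IsLatInjective R L) (hK : HasFiniteLatInjectiveResolution K) :
      HasFiniteLatInjectiveResolution Y

/-- `α : G → N` is a minimal lat-approximation: `α` is a surjection from a lattice, its kernel has a
finite resolution by lat-injectives, and `α` is right minimal. -/
structure IsMinimalLatApproximation {G N : Type u} [AddCommGroup G] [Module R G]
    [AddCommGroup N] [Module R N] (α : G →ₗ[R] N) : Prop where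
  isLattice : IsLattice R G
  surjective : Function.Surjective α
  resolution_ker : HasFiniteLatInjectiveResolution R (ModuleCat.of R (LinearMap.ker α))
  right_minimal : ∀ g : G →ₗ[R] G, α ∘ₗ g = α → Function.Bijective g

end Lattices

/-! ### Homomorphisms modulo projectives -/

section StableHom

variable (R : Type u) [CommRing R]

/-- The submodule `P(M, N)` of homomorphisms that factor through a projective module. -/
def projectiveMaps (M N : Type u) [AddCommGroup M] [Module R M] [AddCommGroup N] [Module R N] :
    Submodule R (M →ₗ[R] N) where
  carrier := {f | ∃ (P : ModuleCat.{u} R) (g : M →ₗ[R] P) (h : P →ₗ[R] N),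
    Module.Projective R P ∧ f = h ∘ₗ g}
  zero_mem' := ⟨ModuleCat.of R PUnit, 0, 0, inferInstance, by simp⟩
  add_mem' := by
    rintro _ _ ⟨P, g, h, hP, rfl⟩ ⟨P', g', h', hP', rfl⟩
    exact ⟨ModuleCat.of R (P × P'), g.prod g', h.coprod h',
      (inferInstance : Module.Projective R (P × P')), by ext; simp⟩
  smul_mem' := by
    rintro c _ ⟨P, g, h, hP, rfl⟩
    exact ⟨P, g, c • h, hP, by ext; simp⟩

/-- The stable homomorphism module `Hom(M, N) / P(M, N)`. -/
abbrev StableHom (M N : Type u) [AddCommGroup M] [Module R M] [AddCommGroup N] [Module R N] :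
    Type u :=
  (M →ₗ[R] N) ⧸ projectiveMaps R M N

/-- The `h`-length of `M` computed with `G`: the length of the stable homomorphism module from `M`
to `M ⊕ G`. -/
noncomputable def hLength (G M : Type u) [AddCommGroup G] [Module R G] [AddCommGroup M]
    [Module R M] : ℕ∞ :=
  Module.length R (StableHom R M (M × G))

/-- A module is indecomposable if it is nonzero and is not the direct sum of two nonzero
submodules. -/
def IsIndecomposable (M : Type u) [AddCommGroup M] [Module R M] : Prop :=
  Nontrivial M ∧ ∀ p q : Submodule R M, IsCompl p q → p = ⊥ ∨ q = ⊥

end StableHom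

/-- `R` has strongly unbounded lattice type: with respect to a minimal lat-approximation `G` of the
residue field (which is the only simple `R`-module, and whose minimal lat-approximation is unique up
to isomorphism), there is a strictly increasing sequence `b` of integers such that, for each `i`,
there are infinitely many pairwise non-isomorphic indecomposable lattices of `h`-length `b i`. -/
def HasStronglyUnboundedLatticeType (R : Type u) [CommRing R] [IsLocalRing R] : Prop :=
  ∃ (G : ModuleCat.{u} R) (α : G →ₗ[R] IsLocalRing.ResidueField R),
    IsMinimalLatApproximation R α ∧
    ∃ b : ℕ → ℕ, StrictMono b ∧ ∀ i : ℕ, ∃ M : ℕ → ModuleCat.{u} R,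
      (∀ j, IsLattice R (M j) ∧ IsIndecomposable R (M j) ∧ hLength R G (M j) = (b i : ℕ∞)) ∧
      ∀ j j', j ≠ j' → IsEmpty (M j ≃ₗ[R] M j')

/-! ### Hypersurfaces and their double branched covers -/

section Hypersurface

variable {k : Type u} [Field k] {d : ℕ}

/-- The hypersurface `R = k[[x_0, …, x_d]]/(f)`. -/
abbrev Hypersurface (f : MvPowerSeries (Fin (d + 1)) k) : Type u :=
  MvPowerSeries (Fin (d + 1)) k ⧸ Ideal.span {f}

/-- The double branched cover `k[[x_0, …, x_d]][[u]]/(f + u²)` of `k[[x_0, …, x_d]]/(f)`. -/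
abbrev DoubleBranchedCover (f : MvPowerSeries (Fin (d + 1)) k) : Type u :=
  PowerSeries (MvPowerSeries (Fin (d + 1)) k) ⧸
    Ideal.span {PowerSeries.C f + (PowerSeries.X : PowerSeries (MvPowerSeries (Fin (d + 1)) k)) ^ 2}

/-- The ideal `(x_0, …, x_d)` of `k[[x_0, …, x_d]]`. -/
noncomputable def variablesIdeal (k : Type u) [Field k] (d : ℕ) : Ideal (MvPowerSeries (Fin (d + 1)) k) :=
  Ideal.span (Set.range MvPowerSeries.X)

theorem constantCoeff_eq_zero {f : MvPowerSeries (Fin (d + 1)) k}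
    (hf : f ∈ variablesIdeal k d ^ 2) : MvPowerSeries.constantCoeff f = 0 := by
  have h : variablesIdeal k d ≤ RingHom.ker (MvPowerSeries.constantCoeff (σ := Fin (d + 1)) (R := k)) := by
    rw [variablesIdeal, Ideal.span_le]
    rintro _ ⟨i, rfl⟩
    simp [RingHom.mem_ker]
  exact h (Ideal.pow_le_self two_ne_zero hf)

theorem isLocalRing_hypersurface {f : MvPowerSeries (Fin (d + 1)) k}
    (hf : f ∈ variablesIdeal k d ^ 2) : IsLocalRing (Hypersurface f) := by
  have : Nontrivial (Hypersurface f) := by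
    rw [Ideal.Quotient.nontrivial_iff, Ne, Ideal.span_singleton_eq_top]
    intro h
    have := h.map (MvPowerSeries.constantCoeff (σ := Fin (d + 1)) (R := k))
    simp [constantCoeff_eq_zero hf] at this
  exact IsLocalRing.of_surjective' (Ideal.Quotient.mk _) Ideal.Quotient.mk_surjective

theorem isLocalRing_doubleBranchedCover {f : MvPowerSeries (Fin (d + 1)) k}
    (hf : f ∈ variablesIdeal k d ^ 2) : IsLocalRing (DoubleBranchedCover f) := by
  have : Nontrivial (DoubleBranchedCover f) := by
    rw [Ideal.Quotient.nontrivial_iff, Ne, Ideal.span_singleton_eq_top]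
    intro h
    have := h.map ((MvPowerSeries.constantCoeff (σ := Fin (d + 1)) (R := k)).comp
      (PowerSeries.constantCoeff (R := MvPowerSeries (Fin (d + 1)) k)))
    simp [constantCoeff_eq_zero hf] at this
  exact IsLocalRing.of_surjective' (Ideal.Quotient.mk _) Ideal.Quotient.mk_surjective

end Hypersurface

end LatticeType

/-! Write S for the power series ring, B for the double cover and u for its distinguished element
`root`, so that R = B/(u) and B is S-free on 1 and u. Two functors, due to Knörrer, compare
lattices: an R-lattice M is sent to its syzygy ΩM over B, and a B-lattice N to N/uN = R ⊗ N. Here M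
is a summand of R ⊗ ΩM (`isRetract_reduction_ker`), and, because 2 is invertible, N is a summand of
every B-syzygy of N/uN (`isRetract_ker_reduction`). By a Krull-Schmidt argument every indecomposable
lattice on one side is therefore matched with an indecomposable one on the other. The matching is
finite-to-one: all lattices matched with a given one are summands of a single finite module.

The h-length is awkward to follow through these functors, so it is replaced by the size `HasSizeLE`:
a bound n on the number of generators such that the n-th power of the maximal ideal lies in the
stable annihilator. For indecomposable lattices the two invariants bound each other. If M is not
free of rank one, lifting along G → k makes Hom(M, k) a quotient of the stable Hom, so h-length b
bounds the generators, and a module of length b is killed by the b-th power of the maximal ideal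
(`hasSizeLE_of_hLength_le`). Conversely, a regular sequence of maximal length inside the n-th power
of the maximal ideal embeds the stable Hom into a Hom of explicitly bounded length
(`exists_hLength_le`). By the pigeonhole principle, strongly unbounded type is then equivalent to
`HasUnboundedFamilies`. Both functors at most double the size, so this condition passes along the
finite-to-one matching (`HasUnboundedFamilies.transfer`).

All that the theory of lattices needs of the two rings is collected in `IsHenselianGorenstein`. It
is verified for R by lifting presentations to S, as in Eisenbud's matrix factorizations, and for B
from the fact that maximal Cohen-Macaulay B-modules are the finite S-free ones. -/

open CategoryTheory Abelian

namespace LatticeType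

/-! ### Vanishing of Ext along short exact sequences -/

section ExtVanishing

variable (A : Type u) [CommRing A]

/-- Vanishing of `Extⁱ(M, N)`. -/
def ExtZero (M N : Type u) [AddCommGroup M] [Module A M] [AddCommGroup N] [Module A N]
    (i : ℕ) : Prop :=
  Subsingleton (Ext (ModuleCat.of A M) (ModuleCat.of A N) i)

variable {A}
variable {W W' X Y Z : Type u} [AddCommGroup W] [Module A W] [AddCommGroup W'] [Module A W']
  [AddCommGroup X] [Module A X]
  [AddCommGroup Y] [Module A Y] [AddCommGroup Z] [Module A Z]

theorem extZero_zero_iff : ExtZero A W X 0 ↔ ∀ f : W →ₗ[A] X, f = 0 := by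
  unfold ExtZero
  rw [(Ext.addEquiv₀.trans ModuleCat.homAddEquiv).subsingleton_congr]
  exact ⟨fun h f => Subsingleton.elim _ _, fun h => ⟨fun f g => (h f).trans (h g).symm⟩⟩

theorem ExtZero.congr_left (e : W ≃ₗ[A] W') {i : ℕ} (h : ExtZero A W X i) : ExtZero A W' X i := by
  constructor
  intro a b
  have key : ∀ c : Ext (ModuleCat.of A W') (ModuleCat.of A X) i, c = 0 := by
    intro c
    obtain ⟨e⟩ : Nonempty (ModuleCat.of A W ≅ ModuleCat.of A W') := ⟨e.toModuleIso⟩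
    have h1 := h.elim ((Ext.mk₀ e.hom).comp c (zero_add i)) 0
    have h2 := congrArg (fun z => (Ext.mk₀ e.inv).comp z (zero_add i)) h1
    simpa [← Ext.comp_assoc_of_second_deg_zero] using h2
  rw [key a, key b]

theorem ExtZero.congr_right (e : X ≃ₗ[A] Y) {i : ℕ} (h : ExtZero A W X i) : ExtZero A W Y i := by
  constructor
  intro a b
  have key : ∀ c : Ext (ModuleCat.of A W) (ModuleCat.of A Y) i, c = 0 := by
    intro c
    obtain ⟨e⟩ : Nonempty (ModuleCat.of A X ≅ ModuleCat.of A Y) := ⟨e.toModuleIso⟩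
    have h1 := h.elim (c.comp (Ext.mk₀ e.inv) (add_zero i)) 0
    have h2 := congrArg (fun z => z.comp (Ext.mk₀ e.hom) (add_zero i)) h1
    simpa using h2
  rw [key a, key b]

theorem ExtZero.of_projective [Module.Projective A W] (i : ℕ) : ExtZero A W X (i + 1) := by
  have : Projective (ModuleCat.of A W) := (IsProjective.iff_projective W).mp inferInstance
  exact Ext.subsingleton_of_projective _ _ _

variable (f : X →ₗ[A] Y) (g : Y →ₗ[A] Z) (hf : Function.Injective f) (hg : Function.Surjective g)
  (hfg : Function.Exact f g)

/-- The short complex of modules attached to an exact pair of maps. -/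
abbrev shortComplexOfExact (hfg : Function.Exact f g) : ShortComplex (ModuleCat.{u} A) :=
  ShortComplex.mk (ModuleCat.ofHom f) (ModuleCat.ofHom g) (by
    ext x; exact hfg.apply_apply_eq_zero x)

include hf hg in
theorem shortExact_shortComplexOfExact : (shortComplexOfExact f g hfg).ShortExact where
  exact := by
    exact (ShortComplex.ShortExact.moduleCat_exact_iff_function_exact _).mpr hfg
  mono_f := (ModuleCat.mono_iff_injective _).mpr hf
  epi_g := (ModuleCat.epi_iff_surjective _).mpr hg

include hf hg hfg

theorem ExtZero.covariant_right {i : ℕ} (hY : ExtZero A W Y i) (hX : ExtZero A W X (i + 1)) :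
    ExtZero A W Z i := by
  have hS := shortExact_shortComplexOfExact f g hf hg hfg
  constructor
  suffices ∀ x : Ext (ModuleCat.of A W) (ModuleCat.of A Z) i, x = 0 from
    fun a b => (this a).trans (this b).symm
  intro x
  obtain ⟨y, hy⟩ := Ext.covariant_sequence_exact₃ (ModuleCat.of A W) hS x rfl (hX.elim _ _)
  rw [← hy, hY.elim y 0, Ext.zero_comp]

theorem ExtZero.covariant_mid {i : ℕ} (hX : ExtZero A W X i) (hZ : ExtZero A W Z i) :
    ExtZero A W Y i := by
  have hS := shortExact_shortComplexOfExact f g hf hg hfg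
  constructor
  suffices ∀ x : Ext (ModuleCat.of A W) (ModuleCat.of A Y) i, x = 0 from
    fun a b => (this a).trans (this b).symm
  intro x
  obtain ⟨y, hy⟩ := Ext.covariant_sequence_exact₂ (ModuleCat.of A W) hS x (hZ.elim _ _)
  rw [← hy, hX.elim y 0, Ext.zero_comp]

theorem ExtZero.covariant_left {i : ℕ} (hZ : ExtZero A W Z i) (hY : ExtZero A W Y (i + 1)) :
    ExtZero A W X (i + 1) := by
  have hS := shortExact_shortComplexOfExact f g hf hg hfg
  constructor
  suffices ∀ x : Ext (ModuleCat.of A W) (ModuleCat.of A X) (i + 1), x = 0 from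
    fun a b => (this a).trans (this b).symm
  intro x
  obtain ⟨y, hy⟩ := Ext.covariant_sequence_exact₁ (ModuleCat.of A W) hS x (hY.elim _ _) rfl
  rw [← hy, hZ.elim y 0, Ext.zero_comp]

theorem ExtZero.contravariant_right {i : ℕ} (hX : ExtZero A X W i)
    (hY : ExtZero A Y W (i + 1)) : ExtZero A Z W (i + 1) := by
  have hS := shortExact_shortComplexOfExact f g hf hg hfg
  constructor
  suffices ∀ x : Ext (ModuleCat.of A Z) (ModuleCat.of A W) (i + 1), x = 0 from
    fun a b => (this a).trans (this b).symm
  intro x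
  obtain ⟨y, hy⟩ := Ext.contravariant_sequence_exact₃ hS (ModuleCat.of A W) x
    (hY.elim _ _) (add_comm 1 i)
  rw [← hy, hX.elim y 0, Ext.comp_zero]

theorem ExtZero.exists_lift (h : ExtZero A W X 1) (φ : W →ₗ[A] Z) : ∃ ψ : W →ₗ[A] Y, g ∘ₗ ψ = φ := by
  have hS := shortExact_shortComplexOfExact f g hf hg hfg
  obtain ⟨y, hy⟩ := Ext.covariant_sequence_exact₃ (ModuleCat.of A W) hS
    (Ext.mk₀ (ModuleCat.ofHom φ)) (zero_add 1) (h.elim _ _)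
  obtain ⟨ψ, rfl⟩ := (Ext.mk₀_bijective _ _).2 y
  rw [Ext.mk₀_comp_mk₀, (Ext.mk₀_bijective _ _).1.eq_iff] at hy
  exact ⟨ψ.hom, congrArg ModuleCat.Hom.hom hy⟩

theorem ExtZero.exists_extend (h : ExtZero A Z W 1) (φ : X →ₗ[A] W) :
    ∃ ψ : Y →ₗ[A] W, ψ ∘ₗ f = φ := by
  have hS := shortExact_shortComplexOfExact f g hf hg hfg
  obtain ⟨y, hy⟩ := Ext.contravariant_sequence_exact₁ hS (ModuleCat.of A W)
    (Ext.mk₀ (ModuleCat.ofHom φ)) (add_zero 1) (h.elim _ _)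
  obtain ⟨ψ, rfl⟩ := (Ext.mk₀_bijective _ _).2 y
  rw [Ext.mk₀_comp_mk₀, (Ext.mk₀_bijective _ _).1.eq_iff] at hy
  exact ⟨ψ.hom, congrArg ModuleCat.Hom.hom hy⟩

/-- Since Y is projective, the connecting map from Hom(X, W) to Ext¹(Z, W) is onto, and it kills the
maps that extend to Y. This is how self-injectivity of R and of B is proved. -/
theorem ExtZero.of_exists_extend [Module.Projective A Y]
    (h : ∀ φ : X →ₗ[A] W, ∃ ψ : Y →ₗ[A] W, ψ ∘ₗ f = φ) : ExtZero A Z W 1 := by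
  have hS := shortExact_shortComplexOfExact f g hf hg hfg
  constructor
  suffices ∀ x : Ext (ModuleCat.of A Z) (ModuleCat.of A W) 1, x = 0 from
    fun a b => (this a).trans (this b).symm
  intro x
  obtain ⟨y, hy⟩ := Ext.contravariant_sequence_exact₃ hS (ModuleCat.of A W) x
    ((ExtZero.of_projective (W := Y) (X := W) 0).elim _ _) (add_zero 1)
  obtain ⟨φ, rfl⟩ := (Ext.mk₀_bijective _ _).2 y
  obtain ⟨ψ, hψ⟩ := h φ.hom
  have : φ = (shortComplexOfExact f g hfg).f ≫ ModuleCat.ofHom ψ := by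
    ext1; exact hψ.symm
  rw [← hy, this, ← Ext.mk₀_comp_mk₀, ShortComplex.ShortExact.extClass_comp_assoc]

omit hf hg hfg
end ExtVanishing
end LatticeType

/-! ### Depth and regular sequences through Ext -/

open CategoryTheory Abelian

namespace LatticeType

section Depth

open IsLocalRing RingTheory.Sequence Pointwise

variable {A : Type u} [CommRing A] [IsLocalRing A] [IsNoetherianRing A]
variable {M N : Type u} [AddCommGroup M] [Module A M] [AddCommGroup N] [Module A N]

theorem _root_.WithBot.eNat_le_zero_of_add_natCast_eq {x : WithBot ℕ∞} {n : ℕ}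
    (h : x + (n : WithBot ℕ∞) = n) : x ≤ 0 := by
  induction x with
  | bot => simp
  | coe x =>
    induction x with
    | top => exact absurd h (by
        have : ((⊤ : ℕ∞) : WithBot ℕ∞) + (n : WithBot ℕ∞) = ((⊤ + (n : ℕ∞) : ℕ∞) : WithBot ℕ∞) := rfl
        rw [this, top_add]
        exact fun h => absurd (WithBot.coe_injective (h : _ = ((n : ℕ∞) : WithBot ℕ∞))) (ENat.top_ne_natCast n))
    | coe m =>
      have : m + n = n := by exact_mod_cast h
      have : m = 0 := by omega
      simp [this]

omit [IsLocalRing A] [IsNoetherianRing A] in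
theorem exact_smul_quotSMulTop (y : A) :
    Function.Exact (LinearMap.lsmul A M y)
      (Submodule.mkQ (y • (⊤ : Submodule A M)) : M →ₗ[A] QuotSMulTop y M) := by
  intro x
  simp [Submodule.mem_smul_pointwise_iff_exists]

/-- The cokernel of y on Extⁱ(N, M) embeds in Extⁱ⁺¹(N/yN, M) = 0, so y acts surjectively on a
finite module and Nakayama's lemma applies. -/
theorem ExtZero.of_quotSMulTop [Module.Finite A N] [Module.Finite A M] {y : A}
    (hy : y ∈ maximalIdeal A) (hreg : IsSMulRegular N y) {i : ℕ}
    (h : ExtZero A (QuotSMulTop y N) M (i + 1)) : ExtZero A N M i := by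
  have hS := shortExact_shortComplexOfExact (LinearMap.lsmul A N y)
    (Submodule.mkQ (y • (⊤ : Submodule A N)) : N →ₗ[A] QuotSMulTop y N) hreg
    (Submodule.mkQ_surjective _) (exact_smul_quotSMulTop y)
  unfold ExtZero
  by_contra ntr
  rw [not_subsingleton_iff_nontrivial] at ntr
  have hj : y ∈ (Module.annihilator A (Ext (ModuleCat.of A N) (ModuleCat.of A M) i)).jacobson :=
    (IsLocalRing.maximalIdeal_le_jacobson _) hy
  refine Submodule.top_ne_pointwise_smul_of_mem_jacobson_annihilator hj (eq_top_iff.mpr ?_).symm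
  intro x _
  obtain ⟨z, hz⟩ := Ext.contravariant_sequence_exact₁ hS (ModuleCat.of A M) x (add_comm 1 i)
    (h.elim _ _)
  have e : (Ext.mk₀ (ModuleCat.ofHom (LinearMap.lsmul A N y))).comp z (zero_add i) = y • z := by
    have : ModuleCat.ofHom (LinearMap.lsmul A N y) = y • 𝟙 (ModuleCat.of A N) := rfl
    rw [this, Ext.mk₀_smul, Ext.smul_comp, Ext.mk₀_id_comp]
  rw [← hz, e]
  exact Submodule.smul_mem_pointwise_smul _ _ ⊤ trivial

theorem ExtZero.of_quotient_ofList [Module.Finite A M] (ys : List A) :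
    ∀ (N : Type u) [AddCommGroup N] [Module A N] [Module.Finite A N] (n : ℕ),
      (∀ y ∈ ys, y ∈ maximalIdeal A) → IsWeaklyRegular N ys →
      (∀ i < n + ys.length, ExtZero A (N ⧸ (Ideal.ofList ys • (⊤ : Submodule A N))) M i) →
      ∀ i < n, ExtZero A N M i := by
  induction ys with
  | nil =>
    intro N _ _ _ n _ _ h i hi
    refine (h i (by simpa using hi)).congr_left (Submodule.quotEquivOfEqBot _ ?_)
    simp
  | cons y ys ih =>
    intro N _ _ _ n hy hreg h i hi
    rw [isWeaklyRegular_cons_iff] at hreg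
    refine ExtZero.of_quotSMulTop (hy y (by simp)) hreg.1 ?_
    refine ih (QuotSMulTop y N) (n + 1) (fun z hz => hy z (by simp [hz])) hreg.2 ?_ (i + 1)
      (by omega)
    intro j hj
    exact (h j (by simp; omega)).congr_left
      (Submodule.quotOfListConsSMulTopEquivQuotSMulTopInner N y ys)

/-- Depth sensitivity: a sequence that is weakly regular on a cyclic module `N` with
`ann N ⊆ ann M`, and whose quotient of `N` has no `Ext` into `M` below the length of the sequence,
is weakly regular on `M`. -/
theorem isWeaklyRegular_of_extZero (ys : List A) :
    ∀ (N M : Type u) [AddCommGroup N] [Module A N] [Module.Finite A N] [AddCommGroup M]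
      [Module A M] [Module.Finite A M] (n₀ : N), (∀ n : N, ∃ a : A, n = a • n₀) →
      (∀ m : M, ∃ h : N →ₗ[A] M, h n₀ = m) →
      (∀ y ∈ ys, y ∈ maximalIdeal A) → IsWeaklyRegular N ys →
      (∀ i < ys.length, ExtZero A (N ⧸ (Ideal.ofList ys • (⊤ : Submodule A N))) M i) →
      IsWeaklyRegular M ys := by
  induction ys with
  | nil => intros; simp
  | cons y ys ih =>
    intro N M _ _ _ _ _ _ n₀ hn hm hy hreg h
    rw [isWeaklyRegular_cons_iff] at hreg ⊢
    have h' : ∀ i < ys.length + 1, ExtZero A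
        (QuotSMulTop y N ⧸ (Ideal.ofList ys • (⊤ : Submodule A (QuotSMulTop y N)))) M i :=
      fun j hj => (h j (by simpa using hj)).congr_left
        (Submodule.quotOfListConsSMulTopEquivQuotSMulTopInner N y ys)
    have h0 : ExtZero A (QuotSMulTop y N) M 0 :=
      ExtZero.of_quotient_ofList ys (QuotSMulTop y N) 1 (fun z hz => hy z (by simp [hz])) hreg.2
        (fun i hi => h' i (by omega)) 0 (by omega)
    -- An element m with ym = 0 is the image of the generator under a map that factors through N/yN,
    -- and Hom(N/yN, M) = 0.
    have hMreg : IsSMulRegular M y := by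
      rw [isSMulRegular_iff_right_eq_zero_of_smul]
      intro m hym
      obtain ⟨φ, hφ⟩ := hm m
      have hk : y • (⊤ : Submodule A N) ≤ LinearMap.ker φ := by
        intro x hx
        obtain ⟨z, -, rfl⟩ := (Submodule.mem_smul_pointwise_iff_exists _ _ _).mp hx
        obtain ⟨a, rfl⟩ := hn z
        simp [hφ, smul_comm y a m, hym]
      have := extZero_zero_iff.mp h0 ((y • (⊤ : Submodule A N)).liftQ φ hk)
      have h2 := congrArg (fun t => t (Submodule.Quotient.mk n₀)) this
      rw [← hφ]
      simpa using h2
    refine ⟨hMreg, ?_⟩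
    refine ih (QuotSMulTop y N) (QuotSMulTop y M) (Submodule.Quotient.mk n₀) ?_ ?_
      (fun z hz => hy z (by simp [hz])) hreg.2 ?_
    · intro n
      obtain ⟨n, rfl⟩ := Submodule.Quotient.mk_surjective _ n
      obtain ⟨a, rfl⟩ := hn n
      exact ⟨a, rfl⟩
    · intro m
      obtain ⟨m, rfl⟩ := Submodule.Quotient.mk_surjective _ m
      obtain ⟨φ, hφ⟩ := hm m
      refine ⟨QuotSMulTop.map y φ, ?_⟩
      rw [← hφ]
      rfl
    -- Replacing M by M/yM costs one degree of vanishing, as in 0 → M → M → M/yM → 0; the shorter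
    -- sequence needs one degree less.
    · intro i hi
      exact ExtZero.covariant_right (LinearMap.lsmul A M y)
        (Submodule.mkQ (y • (⊤ : Submodule A M)) : M →ₗ[A] QuotSMulTop y M) hMreg
        (Submodule.mkQ_surjective _) (exact_smul_quotSMulTop y) (h' i (by omega))
        (h' (i + 1) (by omega))

/-- Rees's theorem: N is supported at the maximal ideal. The zero module is treated apart because
the sequence is then only weakly regular. -/
theorem ExtZero.of_isWeaklyRegular [Module.Finite A M] [Module.Finite A N] (rs : List A)
    (hrs : ∀ r ∈ rs, r ∈ maximalIdeal A) (hreg : IsWeaklyRegular M rs) {e : ℕ}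
    (hN : maximalIdeal A ^ e ≤ Module.annihilator A N) :
    ∀ i < rs.length, ExtZero A N M i := by
  intro i hi
  rcases subsingleton_or_nontrivial M with hM | hM
  · cases i with
    | zero => exact extZero_zero_iff.mpr fun f => by ext; exact Subsingleton.elim _ _
    | succ i =>
      exact ⟨fun a b => by
        have h0 : ∀ c : Ext (ModuleCat.of A N) (ModuleCat.of A M) (i + 1), c = 0 := fun c => by
          rw [← Ext.comp_mk₀_id c]
          have : 𝟙 (ModuleCat.of A M) = 0 := by ext; exact Subsingleton.elim _ _
          rw [this]; simp
        rw [h0 a, h0 b]⟩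
  · have hlt : maximalIdeal A • (⊤ : Submodule A M) < ⊤ :=
      (Submodule.top_ne_ideal_smul_of_le_jacobson_annihilator
        (IsLocalRing.maximalIdeal_le_jacobson _)).symm.lt_top
    refine ModuleCat.subsingleton_ext_of_exists_isRegular (maximalIdeal A) (ModuleCat.of A N) ?_
      (ModuleCat.of A M) hlt rs hrs ?_ i hi
    · rw [Module.support_eq_zeroLocus, PrimeSpectrum.zeroLocus_subset_zeroLocus_iff]
      intro x hx
      exact ⟨e, hN (Ideal.pow_mem_pow hx e)⟩
    · refine ⟨hreg, fun h => ?_⟩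
      refine (lt_of_le_of_lt (Submodule.smul_mono_left ?_) hlt).ne h.symm
      rw [Ideal.ofList, Ideal.span_le]
      exact hrs

/-- Depth depends only on the radical of the ideal, so the sequence may be chosen inside any
prescribed power of the maximal ideal. This freedom is used later to place it inside stable
annihilators. -/
theorem exists_isWeaklyRegular_of_extZero [Module.Finite A M] {n : ℕ} (e : ℕ)
    (h : ∀ i < n, ExtZero A (ResidueField A) M i) :
    ∃ rs : List A, rs.length = n ∧ (∀ r ∈ rs, r ∈ maximalIdeal A ∧ r ∈ maximalIdeal A ^ e) ∧
      IsWeaklyRegular M rs := by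
  rcases subsingleton_or_nontrivial M with hM | hM
  · refine ⟨List.replicate n 0, by simp, fun r hr => ?_, ?_⟩
    · rw [List.eq_of_mem_replicate hr]; simp
    · clear h
      induction n generalizing M with
      | zero => simp
      | succ n ih =>
        rw [List.replicate_succ, isWeaklyRegular_cons_iff]
        exact ⟨fun a b _ => Subsingleton.elim _ _, ih inferInstance⟩
  · have hle : maximalIdeal A ^ (e + 1) ≤ maximalIdeal A := Ideal.pow_le_self (by omega)
    have hlt : maximalIdeal A ^ (e + 1) • (⊤ : Submodule A M) < ⊤ :=
      lt_of_le_of_lt (Submodule.smul_mono_left hle)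
        (Submodule.top_ne_ideal_smul_of_le_jacobson_annihilator
          (IsLocalRing.maximalIdeal_le_jacobson _)).symm.lt_top
    obtain ⟨rs, hlen, hmem, hreg⟩ := ModuleCat.exists_isRegular_of_exists_subsingleton_ext
      (maximalIdeal A ^ (e + 1)) n (ModuleCat.of A M) hlt (ModuleCat.of A (ResidueField A)) (by
        rw [Module.support_eq_zeroLocus]
        have : Module.annihilator A (ResidueField A) = maximalIdeal A :=
          Ideal.annihilator_quotient
        rw [this, PrimeSpectrum.zeroLocus_pow _ (by omega)]) h
    exact ⟨rs, hlen, fun r hr => ⟨hle (hmem r hr), Ideal.pow_le_pow_right (by omega) (hmem r hr)⟩,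
      hreg.toIsWeaklyRegular⟩

variable {D : ℕ}

/-- In this form, stability under retracts, products and syzygies follows from long exact sequences.
-/
theorem isMaximalCohenMacaulay_iff [Module.Finite A M] (hD : ringKrullDim A = (D : ℕ)) :
    IsMaximalCohenMacaulay A M ↔ ∀ i < D, ExtZero A (ResidueField A) M i := by
  constructor
  · rintro ⟨rs, hrs, hreg, hlen⟩ i hi
    have hl : rs.length = D := by
      rw [hD] at hlen
      exact_mod_cast hlen
    refine ExtZero.of_isWeaklyRegular rs hrs hreg (e := 1) ?_ i (hl ▸ hi)
    rw [pow_one]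
    exact (Ideal.annihilator_quotient (I := maximalIdeal A)).ge
  · intro h
    obtain ⟨rs, hlen, hmem, hreg⟩ := exists_isWeaklyRegular_of_extZero 0 h
    exact ⟨rs, fun r hr => (hmem r hr).1, hreg, by rw [hD, hlen]; rfl⟩

/-- A regular sequence of maximal length cuts out an ideal primary to the maximal ideal. -/
theorem exists_pow_le_ofList (hD : ringKrullDim A = (D : ℕ)) (ys : List A) (hlen : ys.length = D)
    (hys : ∀ y ∈ ys, y ∈ maximalIdeal A) (hreg : IsWeaklyRegular A ys) :
    ∃ e, maximalIdeal A ^ e ≤ Ideal.ofList ys := by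
  have hle : Ideal.ofList ys ≤ maximalIdeal A := by
    rw [Ideal.ofList, Ideal.span_le]; exact hys
  have hR : IsRegular A ys := ⟨hreg, fun h => by
    rw [smul_eq_mul, Ideal.mul_top] at h
    exact (Ideal.IsPrime.ne_top inferInstance) (top_le_iff.mp (h.le.trans hle))⟩
  have hdim := ringKrullDim_add_length_eq_ringKrullDim_of_isRegular ys hR
  have hnt : Nontrivial (A ⧸ Ideal.ofList ys) :=
    Ideal.Quotient.nontrivial_iff.mpr fun h =>
      (Ideal.IsPrime.ne_top inferInstance) (top_le_iff.mp (h.symm.le.trans hle))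
  have h0 : Ring.KrullDimLE 0 (A ⧸ Ideal.ofList ys) := by
    rw [Ring.krullDimLE_iff]
    rw [hD, hlen] at hdim
    exact WithBot.eNat_le_zero_of_add_natCast_eq hdim
  have hrad : maximalIdeal A ≤ (Ideal.ofList ys).radical := by
    rw [Ideal.radical_eq_sInf]
    refine le_sInf fun p hp => ?_
    obtain ⟨hp1, hp2⟩ := hp
    have : (p.map (Ideal.Quotient.mk (Ideal.ofList ys))).IsPrime :=
      Ideal.map_isPrime_of_surjective Ideal.Quotient.mk_surjective (by simpa using hp1)
    have hmax : (p.map (Ideal.Quotient.mk (Ideal.ofList ys))).IsMaximal := inferInstance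
    have := Ideal.comap_isMaximal_of_surjective (Ideal.Quotient.mk (Ideal.ofList ys))
      Ideal.Quotient.mk_surjective (K := p.map (Ideal.Quotient.mk (Ideal.ofList ys)))
    rw [Ideal.comap_map_of_surjective _ Ideal.Quotient.mk_surjective] at this
    have hp : p ⊔ Ideal.comap (Ideal.Quotient.mk (Ideal.ofList ys)) ⊥ = p := by
      rw [sup_eq_left, ← RingHom.ker_eq_comap_bot, Ideal.mk_ker]; exact hp1
    rw [hp] at this
    exact (IsLocalRing.eq_maximalIdeal this).ge
  exact Ideal.exists_pow_le_of_le_radical_of_fg hrad (IsNoetherian.noetherian _)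

/-- A regular sequence of maximal length on the ring is weakly regular on every maximal
Cohen-Macaulay module. -/
theorem IsMaximalCohenMacaulay.isWeaklyRegular [Module.Finite A M]
    (h : IsMaximalCohenMacaulay A M) (hD : ringKrullDim A = (D : ℕ)) (ys : List A)
    (hlen : ys.length = D) (hys : ∀ y ∈ ys, y ∈ maximalIdeal A) (hreg : IsWeaklyRegular A ys) :
    IsWeaklyRegular M ys := by
  obtain ⟨rs, hrs, hreg', hlen'⟩ := h
  have hl : rs.length = D := by
    rw [hD] at hlen'
    exact_mod_cast hlen'
  obtain ⟨e, he⟩ := exists_pow_le_ofList hD ys hlen hys hreg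
  -- The cyclic module is A itself. Its quotient by the sequence is killed by a power of the maximal
  -- ideal, so a maximal regular sequence on M makes the required Ext groups vanish.
  refine isWeaklyRegular_of_extZero ys A M 1 (fun n => ⟨n, by simp⟩)
    (fun m => ⟨LinearMap.toSpanSingleton A M m, by simp⟩) hys hreg fun i hi => ?_
  refine ExtZero.of_isWeaklyRegular rs hrs hreg' (e := e) ?_ i (by omega)
  rw [smul_eq_mul, Ideal.mul_top, Ideal.annihilator_quotient]
  exact he

end Depth
end LatticeType

/-! ### Stable annihilators and projectivity on the punctured spectrum -/

namespace LatticeType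

section StableAnnihilator

open IsLocalRing

variable {A : Type u} [CommRing A]
variable {M N P X Y Z : Type u} [AddCommGroup M] [Module A M] [AddCommGroup N] [Module A N]
  [AddCommGroup P] [Module A P] [AddCommGroup X] [Module A X] [AddCommGroup Y] [Module A Y]
  [AddCommGroup Z] [Module A Z]

theorem exists_comp_eq_of_exact_left {f : X →ₗ[A] Y} {g : Y →ₗ[A] Z} (hf : Function.Injective f)
    (hfg : Function.Exact f g) (h : M →ₗ[A] Y) (hh : ∀ m, g (h m) = 0) :
    ∃ k : M →ₗ[A] X, ∀ m, f (k m) = h m := by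
  let e := LinearEquiv.ofInjective f hf
  refine ⟨e.symm.toLinearMap ∘ₗ h.codRestrict (LinearMap.range f) fun m => (hfg _).mp (hh m), ?_⟩
  intro m
  have : ∀ z : LinearMap.range f, f (e.symm z) = z := fun z =>
    congrArg Subtype.val (e.apply_symm_apply z)
  exact this _

theorem exists_comp_eq_of_exact_right {f : X →ₗ[A] Y} {g : Y →ₗ[A] Z}
    (hg : Function.Surjective g) (hfg : Function.Exact f g) (h : Y →ₗ[A] M)
    (hh : ∀ x, h (f x) = 0) : ∃ k : Z →ₗ[A] M, ∀ y, k (g y) = h y := by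
  have hk : LinearMap.ker g ≤ LinearMap.ker h := by
    intro y hy
    obtain ⟨x, rfl⟩ := (hfg y).mp hy
    exact hh x
  refine ⟨(LinearMap.ker g).liftQ _ hk ∘ₗ (g.quotKerEquivOfSurjective hg).symm.toLinearMap, ?_⟩
  intro y
  have : (g.quotKerEquivOfSurjective hg).symm (g y) = Submodule.Quotient.mk y := by
    rw [LinearEquiv.symm_apply_eq]; rfl
  simp [this]

theorem mem_projectiveMaps_of_comp [hP : Module.Projective A P] (g : M →ₗ[A] P) (h : P →ₗ[A] N) :
    h ∘ₗ g ∈ projectiveMaps A M N :=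
  ⟨ModuleCat.of A P, g, h, hP, rfl⟩

theorem comp_mem_projectiveMaps {f : M →ₗ[A] N} (hf : f ∈ projectiveMaps A M N)
    (g : X →ₗ[A] M) (h : N →ₗ[A] Y) : h ∘ₗ f ∘ₗ g ∈ projectiveMaps A X Y := by
  obtain ⟨P, a, b, hP, rfl⟩ := hf
  exact ⟨P, a ∘ₗ g, h ∘ₗ b, hP, rfl⟩

theorem comp_left_mem_projectiveMaps {f : M →ₗ[A] N} (hf : f ∈ projectiveMaps A M N)
    (h : N →ₗ[A] Y) : h ∘ₗ f ∈ projectiveMaps A M Y :=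
  comp_mem_projectiveMaps hf LinearMap.id h

/-- A map factors through a projective module iff it lifts along one, equivalently any, surjection
from a projective module. -/
theorem mem_projectiveMaps_iff_exists_lift [Module.Projective A P] (π : P →ₗ[A] N)
    (hπ : Function.Surjective π) (f : M →ₗ[A] N) :
    f ∈ projectiveMaps A M N ↔ ∃ g : M →ₗ[A] P, π ∘ₗ g = f := by
  constructor
  · rintro ⟨Q, g, h, hQ, rfl⟩
    obtain ⟨k, hk⟩ := Module.projective_lifting_property π h hπ
    exact ⟨k ∘ₗ g, by rw [← LinearMap.comp_assoc, hk]⟩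
  · rintro ⟨g, rfl⟩
    exact mem_projectiveMaps_of_comp g π

variable (A) in
/-- The ideal of all `a` such that multiplication by `a` on `M` factors through a projective
module. -/
def stableAnnihilator (M : Type u) [AddCommGroup M] [Module A M] : Ideal A :=
  (projectiveMaps A M M).comap (LinearMap.toSpanSingleton A (M →ₗ[A] M) LinearMap.id)

theorem mem_stableAnnihilator {a : A} :
    a ∈ stableAnnihilator A M ↔ a • (LinearMap.id : M →ₗ[A] M) ∈ projectiveMaps A M M := by
  simp [stableAnnihilator]

theorem mem_stableAnnihilator_iff_exists_lift [Module.Projective A P] (π : P →ₗ[A] M)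
    (hπ : Function.Surjective π) {a : A} :
    a ∈ stableAnnihilator A M ↔ ∃ s : M →ₗ[A] P, π ∘ₗ s = a • LinearMap.id := by
  rw [mem_stableAnnihilator, mem_projectiveMaps_iff_exists_lift π hπ]

variable (A) in
/-- `M` is a retract (a direct summand up to isomorphism) of `N`. -/
def IsRetract (M N : Type u) [AddCommGroup M] [Module A M] [AddCommGroup N] [Module A N] : Prop :=
  ∃ (i : M →ₗ[A] N) (p : N →ₗ[A] M), p ∘ₗ i = LinearMap.id

theorem IsRetract.of_equiv (e : M ≃ₗ[A] N) : IsRetract A M N :=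
  ⟨e.toLinearMap, e.symm.toLinearMap, by ext; simp⟩

theorem IsRetract.trans (h₁ : IsRetract A M N) (h₂ : IsRetract A N P) : IsRetract A M P := by
  obtain ⟨i, p, h⟩ := h₁
  obtain ⟨j, q, h'⟩ := h₂
  refine ⟨j ∘ₗ i, p ∘ₗ q, ?_⟩
  ext x
  have h1 := LinearMap.congr_fun h' (i x)
  have h2 := LinearMap.congr_fun h x
  simp only [LinearMap.comp_apply, LinearMap.id_apply] at h1 h2 ⊢
  rw [h1, h2]

theorem IsRetract.surjective (h : IsRetract A M N) : ∃ p : N →ₗ[A] M, Function.Surjective p := by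
  obtain ⟨i, p, h⟩ := h
  exact ⟨p, fun m => ⟨i m, LinearMap.congr_fun h m⟩⟩

theorem IsRetract.finite (h : IsRetract A M N) [Module.Finite A N] : Module.Finite A M := by
  obtain ⟨p, hp⟩ := h.surjective
  exact Module.Finite.of_surjective p hp

theorem IsRetract.fst : IsRetract A M (M × N) :=
  ⟨LinearMap.inl A M N, LinearMap.fst A M N, by ext; simp⟩

theorem IsRetract.snd : IsRetract A N (M × N) :=
  ⟨LinearMap.inr A M N, LinearMap.snd A M N, by ext; simp⟩

theorem IsRetract.stableAnnihilator_le (h : IsRetract A M N) :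
    stableAnnihilator A N ≤ stableAnnihilator A M := by
  obtain ⟨i, p, h⟩ := h
  intro a ha
  rw [mem_stableAnnihilator] at ha ⊢
  have := comp_mem_projectiveMaps ha i p
  have e : p ∘ₗ (a • LinearMap.id) ∘ₗ i = a • (LinearMap.id : M →ₗ[A] M) := by
    rw [← h]; ext; simp
  rwa [e] at this

theorem inf_stableAnnihilator_le_prod :
    stableAnnihilator A M ⊓ stableAnnihilator A N ≤ stableAnnihilator A (M × N) := by
  rintro a ⟨h₁, h₂⟩
  have h₁ := comp_mem_projectiveMaps (mem_stableAnnihilator.mp h₁) (LinearMap.fst A M N)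
    (LinearMap.inl A M N)
  have h₂ := comp_mem_projectiveMaps (mem_stableAnnihilator.mp h₂) (LinearMap.snd A M N)
    (LinearMap.inr A M N)
  rw [mem_stableAnnihilator]
  convert add_mem h₁ h₂ using 1
  ext <;> simp

theorem stableAnnihilator_eq_top [Module.Projective A M] : stableAnnihilator A M = ⊤ := by
  rw [eq_top_iff]
  intro a _
  rw [mem_stableAnnihilator]
  exact mem_projectiveMaps_of_comp (P := M) (LinearMap.id : M →ₗ[A] M) (a • LinearMap.id)

theorem annihilator_le_stableAnnihilator : Module.annihilator A M ≤ stableAnnihilator A M := by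
  intro a ha
  rw [mem_stableAnnihilator]
  have : a • (LinearMap.id : M →ₗ[A] M) = 0 := by
    ext x; simpa using Module.mem_annihilator.mp ha x
  rw [this]
  exact zero_mem _

/-- Stable annihilators grow under syzygies. -/
theorem stableAnnihilator_le_of_exact [Module.Projective A Y] (f : X →ₗ[A] Y) (g : Y →ₗ[A] Z)
    (hf : Function.Injective f) (hg : Function.Surjective g) (hfg : Function.Exact f g) :
    stableAnnihilator A Z ≤ stableAnnihilator A X := by
  intro a ha
  obtain ⟨s, hs⟩ := (mem_stableAnnihilator_iff_exists_lift g hg).mp ha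
  have hk : ∀ y, g (a • y - s (g y)) = 0 := fun y => by
    have := LinearMap.congr_fun hs (g y)
    simp only [LinearMap.comp_apply, LinearMap.smul_apply, LinearMap.id_apply] at this
    rw [map_sub, this, map_smul, sub_self]
  obtain ⟨φ, hφ⟩ := exists_comp_eq_of_exact_left hf hfg (a • LinearMap.id - s ∘ₗ g) hk
  rw [mem_stableAnnihilator]
  have : a • (LinearMap.id : X →ₗ[A] X) = φ ∘ₗ f := by
    ext x
    apply hf
    simp [hφ, hfg.apply_apply_eq_zero x]
  rw [this]
  exact mem_projectiveMaps_of_comp f _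

/-- Stable annihilators grow under cosyzygies. -/
theorem stableAnnihilator_le_of_exact_of_extend [Module.Projective A Y] [Module.Projective A P]
    (f : X →ₗ[A] Y) (g : Y →ₗ[A] Z)
    (hg : Function.Surjective g) (hfg : Function.Exact f g)
    (π : P →ₗ[A] X) (hπ : Function.Surjective π)
    (hext : ∀ φ : X →ₗ[A] P, ∃ ψ : Y →ₗ[A] P, ψ ∘ₗ f = φ) :
    stableAnnihilator A X ≤ stableAnnihilator A Z := by
  intro a ha
  obtain ⟨s, hs⟩ := (mem_stableAnnihilator_iff_exists_lift π hπ).mp ha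
  obtain ⟨ψ, hψ⟩ := hext s
  obtain ⟨k, hk⟩ := exists_comp_eq_of_exact_right hg hfg (a • LinearMap.id - f ∘ₗ π ∘ₗ ψ) (by
    intro x
    have h1 := LinearMap.congr_fun hψ x
    have h2 := LinearMap.congr_fun hs x
    simp only [LinearMap.comp_apply, LinearMap.smul_apply, LinearMap.id_apply] at h1 h2
    simp [h1, h2])
  rw [mem_stableAnnihilator_iff_exists_lift g hg]
  refine ⟨k, ?_⟩
  ext z
  obtain ⟨y, rfl⟩ := hg z
  simp [hk, hfg.apply_apply_eq_zero]

end StableAnnihilator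

section PuncturedSpectrum

open IsLocalRing

variable {A : Type u} [CommRing A]
variable {M P : Type u} [AddCommGroup M] [Module A M] [AddCommGroup P] [Module A P]

/-- At p the element a becomes invertible, so t divided by a splits s. -/
theorem projective_localizedModule_of_comp [Module.Projective A P] (p : Ideal A) [p.IsPrime] {a : A}
    (ha : a ∉ p) (s : M →ₗ[A] P) (t : P →ₗ[A] M) (h : t ∘ₗ s = a • LinearMap.id) :
    Module.Projective (Localization.AtPrime p) (LocalizedModule p.primeCompl M) := by
  let S := p.primeCompl
  have : Module.Projective (Localization S) (LocalizedModule S P) := inferInstance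
  let b : Localization S := Localization.mk 1 ⟨a, ha⟩
  refine Module.Projective.of_split (M := LocalizedModule S P) (LocalizedModule.map S s)
    (b • LocalizedModule.map S t) ?_
  ext x
  induction x with
  | h m c =>
    have hm := LinearMap.congr_fun h m
    simp only [LinearMap.comp_apply, LinearMap.smul_apply, LinearMap.id_apply] at hm
    simp only [LinearMap.comp_apply, LinearMap.smul_apply, LinearMap.id_apply,
      LocalizedModule.map_mk, hm, b, LocalizedModule.mk_smul_mk, one_smul]
    exact LocalizedModule.mk_cancel_common_left ⟨a, ha⟩ c m

/-- A splitting of a presentation at p spreads out: c clears the denominators of the section and c'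
those of the identity it satisfies, so c'c lies in the stable annihilator but not in p. -/
theorem not_stableAnnihilator_le [IsNoetherianRing A] [Module.Finite A M] (p : Ideal A) [p.IsPrime]
    (h : Module.Projective (Localization.AtPrime p) (LocalizedModule p.primeCompl M)) :
    ¬ stableAnnihilator A M ≤ p := by
  let S := p.primeCompl
  obtain ⟨n, π, hπ⟩ := Module.Finite.exists_fin' A M
  obtain ⟨σ, hσ⟩ := Module.projective_lifting_property (LocalizedModule.map S π)
    (LinearMap.id : LocalizedModule S M →ₗ[Localization S] LocalizedModule S M)
    (LocalizedModule.map_surjective S π hπ)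
  have : Module.FinitePresentation A M := Module.finitePresentation_of_finite A M
  obtain ⟨s, c, hs⟩ := Module.FinitePresentation.exists_lift_of_isLocalizedModule S
    (LocalizedModule.mkLinearMap S (Fin n → A))
    ((σ.restrictScalars A) ∘ₗ LocalizedModule.mkLinearMap S M)
  obtain ⟨c', hc'⟩ := Module.Finite.exists_smul_of_comp_eq_of_isLocalizedModule S
    (LocalizedModule.mkLinearMap S M) (π ∘ₗ s) ((c : A) • LinearMap.id) (by
      ext m
      have h1 := LinearMap.congr_fun hs m
      have h2 := congrArg ((LocalizedModule.map S π).restrictScalars A) h1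
      have h3 := LinearMap.congr_fun hσ (LocalizedModule.mk m 1)
      simp only [LinearMap.comp_apply, LocalizedModule.mkLinearMap_apply, LocalizedModule.map_mk,
        LinearMap.smul_apply, LinearMap.id_apply, LinearMap.restrictScalars_apply,
        Submonoid.smul_def, map_smul] at h1 h2 h3 ⊢
      rw [h2, h3])
  intro hle
  have hmem : (c' * c : A) ∈ stableAnnihilator A M := by
    rw [mem_stableAnnihilator_iff_exists_lift π hπ]
    refine ⟨(c' : A) • s, ?_⟩
    rw [LinearMap.comp_smul, mul_smul]
    exact hc'
  exact (S.mul_mem c'.2 c.2) (hle hmem)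

/-- The stable annihilator cuts out the locus where M is not projective, so being projective off the
closed point means containing a power of the maximal ideal. The condition on the dual is then
automatic: dualizing a factorization of a·id through a free module gives one for the dual. -/
theorem isLattice_iff [IsLocalRing A] [IsNoetherianRing A] :
    IsLattice A M ↔ Module.Finite A M ∧ IsMaximalCohenMacaulay A M ∧
      ∃ e, maximalIdeal A ^ e ≤ stableAnnihilator A M := by
  constructor
  · intro h
    have := h.finite
    refine ⟨h.finite, h.maximalCohenMacaulay, ?_⟩
    refine Ideal.exists_pow_le_of_le_radical_of_fg ?_ (IsNoetherian.noetherian _)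
    rw [Ideal.radical_eq_sInf]
    refine le_sInf fun p hp => ?_
    obtain ⟨hp1, hp2⟩ := hp
    by_contra hne
    exact not_stableAnnihilator_le p (h.projective_localization p fun h => hne h.ge) hp1
  · rintro ⟨hfin, hmcm, e, he⟩
    obtain ⟨n, π, hπ⟩ := Module.Finite.exists_fin' A M
    have key : ∀ (p : Ideal A) [p.IsPrime], p ≠ maximalIdeal A →
        ∃ a ∉ p, ∃ s : M →ₗ[A] (Fin n → A), π ∘ₗ s = a • LinearMap.id := by
      intro p hp hpm
      have : ¬ maximalIdeal A ^ e ≤ p := fun h =>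
        hpm (le_antisymm (le_maximalIdeal hp.ne_top) (Ideal.IsPrime.le_of_pow_le h))
      obtain ⟨a, ha, hap⟩ := SetLike.not_le_iff_exists.mp this
      exact ⟨a, hap, (mem_stableAnnihilator_iff_exists_lift π hπ).mp (he ha)⟩
    refine ⟨hfin, hmcm, fun p hp hpm => ?_, fun p hp hpm => ?_⟩
    · obtain ⟨a, ha, s, hs⟩ := key p hpm
      exact projective_localizedModule_of_comp p ha s π hs
    · obtain ⟨a, ha, s, hs⟩ := key p hpm
      refine projective_localizedModule_of_comp (P := Module.Dual A (Fin n → A)) p ha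
        (LinearMap.lcomp A A π) (LinearMap.lcomp A A s) ?_
      ext l m
      have := LinearMap.congr_fun hs m
      simp only [LinearMap.comp_apply, LinearMap.smul_apply, LinearMap.id_apply] at this
      simp [this]

end PuncturedSpectrum
end LatticeType

/-! ### Lattices and lat-injectives over a Gorenstein ring -/

open CategoryTheory Abelian

namespace LatticeType

section ExtRetract

variable {A : Type u} [CommRing A]
variable {M N W : Type u} [AddCommGroup M] [Module A M] [AddCommGroup N] [Module A N]
  [AddCommGroup W] [Module A W]

theorem ExtZero.of_isRetract_right {i : ℕ} (h : ExtZero A W N i) (hr : IsRetract A M N) :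
    ExtZero A W M i := by
  obtain ⟨j, p, hjp⟩ := hr
  constructor
  have key : ∀ c : Ext (ModuleCat.of A W) (ModuleCat.of A M) i, c = 0 := by
    intro c
    have e : ModuleCat.ofHom j ≫ ModuleCat.ofHom p = 𝟙 _ := by
      rw [← ModuleCat.ofHom_comp, hjp]; rfl
    rw [← Ext.comp_mk₀_id c, ← e, ← Ext.mk₀_comp_mk₀,
      ← Ext.comp_assoc_of_second_deg_zero, h.elim (c.comp _ _) 0, Ext.zero_comp]
  exact fun a b => (key a).trans (key b).symm

theorem ExtZero.prod_right {i : ℕ} (hM : ExtZero A W M i) (hN : ExtZero A W N i) :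
    ExtZero A W (M × N) i :=
  ExtZero.covariant_mid (LinearMap.inl A M N) (LinearMap.snd A M N) LinearMap.inl_injective
    LinearMap.snd_surjective Function.Exact.inl_snd hM hN

theorem ExtZero.of_subsingleton_right [Subsingleton M] (i : ℕ) : ExtZero A W M i := by
  constructor
  have h0 : ∀ c : Ext (ModuleCat.of A W) (ModuleCat.of A M) i, c = 0 := fun c => by
    rw [← Ext.comp_mk₀_id c]
    have : 𝟙 (ModuleCat.of A M) = 0 := by ext; exact Subsingleton.elim _ _
    rw [this]; simp
  exact fun a b => (h0 a).trans (h0 b).symm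

theorem ExtZero.pi_right {i : ℕ} (h : ExtZero A W M i) (n : ℕ) : ExtZero A W (Fin n → M) i := by
  induction n with
  | zero => exact ExtZero.of_subsingleton_right i
  | succ n ih => exact (h.prod_right ih).congr_right (Fin.consLinearEquiv A fun _ => M)

end ExtRetract

open IsLocalRing

/-- The properties of complete hypersurface rings on which the theory of lattices rests: a
Noetherian local ring that is Cohen-Macaulay and self-injective on maximal Cohen-Macaulay modules,
over which maximal Cohen-Macaulay modules have cosyzygies, and over which finite commutative
algebras without nontrivial idempotents are local. -/
structure IsHenselianGorenstein (A : Type u) [CommRing A] [IsLocalRing A] : Prop where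
  isNoetherianRing : IsNoetherianRing A
  exists_dim : ∃ D : ℕ, ringKrullDim A = (D : ℕ)
  cohenMacaulay : IsMaximalCohenMacaulay A A
  extZero : ∀ (M : Type u) [AddCommGroup M] [Module A M], Module.Finite A M →
    IsMaximalCohenMacaulay A M → ExtZero A M A 1
  exists_cosyzygy : ∀ (M : Type u) [AddCommGroup M] [Module A M], Module.Finite A M →
    IsMaximalCohenMacaulay A M → ∃ (n : ℕ) (Z : ModuleCat.{u} A) (f : M →ₗ[A] (Fin n → A))
      (g : (Fin n → A) →ₗ[A] Z), Function.Injective f ∧ Function.Surjective g ∧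
      Function.Exact f g ∧ IsMaximalCohenMacaulay A Z
  isLocalRing_of_idempotents : ∀ (C : Type u) [CommRing C] [Algebra A C] [Nontrivial C],
    Module.Finite A C → (∀ e : C, e * e = e → e = 0 ∨ e = 1) → IsLocalRing C

section MCM

variable {A : Type u} [CommRing A] [IsLocalRing A]
variable {M N P X Y Z : Type u} [AddCommGroup M] [Module A M] [AddCommGroup N] [Module A N]
  [AddCommGroup P] [Module A P] [AddCommGroup X] [Module A X] [AddCommGroup Y] [Module A Y]
  [AddCommGroup Z] [Module A Z]

theorem isMaximalCohenMacaulay_of_isRetract [IsNoetherianRing A] {D : ℕ}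
    (hD : ringKrullDim A = (D : ℕ)) [Module.Finite A N] (h : IsMaximalCohenMacaulay A N)
    (hr : IsRetract A M N) : IsMaximalCohenMacaulay A M := by
  have := hr.finite
  rw [isMaximalCohenMacaulay_iff hD] at h ⊢
  exact fun i hi => (h i hi).of_isRetract_right hr

theorem isMaximalCohenMacaulay_of_exact [IsNoetherianRing A] {D : ℕ}
    (hD : ringKrullDim A = (D : ℕ)) [Module.Finite A Y] (f : X →ₗ[A] Y) (g : Y →ₗ[A] Z)
    (hf : Function.Injective f) (hg : Function.Surjective g) (hfg : Function.Exact f g)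
    (hY : IsMaximalCohenMacaulay A Y) (hZ : IsMaximalCohenMacaulay A Z) :
    IsMaximalCohenMacaulay A X := by
  have := Module.Finite.of_surjective g hg
  have := Module.Finite.of_injective f hf
  rw [isMaximalCohenMacaulay_iff hD] at hY hZ ⊢
  intro i hi
  cases i with
  | zero =>
    rw [extZero_zero_iff]
    intro φ
    have := extZero_zero_iff.mp (hY 0 hi) (f ∘ₗ φ)
    ext x
    exact hf (by simpa using LinearMap.congr_fun this x)
  | succ i => exact ExtZero.covariant_left f g hf hg hfg (hZ i (by omega)) (hY _ hi)

namespace IsHenselianGorenstein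

variable (hA : IsHenselianGorenstein A)
include hA

theorem mcm_of_isRetract [Module.Finite A N] (h : IsMaximalCohenMacaulay A N)
    (hr : IsRetract A M N) : IsMaximalCohenMacaulay A M := by
  have := hA.isNoetherianRing
  obtain ⟨D, hD⟩ := hA.exists_dim
  exact isMaximalCohenMacaulay_of_isRetract hD h hr

theorem mcm_prod [Module.Finite A M] [Module.Finite A N] (hM : IsMaximalCohenMacaulay A M)
    (hN : IsMaximalCohenMacaulay A N) : IsMaximalCohenMacaulay A (M × N) := by
  have := hA.isNoetherianRing
  obtain ⟨D, hD⟩ := hA.exists_dim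
  rw [isMaximalCohenMacaulay_iff hD] at hM hN ⊢
  exact fun i hi => (hM i hi).prod_right (hN i hi)

theorem mcm_free (n : ℕ) : IsMaximalCohenMacaulay A (Fin n → A) := by
  have := hA.isNoetherianRing
  obtain ⟨D, hD⟩ := hA.exists_dim
  have h := hA.cohenMacaulay
  rw [isMaximalCohenMacaulay_iff hD] at h ⊢
  exact fun i hi => (h i hi).pi_right n

omit hA [IsLocalRing A] in
theorem exists_isRetract_free [Module.Finite A P] [Module.Projective A P] :
    ∃ n, IsRetract A P (Fin n → A) := by
  obtain ⟨n, π, hπ⟩ := Module.Finite.exists_fin' A P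
  obtain ⟨s, hs⟩ := Module.projective_lifting_property π LinearMap.id hπ
  exact ⟨n, s, π, hs⟩

theorem isLattice_prod (hM : IsLattice A M) (hN : IsLattice A N) : IsLattice A (M × N) := by
  have := hA.isNoetherianRing
  rw [isLattice_iff] at *
  obtain ⟨_, hM, e, he⟩ := hM
  obtain ⟨_, hN, e', he'⟩ := hN
  refine ⟨inferInstance, hA.mcm_prod hM hN, e + e', le_trans (le_inf ?_ ?_)
    inf_stableAnnihilator_le_prod⟩
  · exact (Ideal.pow_le_pow_right (by omega)).trans he
  · exact (Ideal.pow_le_pow_right (by omega)).trans he'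

theorem isLattice_of_isRetract (hN : IsLattice A N) (hr : IsRetract A M N) : IsLattice A M := by
  have := hA.isNoetherianRing
  rw [isLattice_iff] at *
  obtain ⟨_, hN, e, he⟩ := hN
  exact ⟨hr.finite, hA.mcm_of_isRetract hN hr, e, he.trans hr.stableAnnihilator_le⟩

theorem isLattice_free (n : ℕ) : IsLattice A (Fin n → A) := by
  have := hA.isNoetherianRing
  rw [isLattice_iff]
  exact ⟨inferInstance, hA.mcm_free n, 0, by simp [stableAnnihilator_eq_top]⟩

theorem isLattice_of_projective [Module.Finite A P] [Module.Projective A P] : IsLattice A P := by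
  obtain ⟨n, hn⟩ := exists_isRetract_free (A := A) (P := P)
  exact hA.isLattice_of_isRetract (hA.isLattice_free n) hn

/-- Dimension shifting: syzygies of maximal Cohen-Macaulay modules are again such, so higher Ext
reduces to Ext¹, which vanishes by assumption on A. -/
theorem extZero_free [Module.Finite A M] (hM : IsMaximalCohenMacaulay A M) (n i : ℕ) :
    ExtZero A M (Fin n → A) (i + 1) := by
  have := hA.isNoetherianRing
  obtain ⟨D, hD⟩ := hA.exists_dim
  refine ExtZero.pi_right ?_ n
  induction i generalizing M with
  | zero => exact hA.extZero M inferInstance hM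
  | succ i ih =>
    obtain ⟨m, π, hπ⟩ := Module.Finite.exists_fin' A M
    have hK : IsMaximalCohenMacaulay A (LinearMap.ker π) :=
      isMaximalCohenMacaulay_of_exact hD (LinearMap.ker π).subtype π
        (LinearMap.ker π).subtype_injective hπ (LinearMap.exact_subtype_ker_map π)
        (hA.mcm_free m) hM
    exact ExtZero.contravariant_right (LinearMap.ker π).subtype π
      (LinearMap.ker π).subtype_injective hπ (LinearMap.exact_subtype_ker_map π) (ih hK)
      (ExtZero.of_projective _)

theorem extZero_projective [Module.Finite A M] (hM : IsMaximalCohenMacaulay A M)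
    [Module.Finite A P] [Module.Projective A P] (i : ℕ) : ExtZero A M P (i + 1) := by
  obtain ⟨n, hn⟩ := exists_isRetract_free (A := A) (P := P)
  exact (hA.extZero_free hM n i).of_isRetract_right hn

/-- Maps from M to free modules extend over the embedding because Ext¹(Z, free) = 0, and this lets
the stable annihilator of M act on Z as well. -/
theorem exists_cosyzygy_lattice (hM : IsLattice A M) : ∃ (n : ℕ) (Z : ModuleCat.{u} A)
    (f : M →ₗ[A] (Fin n → A)) (g : (Fin n → A) →ₗ[A] Z), Function.Injective f ∧
      Function.Surjective g ∧ Function.Exact f g ∧ IsLattice A Z := by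
  have := hA.isNoetherianRing
  rw [isLattice_iff] at hM
  obtain ⟨_, hM, e, he⟩ := hM
  obtain ⟨n, Z, f, g, hf, hg, hfg, hZ⟩ := hA.exists_cosyzygy M inferInstance hM
  refine ⟨n, Z, f, g, hf, hg, hfg, ?_⟩
  rw [isLattice_iff]
  have : Module.Finite A Z := Module.Finite.of_surjective g hg
  refine ⟨this, hZ, e, he.trans ?_⟩
  obtain ⟨m, π, hπ⟩ := Module.Finite.exists_fin' A M
  exact stableAnnihilator_le_of_exact_of_extend f g hg hfg π hπ fun φ =>
    ExtZero.exists_extend f g hf hg hfg (hA.extZero_free hZ m 0) φ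

/-- A lat-injective has no extensions by its cosyzygy lattice, so it splits off the free module
containing it. -/
theorem isLatInjective_iff :
    IsLatInjective A Y ↔ Module.Finite A Y ∧ Module.Projective A Y := by
  constructor
  · rintro ⟨hY, hext⟩
    refine ⟨hY.finite, ?_⟩
    obtain ⟨n, Z, f, g, hf, hg, hfg, hZ⟩ := hA.exists_cosyzygy_lattice hY
    obtain ⟨r, hr⟩ := ExtZero.exists_extend f g hf hg hfg (hext Z hZ) LinearMap.id
    exact Module.Projective.of_split f r hr
  · rintro ⟨h1, h2⟩
    refine ⟨hA.isLattice_of_projective, fun M _ _ hM => ?_⟩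
    have := hM.finite
    exact hA.extZero_projective hM.maximalCohenMacaulay 0

/-- A finite module has a finite resolution by lat-injectives iff its projective dimension is
finite. -/
theorem hasFiniteLatInjectiveResolution_iff :
    HasFiniteLatInjectiveResolution A (ModuleCat.of A Y) ↔
      Module.Finite A Y ∧ ∃ n, HasProjectiveDimensionLT (ModuleCat.of A Y) n := by
  have := hA.isNoetherianRing
  constructor
  · intro h
    suffices ∀ Y : ModuleCat.{u} A, HasFiniteLatInjectiveResolution A Y →
        Module.Finite A Y ∧ ∃ n, HasProjectiveDimensionLT Y n from this _ h
    intro Y h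
    induction h with
    | of_isLatInjective Y hY =>
      obtain ⟨h1, h2⟩ := hA.isLatInjective_iff.mp hY
      have : Projective Y := (IsProjective.iff_projective Y).mp h2
      exact ⟨h1, 1, inferInstance⟩
    | of_exact K L Y i p hi hip hp hL hK ih =>
      obtain ⟨h1, h2⟩ := hA.isLatInjective_iff.mp hL
      obtain ⟨hKf, n, hn⟩ := ih
      have : Projective L := (IsProjective.iff_projective L).mp h2
      exact ⟨Module.Finite.of_surjective p hp, n + 1,
        (shortExact_shortComplexOfExact i p hi hp hip).hasProjectiveDimensionLT_X₃ n hn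
          (hasProjectiveDimensionLT_of_ge L 1 (n + 1) (by omega))⟩
  · rintro ⟨hf, n, hn⟩
    -- The bound is raised by one so that the induction starts at "dimension less than 1", that is,
    -- projective.
    replace hn : HasProjectiveDimensionLT (ModuleCat.of A Y) (n + 1) :=
      hasProjectiveDimensionLT_of_ge _ n (n + 1) (by omega)
    induction n generalizing Y with
    | zero =>
      refine .of_isLatInjective _ (hA.isLatInjective_iff.mpr ⟨hf, ?_⟩)
      exact (IsProjective.iff_projective Y).mpr (projective_iff_hasProjectiveDimensionLT_one.mpr hn)
    | succ n ih =>
      obtain ⟨m, π, hπ⟩ := Module.Finite.exists_fin' A Y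
      have hp : Projective (ModuleCat.of A (Fin m → A)) :=
        (IsProjective.iff_projective _).mp inferInstance
      refine .of_exact (ModuleCat.of A (LinearMap.ker π)) (ModuleCat.of A (Fin m → A)) _
        (LinearMap.ker π).subtype π (LinearMap.ker π).subtype_injective
        (LinearMap.exact_subtype_ker_map π) hπ
        (hA.isLatInjective_iff.mpr ⟨inferInstance, inferInstance⟩) ?_
      exact ih inferInstance (((shortExact_shortComplexOfExact (LinearMap.ker π).subtype π
        (LinearMap.ker π).subtype_injective hπ
        (LinearMap.exact_subtype_ker_map π)).hasProjectiveDimensionLT_X₃_iff n hp).mp hn)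

/-- With i = 0 this lifts maps from lattices along a lat-approximation. -/
theorem extZero_of_resolution [Module.Finite A M] (hM : IsMaximalCohenMacaulay A M)
    {Y : ModuleCat.{u} A} (hY : HasFiniteLatInjectiveResolution A Y) (i : ℕ) :
    ExtZero A M Y (i + 1) := by
  induction hY generalizing i with
  | of_isLatInjective Y hY =>
    obtain ⟨h1, h2⟩ := hA.isLatInjective_iff.mp hY
    exact hA.extZero_projective hM i
  | of_exact K L Y j p hj hjp hp hL hK ih =>
    obtain ⟨h1, h2⟩ := hA.isLatInjective_iff.mp hL
    exact ExtZero.covariant_right j p hj hp hjp (hA.extZero_projective hM i) (ih (i + 1))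

end IsHenselianGorenstein
end MCM
end LatticeType

/-! ### Minimal generators and endomorphisms of indecomposables -/

namespace LatticeType

open IsLocalRing TensorProduct

section MinimalGenerators

variable (A : Type u) [CommRing A] [IsLocalRing A]

/-- The minimal number of generators of a finite module over a local ring. -/
noncomputable def minGenerators (M : Type u) [AddCommGroup M] [Module A M] : ℕ :=
  Module.finrank (ResidueField A) (ResidueField A ⊗[A] M)

variable {A}
variable {M N : Type u} [AddCommGroup M] [Module A M] [AddCommGroup N] [Module A N]

theorem minGenerators_congr (e : M ≃ₗ[A] N) : minGenerators A M = minGenerators A N :=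
  (e.baseChange A (ResidueField A) M N).finrank_eq

theorem minGenerators_prod [Module.Finite A M] [Module.Finite A N] :
    minGenerators A (M × N) = minGenerators A M + minGenerators A N := by
  unfold minGenerators
  rw [(TensorProduct.prodRight A (ResidueField A) (ResidueField A) M N).finrank_eq,
    Module.finrank_prod]

theorem minGenerators_pos [Module.Finite A M] [Nontrivial M] : 0 < minGenerators A M := by
  have : Nontrivial (ResidueField A ⊗[A] M) := by
    rw [← not_subsingleton_iff_nontrivial, IsLocalRing.subsingleton_tensorProduct,
      not_subsingleton_iff_nontrivial]
    infer_instance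
  exact Module.finrank_pos

theorem exists_surjective_minGenerators [Module.Finite A M] :
    ∃ π : (Fin (minGenerators A M) → A) →ₗ[A] M, Function.Surjective π := by
  let b : Module.Basis (Fin (minGenerators A M)) (ResidueField A) (ResidueField A ⊗[A] M) :=
    Module.finBasis (ResidueField A) (ResidueField A ⊗[A] M)
  have hs : Function.Surjective (TensorProduct.mk A (ResidueField A) M 1) :=
    TensorProduct.mk_surjective A M (ResidueField A) Ideal.Quotient.mk_surjective
  choose v hv using fun i => hs (b i)
  refine ⟨Fintype.linearCombination A v, ?_⟩
  rw [← LinearMap.range_eq_top, Fintype.range_linearCombination]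
  exact IsLocalRing.span_eq_top_of_tmul_eq_basis v b hv

theorem minGenerators_le {n : ℕ} (π : (Fin n → A) →ₗ[A] M) (hπ : Function.Surjective π) :
    minGenerators A M ≤ n := by
  have h := LinearMap.finrank_le_finrank_of_surjective
    (f := π.baseChange (ResidueField A)) (LinearMap.lTensor_surjective (ResidueField A) hπ)
  refine h.trans (le_of_eq ?_)
  rw [Module.finrank_baseChange, Module.finrank_fin_fun]

end MinimalGenerators

section LocalEndomorphisms

variable {A : Type u} [CommRing A] [IsLocalRing A]
variable {M : Type u} [AddCommGroup M] [Module A M]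

open Polynomial

/-- The subalgebra A[φ] of the endomorphism ring is commutative and finite, since φ is integral over
A, so the idempotent criterion applies to it. It takes the place of locality of the noncommutative
endomorphism ring. -/
theorem IsHenselianGorenstein.isLocalRing_quotient_ker (hA : IsHenselianGorenstein A)
    [Module.Finite A M] [Nontrivial M] (φ : Module.End A M)
    (h : ∀ p : A[X], IsIdempotentElem (aeval φ p) → aeval φ p = 0 ∨ aeval φ p = 1) :
    IsLocalRing (A[X] ⧸ RingHom.ker (aeval φ : A[X] →ₐ[A] Module.End A M)) := by
  let I := RingHom.ker (aeval φ : A[X] →ₐ[A] Module.End A M)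
  have hnt : Nontrivial (A[X] ⧸ I) := by
    rw [Ideal.Quotient.nontrivial_iff, Ideal.ne_top_iff_one]
    intro h1
    have : (1 : Module.End A M) = 0 := by simpa using (RingHom.mem_ker).mp h1
    exact one_ne_zero this
  obtain ⟨p, hp, hp0⟩ := Algebra.IsIntegral.isIntegral (R := A) φ
  have hfin : Module.Finite A (A[X] ⧸ I) := by
    have : Module.Finite A (A[X] ⧸ Ideal.span {p}) := hp.finite_quotient
    have hle : Ideal.span {p} ≤ I := by
      rw [Ideal.span_singleton_le_iff_mem]
      exact hp0
    exact Module.Finite.of_surjective (Ideal.Quotient.factorₐ A hle).toLinearMap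
      (Ideal.Quotient.factor_surjective hle)
  refine hA.isLocalRing_of_idempotents (A[X] ⧸ I) hfin fun e he => ?_
  obtain ⟨q, rfl⟩ := Ideal.Quotient.mk_surjective e
  have key : ∀ q' r : A[X], Ideal.Quotient.mk I q' = Ideal.Quotient.mk I r ↔ aeval φ q' = aeval φ r := by
    intro q' r
    rw [Ideal.Quotient.eq, RingHom.mem_ker, map_sub, sub_eq_zero]
  rw [← map_mul, key, map_mul] at he
  rcases h q he with h | h
  · left; rw [← map_zero (Ideal.Quotient.mk I), key, h, map_zero]
  · right; rw [← map_one (Ideal.Quotient.mk I), key, h, map_one]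

omit [IsLocalRing A] in
theorem bijective_aeval_of_isUnit (φ : Module.End A M) (p : A[X])
    (h : IsUnit (Ideal.Quotient.mk (RingHom.ker (aeval φ : A[X] →ₐ[A] Module.End A M)) p)) :
    Function.Bijective (aeval φ p) := by
  rw [← Module.End.isUnit_iff]
  have := h.map (Ideal.kerLiftAlg (aeval φ : A[X] →ₐ[A] Module.End A M))
  simpa using this

omit [IsLocalRing A] in
theorem IsIndecomposable.eq_zero_or_eq_one (hM : IsIndecomposable A M) (e : Module.End A M)
    (he : IsIdempotentElem e) : e = 0 ∨ e = 1 := by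
  rcases hM.2 _ _ (LinearMap.IsIdempotentElem.isCompl he) with h | h
  · left; rwa [LinearMap.range_eq_bot] at h
  · right
    ext x
    have h2 : e (e x) = e x := LinearMap.congr_fun he x
    exact LinearMap.ker_eq_bot.mp h h2

/-- Here ψ = 1 - φ lies in the local ring A[φ], where φ or 1 - φ is a unit. -/
theorem IsIndecomposable.bijective_or_bijective (hA : IsHenselianGorenstein A)
    [Module.Finite A M] (hM : IsIndecomposable A M) (φ ψ : M →ₗ[A] M)
    (h : φ + ψ = LinearMap.id) : Function.Bijective φ ∨ Function.Bijective ψ := by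
  have := hM.1
  have hloc := hA.isLocalRing_quotient_ker (M := M) φ fun p hp => hM.eq_zero_or_eq_one _ hp
  rcases IsLocalRing.isUnit_or_isUnit_one_sub_self
    (Ideal.Quotient.mk (RingHom.ker (aeval φ : A[X] →ₐ[A] Module.End A M)) X) with h1 | h1
  · left
    simpa using bijective_aeval_of_isUnit φ X h1
  · right
    rw [← map_one (Ideal.Quotient.mk _), ← map_sub] at h1
    have := bijective_aeval_of_isUnit φ (1 - X) h1
    have e : (aeval φ (1 - X : A[X])) = ψ := by
      simp only [map_sub, map_one, aeval_X]
      rw [sub_eq_iff_eq_add, add_comm, h]; rfl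
    rwa [e] at this

end LocalEndomorphisms
end LatticeType

/-! ### Existence of a minimal lat-approximation of the residue field -/

open CategoryTheory

namespace LatticeType

open IsLocalRing

section Approximation

variable {A : Type u} [CommRing A] [IsLocalRing A]
variable {M N G : Type u} [AddCommGroup M] [Module A M] [AddCommGroup N] [Module A N]
  [AddCommGroup G] [Module A G]

namespace IsHenselianGorenstein

variable (hA : IsHenselianGorenstein A)
include hA

/-- A lat-approximation of the first syzygy yields one of the module itself. -/
theorem exists_latApproximation_of_syzygy {n : ℕ} (π : (Fin n → A) →ₗ[A] N)
    (hπ : Function.Surjective π) (hM : IsLattice A M) (α : M →ₗ[A] LinearMap.ker π)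
    (hα : Function.Surjective α)
    (hker : HasFiniteLatInjectiveResolution A (ModuleCat.of A (LinearMap.ker α))) :
    ∃ (G : ModuleCat.{u} A) (β : G →ₗ[A] N), IsLattice A G ∧ Function.Surjective β ∧
      HasFiniteLatInjectiveResolution A (ModuleCat.of A (LinearMap.ker β)) := by
  -- Embed M in a free module with lattice cokernel Z, extend α to b : Aᵖ → Aⁿ, and let c : Z → N be
  -- the map induced by π ∘ b. The approximation is (π, c) on Aⁿ × Z.
  obtain ⟨p, Z, f, g, hf, hg, hfg, hZ⟩ := hA.exists_cosyzygy_lattice hM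
  have := hZ.finite
  obtain ⟨b, hb⟩ := ExtZero.exists_extend f g hf hg hfg
    (hA.extZero_free hZ.maximalCohenMacaulay n 0) ((LinearMap.ker π).subtype ∘ₗ α)
  have hb' : ∀ x, b (f x) = α x := fun x => LinearMap.congr_fun hb x
  obtain ⟨c, hc⟩ := exists_comp_eq_of_exact_right hg hfg (π ∘ₗ b) fun x => by
    rw [LinearMap.comp_apply, hb']; exact (α x).2
  let ω : ((Fin n → A) × Z) →ₗ[A] N := π.coprod c
  have hω : Function.Surjective ω := fun y => by
    obtain ⟨a, rfl⟩ := hπ y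
    exact ⟨(a, 0), by simp [ω]⟩
  -- The map w ↦ (-b w, g w) is onto ker ω with kernel f(ker α), so a resolution of ker α becomes
  -- one of ker ω that is one step longer.
  let κ : (Fin p → A) →ₗ[A] LinearMap.ker ω := ((-b).prod g).codRestrict _ fun w => by
    have := hc w
    simp only [LinearMap.comp_apply] at this
    simp [ω, this]
  have hκ : Function.Surjective κ := by
    rintro ⟨⟨a, z⟩, haz⟩
    obtain ⟨w, rfl⟩ := hg z
    have h1 : π (a + b w) = 0 := by
      have := hc w
      simp only [LinearMap.comp_apply] at this
      have h2 : π a + c (g w) = 0 := haz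
      rw [map_add, ← this, h2]
    obtain ⟨x, hx⟩ := hα ⟨a + b w, h1⟩
    refine ⟨w - f x, Subtype.ext (Prod.ext ?_ ?_)⟩
    · have : b (f x) = a + b w := by rw [hb', hx]
      simp [κ, this]
    · simp [κ, hfg.apply_apply_eq_zero]
  have hι : Function.Injective (f ∘ₗ (LinearMap.ker α).subtype) :=
    hf.comp Subtype.val_injective
  have hex : Function.Exact (f ∘ₗ (LinearMap.ker α).subtype) κ := by
    intro w
    constructor
    · intro hw
      have h1 : b w = 0 := by
        have := congrArg (fun t => t.1.1) hw
        simpa [κ] using this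
      have h2 : g w = 0 := by
        have := congrArg (fun t => t.1.2) hw
        simpa [κ] using this
      obtain ⟨x, rfl⟩ := (hfg w).mp h2
      refine ⟨⟨x, ?_⟩, rfl⟩
      rw [LinearMap.mem_ker]
      exact Subtype.ext (by rw [← hb', h1]; rfl)
    · rintro ⟨⟨x, hx⟩, rfl⟩
      refine Subtype.ext (Prod.ext ?_ ?_)
      · simp [κ, hb', LinearMap.mem_ker.mp hx]
      · simp [κ, hfg.apply_apply_eq_zero]
  exact ⟨ModuleCat.of A ((Fin n → A) × Z), ω, hA.isLattice_prod (hA.isLattice_free n) hZ, hω,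
    HasFiniteLatInjectiveResolution.of_exact _ (ModuleCat.of A (Fin p → A)) (ModuleCat.of A _) _ κ hι hex hκ
      (hA.isLatInjective_iff.mpr ⟨inferInstance, inferInstance⟩) hker⟩

/-- The construction of Auslander and Buchweitz, by induction on a bound j for the codepth: a syzygy
has one more unit of depth, and the previous lemma goes back from the syzygy to N. The hypothesis on
the stable annihilator passes to syzygies; once the depth is D, it makes the module a lattice, which
is its own approximation. -/
theorem exists_latApproximation {D : ℕ} (hD : ringKrullDim A = (D : ℕ)) (j : ℕ) (hj : j ≤ D)
    [Module.Finite A N] (hN : maximalIdeal A ≤ stableAnnihilator A N)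
    (hdepth : ∀ i < D - j, ExtZero A (ResidueField A) N i) :
    ∃ (G : ModuleCat.{u} A) (β : G →ₗ[A] N), IsLattice A G ∧ Function.Surjective β ∧
      HasFiniteLatInjectiveResolution A (ModuleCat.of A (LinearMap.ker β)) := by
  have := hA.isNoetherianRing
  induction j generalizing N with
  | zero =>
    refine ⟨ModuleCat.of A N, LinearMap.id, ?_, Function.surjective_id, ?_⟩
    · rw [isLattice_iff]
      exact ⟨inferInstance, (isMaximalCohenMacaulay_iff hD).mpr hdepth, 1, by simpa using hN⟩
    · refine .of_isLatInjective _ (hA.isLatInjective_iff.mpr ?_)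
      have : Subsingleton (LinearMap.ker (LinearMap.id : N →ₗ[A] N)) := by
        rw [LinearMap.ker_id]; infer_instance
      exact ⟨inferInstance, inferInstance⟩
  | succ j ih =>
    obtain ⟨n, π, hπ⟩ := Module.Finite.exists_fin' A N
    have hex := LinearMap.exact_subtype_ker_map π
    have hinj := (LinearMap.ker π).subtype_injective
    have hfree := (isMaximalCohenMacaulay_iff hD).mp (hA.mcm_free n)
    obtain ⟨G, α, hG, hα, hker⟩ := ih (N := LinearMap.ker π) (by omega)
      (hN.trans (stableAnnihilator_le_of_exact _ π hinj hπ hex)) fun i hi => by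
        cases i with
        | zero =>
          rw [extZero_zero_iff]
          intro φ
          have h0 := extZero_zero_iff.mp (hfree 0 (by omega)) ((LinearMap.ker π).subtype ∘ₗ φ)
          ext x
          exact congrFun (LinearMap.congr_fun h0 x) _
        | succ i =>
          exact ExtZero.covariant_left _ π hinj hπ hex (hdepth i (by omega)) (hfree _ (by omega))
    exact hA.exists_latApproximation_of_syzygy π hπ hG α hα hker

/-- An idempotent compatible with a lat-approximation splits off a smaller lat-approximation. -/
theorem latApproximation_range (hG : IsLattice A G) (α : G →ₗ[A] N) (hα : Function.Surjective α)
    (hker : HasFiniteLatInjectiveResolution A (ModuleCat.of A (LinearMap.ker α)))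
    (e : G →ₗ[A] G) (he : e ∘ₗ e = e) (hαe : α ∘ₗ e = α) :
    IsLattice A (LinearMap.range e) ∧ Function.Surjective (α ∘ₗ (LinearMap.range e).subtype) ∧
      HasFiniteLatInjectiveResolution A
        (ModuleCat.of A (LinearMap.ker (α ∘ₗ (LinearMap.range e).subtype))) := by
  have hee : ∀ x, e (e x) = e x := fun x => LinearMap.congr_fun he x
  have hαe' : ∀ x, α (e x) = α x := fun x => LinearMap.congr_fun hαe x
  have hr : IsRetract A (LinearMap.range e) G := by
    refine ⟨(LinearMap.range e).subtype, e.rangeRestrict, ?_⟩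
    ext ⟨_, x, rfl⟩
    exact hee x
  have hr' : ∃ (i : LinearMap.ker (α ∘ₗ (LinearMap.range e).subtype) →ₗ[A] LinearMap.ker α)
      (p : LinearMap.ker α →ₗ[A] LinearMap.ker (α ∘ₗ (LinearMap.range e).subtype)),
      p ∘ₗ i = LinearMap.id := by
    refine ⟨((LinearMap.range e).subtype ∘ₗ Submodule.subtype _).codRestrict _ fun x => x.2,
      (e.rangeRestrict ∘ₗ (LinearMap.ker α).subtype).codRestrict _ fun x => ?_, ?_⟩
    · have h1 : α x = 0 := x.2
      change α (e x) = 0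
      rw [hαe', h1]
    · ext ⟨⟨_, x, rfl⟩, hx⟩
      exact hee x
  refine ⟨hA.isLattice_of_isRetract hG hr, fun y => ?_, ?_⟩
  · obtain ⟨x, rfl⟩ := hα y
    exact ⟨⟨e x, x, rfl⟩, hαe' x⟩
  · obtain ⟨hf, n, hn⟩ := hA.hasFiniteLatInjectiveResolution_iff.mp hker
    refine hA.hasFiniteLatInjectiveResolution_iff.mpr ⟨IsRetract.finite hr', n, ?_⟩
    obtain ⟨i, p, hip⟩ := hr'
    let r : Retract (ModuleCat.of A (LinearMap.ker (α ∘ₗ (LinearMap.range e).subtype)))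
        (ModuleCat.of A (LinearMap.ker α)) :=
      { i := ModuleCat.ofHom i, r := ModuleCat.ofHom p
        retract := by rw [← ModuleCat.ofHom_comp, hip]; rfl }
    exact r.hasProjectiveDimensionLT n

/-- The residue field has a minimal lat-approximation. -/
theorem exists_isMinimalLatApproximation :
    ∃ (G : ModuleCat.{u} A) (α : G →ₗ[A] ResidueField A), IsMinimalLatApproximation A α := by
  have := hA.isNoetherianRing
  obtain ⟨D, hD⟩ := hA.exists_dim
  -- Minimality comes from choosing an approximation with the fewest generators.
  have hex : ∃ n : ℕ, ∃ (G : ModuleCat.{u} A) (α : G →ₗ[A] ResidueField A), IsLattice A G ∧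
      Function.Surjective α ∧
      HasFiniteLatInjectiveResolution A (ModuleCat.of A (LinearMap.ker α)) ∧
      minGenerators A G = n := by
    obtain ⟨G, α, h1, h2, h3⟩ := hA.exists_latApproximation (N := ResidueField A) hD D le_rfl
      (le_trans (by
        intro a ha
        rw [Module.mem_annihilator]
        intro x
        rw [Algebra.smul_def, ResidueField.algebraMap_eq, (residue_eq_zero_iff a).mpr ha, zero_mul])
        annihilator_le_stableAnnihilator) (by omega)
    exact ⟨_, G, α, h1, h2, h3, rfl⟩
  classical
  obtain ⟨G, α, hG, hα, hker, hmin⟩ := Nat.find_spec hex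
  have := hG.finite
  obtain ⟨x₀, hx₀⟩ := hα 1
  have : Nontrivial G := ⟨x₀, 0, fun h => by simp [h] at hx₀⟩
  -- The range of such an e is again an approximation, so by the choice of G the complementary
  -- summand needs no generators and is zero.
  have key : ∀ e : G →ₗ[A] G, e ∘ₗ e = e → α ∘ₗ e = α → e = LinearMap.id := by
    intro e he hαe
    obtain ⟨h1, h2, h3⟩ := hA.latApproximation_range hG α hα hker e he hαe
    have hle := Nat.find_min' hex ⟨ModuleCat.of A (LinearMap.range e), _, h1, h2, h3, rfl⟩
    have hc : IsCompl (LinearMap.range e) (LinearMap.ker e) :=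
      LinearMap.IsIdempotentElem.isCompl (f := e) he
    have := minGenerators_congr (Submodule.prodEquivOfIsCompl _ _ hc)
    rw [minGenerators_prod, hmin] at this
    have h0 : minGenerators A (LinearMap.ker e) = 0 := by
      change _ ≤ minGenerators A (LinearMap.range e) at hle
      omega
    have hs : Subsingleton (LinearMap.ker e) := by
      by_contra h
      rw [not_subsingleton_iff_nontrivial] at h
      exact minGenerators_pos.ne' h0
    have hk : LinearMap.ker e = ⊥ := (Submodule.subsingleton_iff_eq_bot).mp hs
    ext x
    exact LinearMap.ker_eq_bot.mp hk (LinearMap.congr_fun he x)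
  refine ⟨G, α, hG, hα, hker, fun g hg => ?_⟩
  have hg' : ∀ x, α (g x) = α x := fun x => LinearMap.congr_fun hg x
  have hpow : ∀ (i : ℕ) x, α ((g ^ i) x) = α x := by
    intro i
    induction i with
    | zero => simp
    | succ i ih => intro x; rw [pow_succ, Module.End.mul_apply, ih, hg']
  -- As α ∘ g = α, a polynomial p(g) acts on k through p(1). For an idempotent p(g) this scalar is 0
  -- or 1 in k, so `key` applies to 1 - p(g) or to p(g). Hence A[g] is local.
  have hpoly : ∀ (p : Polynomial A) x, α (Polynomial.aeval g p x) = p.eval 1 • α x := by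
    intro p x
    induction p using Polynomial.induction_on' with
    | add p q hp hq => simp [hp, hq, add_smul]
    | monomial n a =>
      simp [Polynomial.aeval_monomial, hpow, Module.algebraMap_end_apply]
  have hloc := hA.isLocalRing_quotient_ker (M := G) g fun p hp => by
    set e : Module.End A G := Polynomial.aeval g p with he
    have hee : ∀ x, e (e x) = e x := fun x => LinearMap.congr_fun (show e * e = e from hp) x
    set c := residue A (p.eval 1) with hc
    have hαe : ∀ x, α (e x) = c * α x := fun x => by
      rw [hpoly, Algebra.smul_def, ResidueField.algebraMap_eq]
    have hcc : c * c = c := by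
      have := hαe (e x₀)
      rw [hee, hαe, hx₀, mul_one] at this
      exact this.symm
    rcases (IsIdempotentElem.iff_eq_zero_or_one (p := c)).mp hcc with h0 | h1
    · left
      have := key (LinearMap.id - e) (by ext x; simp [hee]) (by
        ext x; simp [hαe, h0])
      rwa [sub_eq_self] at this
    · right
      exact key e (by ext x; exact hee x) (by ext x; simp [hαe, h1])
  rcases IsLocalRing.isUnit_or_isUnit_one_sub_self
    (Ideal.Quotient.mk (RingHom.ker (Polynomial.aeval g : Polynomial A →ₐ[A] Module.End A G))
      Polynomial.X) with h1 | h1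
  · simpa using bijective_aeval_of_isUnit (A := A) (M := G) g Polynomial.X h1
  -- The map 1 - g cannot be bijective, since α ∘ (1 - g) = 0 while α is nonzero.
  · exfalso
    rw [← map_one (Ideal.Quotient.mk _), ← map_sub] at h1
    have := bijective_aeval_of_isUnit (A := A) (M := G) g (1 - Polynomial.X) h1
    obtain ⟨y, hy⟩ := this.2 x₀
    have h2 := hpoly (1 - Polynomial.X) y
    rw [hy, hx₀] at h2
    simp at h2

end IsHenselianGorenstein

end Approximation

end LatticeType

/-! ### Comparison of size with h-length -/

namespace LatticeType

open IsLocalRing RingTheory.Sequence Pointwise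

section Size

variable {A : Type u} [CommRing A] [IsLocalRing A]
variable {M N W : Type u} [AddCommGroup M] [Module A M] [AddCommGroup N] [Module A N]
  [AddCommGroup W] [Module A W]

variable (A) in
/-- `M` needs at most `n` generators, and the `n`-th power of the maximal ideal annihilates its
stable endomorphisms. -/
def HasSizeLE (n : ℕ) (M : Type u) [AddCommGroup M] [Module A M] : Prop :=
  minGenerators A M ≤ n ∧ maximalIdeal A ^ n ≤ stableAnnihilator A M

theorem HasSizeLE.mono {m n : ℕ} (h : HasSizeLE A m M) (hmn : m ≤ n) : HasSizeLE A n M :=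
  ⟨h.1.trans hmn, (Ideal.pow_le_pow_right hmn).trans h.2⟩

/-- By Nakayama's lemma the maximal ideal times L is strictly shorter than L, so induction on the
length applies. -/
theorem pow_le_annihilator_of_length_le (b : ℕ) (L : Type u) [AddCommGroup L] [Module A L]
    (h : Module.length A L ≤ b) : maximalIdeal A ^ b ≤ Module.annihilator A L := by
  induction b generalizing L with
  | zero =>
    have : Subsingleton L := Module.length_eq_zero_iff.mp (le_antisymm (by simpa using h) bot_le)
    rw [Module.annihilator_eq_top_iff.mpr this]
    exact le_top
  | succ b ih =>
    have hfl : IsFiniteLength A L := Module.length_ne_top_iff.mp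
      (ne_top_of_le_ne_top (ENat.natCast_ne_top _) h)
    obtain ⟨_, _⟩ := isFiniteLength_iff_isNoetherian_isArtinian.mp hfl
    rcases subsingleton_or_nontrivial L with hL | hL
    · rw [Module.annihilator_eq_top_iff.mpr hL]
      exact le_top
    · let m := maximalIdeal A
      have hne : m • (⊤ : Submodule A L) < ⊤ := by
        rw [lt_top_iff_ne_top]
        intro h
        have := Submodule.eq_bot_of_le_smul_of_le_jacobson_bot m (⊤ : Submodule A L)
          (Module.Finite.fg_top) h.ge (maximalIdeal_le_jacobson _)
        exact top_ne_bot this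
      have hlt := Submodule.length_lt hne.ne
      have hle : Module.length A (m • (⊤ : Submodule A L) : Submodule A L) ≤ b := by
        have := hlt.trans_le h
        push_cast at this
        exact Order.le_of_lt_add_one this
      have h1 := ih _ hle
      rw [pow_succ]
      rw [Ideal.mul_le]
      intro r hr s hs
      rw [Module.mem_annihilator]
      intro x
      have h2 := Module.mem_annihilator.mp (h1 hr)
        ⟨s • x, Submodule.smul_mem_smul hs Submodule.mem_top⟩
      have h3 := congrArg Subtype.val h2
      rw [mul_smul]
      exact h3

theorem length_linearMap_residueField [Module.Finite A M] :
    Module.length A (M →ₗ[A] ResidueField A) = minGenerators A M := by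
  have h1 : Module.length A (M →ₗ[A] ResidueField A) =
      Module.length (ResidueField A) (M →ₗ[A] ResidueField A) :=
    Module.length_eq_of_surjective (Ideal.Quotient.mk_surjective)
  rw [h1, (LinearMap.liftBaseChangeEquiv (R := A) (M := M) (N := ResidueField A)
    (ResidueField A)).length_eq, Module.length_eq_finrank]
  congr 1
  exact Subspace.dual_finrank_eq

/-- An indecomposable module with a functional taking a unit value is free of rank one. -/
theorem IsIndecomposable.nonempty_equiv (hM : IsIndecomposable A M) (φ : M →ₗ[A] A)
    (hφ : ∃ m, IsUnit (φ m)) : Nonempty (M ≃ₗ[A] A) := by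
  have hs : Function.Surjective φ := by
    obtain ⟨m, hm⟩ := hφ
    intro a
    exact ⟨(a * ↑hm.unit⁻¹) • m, by simp [mul_assoc]⟩
  obtain ⟨s, hs'⟩ := Module.projective_lifting_property φ LinearMap.id hs
  have hs'' : ∀ a, φ (s a) = a := fun a => LinearMap.congr_fun hs' a
  rcases hM.eq_zero_or_eq_one (s ∘ₗ φ) (by
    change (s ∘ₗ φ) ∘ₗ (s ∘ₗ φ) = s ∘ₗ φ
    ext x; simp [hs'']) with h | h
  · exfalso
    have h0 := congrArg φ (LinearMap.congr_fun h (s 1))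
    simp [hs''] at h0
  · exact ⟨LinearEquiv.ofLinearMap φ s hs' h⟩

theorem IsIndecomposable.hasSizeLE_one (hM : IsIndecomposable A M) (φ : M →ₗ[A] A)
    (hφ : ∃ m, IsUnit (φ m)) : HasSizeLE A 1 M := by
  obtain ⟨e⟩ := hM.nonempty_equiv φ hφ
  have : Module.Projective A M := Module.Projective.of_equiv e.symm
  constructor
  · exact minGenerators_le (e.symm.toLinearMap ∘ₗ (LinearEquiv.funUnique (Fin 1) A A).toLinearMap)
      (e.symm.surjective.comp (LinearEquiv.surjective _))
  · rw [stableAnnihilator_eq_top]; exact le_top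

/-- A map from the projective P to k lifts to A. Composed with M → P this is a functional on M,
whose values are nonunits by assumption. Thus composing with α is well defined on stable maps. -/
theorem comp_eq_zero_of_mem_projectiveMaps {f : M →ₗ[A] N} (hf : f ∈ projectiveMaps A M N)
    (hM : ∀ φ : M →ₗ[A] A, ∀ m, ¬ IsUnit (φ m)) (α : N →ₗ[A] ResidueField A) : α ∘ₗ f = 0 := by
  obtain ⟨P, g, h, hP, rfl⟩ := hf
  obtain ⟨l, hl⟩ := Module.projective_lifting_property
    (Algebra.linearMap A (ResidueField A)) (α ∘ₗ h) Ideal.Quotient.mk_surjective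
  ext m
  have h1 := LinearMap.congr_fun hl (g m)
  simp only [LinearMap.comp_apply] at h1 ⊢
  rw [← h1]
  have h2 : l (g m) ∈ maximalIdeal A := hM (l ∘ₗ g) m
  exact (residue_eq_zero_iff _).mpr h2

/-- An indecomposable lattice of bounded `h`-length has bounded size. -/
theorem IsHenselianGorenstein.hasSizeLE_of_hLength_le (hA : IsHenselianGorenstein A)
    {G : ModuleCat.{u} A} {α : G →ₗ[A] ResidueField A} (hα : IsMinimalLatApproximation A α)
    (hM : IsLattice A M) (hind : IsIndecomposable A M) {b : ℕ} (hb : hLength A G M ≤ b) :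
    HasSizeLE A (max b 1) M := by
  have := hM.finite
  -- In the first case M is isomorphic to A and has h-length 0 but one generator; this is the reason
  -- for `max b 1`.
  by_cases hφ : ∃ φ : M →ₗ[A] A, ∃ m, IsUnit (φ m)
  · obtain ⟨φ, hφ⟩ := hφ
    exact (hind.hasSizeLE_one φ hφ).mono (le_max_right _ _)
  push Not at hφ
  refine HasSizeLE.mono ⟨?_, ?_⟩ (le_max_left b 1)
  -- The G-component gives a map from stable Hom to Hom(M, k), onto because maps M → k lift along α.
  -- The length of Hom(M, k) is the number of generators of M.
  · let T : (M →ₗ[A] (M × G)) →ₗ[A] (M →ₗ[A] ResidueField A) :=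
      LinearMap.llcomp A M (M × G) (ResidueField A) (α ∘ₗ LinearMap.snd A M G)
    let T' : StableHom A M (M × G) →ₗ[A] (M →ₗ[A] ResidueField A) :=
      (projectiveMaps A M (M × G)).liftQ T fun f hf =>
        LinearMap.mem_ker.mpr (comp_eq_zero_of_mem_projectiveMaps hf hφ (α ∘ₗ LinearMap.snd A M G))
    have hT' : Function.Surjective T' := by
      intro φ
      obtain ⟨ψ, rfl⟩ := ExtZero.exists_lift (LinearMap.ker α).subtype α
        (LinearMap.ker α).subtype_injective hα.surjective (LinearMap.exact_subtype_ker_map α)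
        (hA.extZero_of_resolution hM.maximalCohenMacaulay hα.resolution_ker 0) φ
      exact ⟨Submodule.Quotient.mk (LinearMap.inr A M G ∘ₗ ψ), rfl⟩
    have := (Module.length_le_of_surjective T' hT').trans hb
    rw [length_linearMap_residueField] at this
    exact_mod_cast this
  -- The M-component of the stable Hom contains the class of the identity, which must be killed by
  -- the b-th power of the maximal ideal.
  · intro a ha
    have h1 := Module.mem_annihilator.mp (pow_le_annihilator_of_length_le b _ hb ha)
      (Submodule.Quotient.mk (LinearMap.inl A M G))
    rw [← Submodule.Quotient.mk_smul, Submodule.Quotient.mk_eq_zero] at h1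
    rw [mem_stableAnnihilator]
    exact comp_left_mem_projectiveMaps h1 (LinearMap.fst A M G)

omit [IsLocalRing A] in
-- Lift the factorization modulo y to a map M → P → W. The difference from φ is divisible by y,
-- hence equal to χ ∘ (y·id), and y·id factors through a projective module.
theorem mem_projectiveMaps_of_mkQ_comp {y : A} (hy : y ∈ stableAnnihilator A M)
    (hreg : IsSMulRegular W y) (φ : M →ₗ[A] W)
    (h : (Submodule.mkQ (y • (⊤ : Submodule A W))) ∘ₗ φ ∈ projectiveMaps A M (QuotSMulTop y W)) :
    φ ∈ projectiveMaps A M W := by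
  obtain ⟨P, g, l, hP, hl⟩ := h
  obtain ⟨l', hl'⟩ := Module.projective_lifting_property
    (Submodule.mkQ (y • (⊤ : Submodule A W))) l (Submodule.mkQ_surjective _)
  obtain ⟨χ, hχ⟩ := exists_comp_eq_of_exact_left (f := LinearMap.lsmul A W y)
    (g := (Submodule.mkQ (y • (⊤ : Submodule A W)))) hreg (exact_smul_quotSMulTop y)
    (φ - l' ∘ₗ g) fun m => by
      have h1 := LinearMap.congr_fun hl m
      have h2 := LinearMap.congr_fun hl' (g m)
      simp only [LinearMap.comp_apply] at h1 h2
      rw [LinearMap.sub_apply, LinearMap.comp_apply, map_sub, h1, h2, sub_self]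
  have h3 : φ = l' ∘ₗ g + χ ∘ₗ (y • LinearMap.id) := by
    ext m
    have := hχ m
    simp at this
    simp [this]
  rw [h3]
  exact add_mem (mem_projectiveMaps_of_comp g l')
    (comp_left_mem_projectiveMaps (mem_stableAnnihilator.mp hy) χ)

omit [IsLocalRing A] in
-- By the previous lemma, reduction modulo y is injective on stable Hom, and it can be iterated
-- along the sequence.
theorem length_stableHom_le_of_isWeaklyRegular (ys : List A)
    (hys : ∀ y ∈ ys, y ∈ stableAnnihilator A M) :
    ∀ (W : Type u) [AddCommGroup W] [Module A W], IsWeaklyRegular W ys →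
      Module.length A (StableHom A M W) ≤
        Module.length A (M →ₗ[A] (W ⧸ (Ideal.ofList ys • (⊤ : Submodule A W)))) := by
  induction ys with
  | nil =>
    intro W _ _ _
    let e : (W ⧸ (Ideal.ofList ([] : List A) • (⊤ : Submodule A W))) ≃ₗ[A] W :=
      Submodule.quotEquivOfEqBot _ (by simp)
    rw [(LinearEquiv.congrRight (M := M) e).length_eq]
    exact Module.length_le_of_surjective _ (Submodule.mkQ_surjective _)
  | cons y ys ih =>
    intro W _ _ hW
    rw [isWeaklyRegular_cons_iff] at hW
    have h1 := ih (fun z hz => hys z (List.mem_cons_of_mem _ hz)) _ hW.2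
    let e := Submodule.quotOfListConsSMulTopEquivQuotSMulTopInner W y ys
    rw [(LinearEquiv.congrRight (M := M) e).length_eq]
    refine le_trans ?_ h1
    let T : (M →ₗ[A] W) →ₗ[A] (M →ₗ[A] QuotSMulTop y W) :=
      LinearMap.llcomp A M W (QuotSMulTop y W) (Submodule.mkQ (y • (⊤ : Submodule A W)))
    refine Module.length_le_of_injective
      ((projectiveMaps A M W).mapQ (projectiveMaps A M (QuotSMulTop y W)) T
        fun f hf =>
          comp_left_mem_projectiveMaps hf (Submodule.mkQ (y • (⊤ : Submodule A W)))) ?_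
    rw [injective_iff_map_eq_zero]
    intro φ hφ
    obtain ⟨φ, rfl⟩ := Submodule.Quotient.mk_surjective _ φ
    rw [Submodule.Quotient.mk_eq_zero]
    exact mem_projectiveMaps_of_mkQ_comp (hys y List.mem_cons_self) hW.1 φ
      ((Submodule.Quotient.mk_eq_zero _).mp hφ)

theorem length_quotient_smul_top_le [Module.Finite A W] (I : Ideal A) :
    Module.length A (W ⧸ (I • (⊤ : Submodule A W))) ≤
      minGenerators A W * Module.length A (A ⧸ I) := by
  obtain ⟨π, hπ⟩ := exists_surjective_minGenerators (A := A) (M := W)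
  let n := minGenerators A W
  have hw : ∀ w ∈ I, ∀ x : W, Submodule.Quotient.mk (p := I • (⊤ : Submodule A W)) (w • x) = 0 :=
    fun w hw x => (Submodule.Quotient.mk_eq_zero _).mpr (Submodule.smul_mem_smul hw trivial)
  let c : Fin n → (A ⧸ I) →ₗ[A] (W ⧸ (I • (⊤ : Submodule A W))) := fun i =>
    Submodule.liftQ I (LinearMap.toSpanSingleton A _
      (Submodule.Quotient.mk (π (Pi.single i 1)))) fun a ha => by
        simpa [← Submodule.Quotient.mk_smul] using hw a ha (π (Pi.single i 1))
  let T : (Fin n → (A ⧸ I)) →ₗ[A] (W ⧸ (I • (⊤ : Submodule A W))) :=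
    LinearMap.lsum A (fun _ => A ⧸ I) A c
  have hT : Function.Surjective T := by
    intro w
    obtain ⟨w, rfl⟩ := Submodule.Quotient.mk_surjective _ w
    obtain ⟨a, rfl⟩ := hπ w
    refine ⟨fun i => Submodule.Quotient.mk (a i), ?_⟩
    have : π a = ∑ i, a i • π (Pi.single i 1) := by
      conv_lhs => rw [pi_eq_sum_univ' a]
      simp [map_sum, map_smul]
    rw [this]
    rw [← Submodule.mkQ_apply, map_sum]
    simp only [T, LinearMap.lsum_apply, LinearMap.coe_sum, Finset.sum_apply, LinearMap.comp_apply,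
      LinearMap.proj_apply, c]
    rfl
  refine (Module.length_le_of_surjective T hT).trans ?_
  simp [Module.length_pi_of_fintype, n]

theorem length_linearMap_le [Module.Finite A M] :
    Module.length A (M →ₗ[A] W) ≤ minGenerators A M * Module.length A W := by
  obtain ⟨π, hπ⟩ := exists_surjective_minGenerators (A := A) (M := M)
  let T : (M →ₗ[A] W) →ₗ[A] (Fin (minGenerators A M) → W) :=
    LinearMap.pi fun i => LinearMap.applyₗ (π (Pi.single i 1))
  have hT : Function.Injective T := by
    rw [injective_iff_map_eq_zero]
    intro φ hφ
    have : φ ∘ₗ π = 0 := by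
      refine LinearMap.pi_ext' fun i => ?_
      ext
      exact congrFun hφ i
    ext m
    obtain ⟨a, rfl⟩ := hπ m
    exact LinearMap.congr_fun this a
  refine (Module.length_le_of_injective T hT).trans ?_
  simp [Module.length_pi_of_fintype]

theorem length_quotient_ne_top [IsNoetherianRing A] (I : Ideal A) {e : ℕ}
    (he : maximalIdeal A ^ e ≤ I) : Module.length A (A ⧸ I) ≠ ⊤ := by
  rcases subsingleton_or_nontrivial (A ⧸ I) with h | h
  · rw [Module.length_eq_zero]; simp
  have hloc : IsLocalRing (A ⧸ I) := IsLocalRing.of_surjective' (Ideal.Quotient.mk I)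
    Ideal.Quotient.mk_surjective
  have hart : IsArtinianRing (A ⧸ I) := by
    rw [isArtinianRing_iff_isNilpotent_maximalIdeal]
    refine ⟨e, ?_⟩
    rw [← map_maximalIdeal_of_surjective (Ideal.Quotient.mk I) Ideal.Quotient.mk_surjective, ← Ideal.map_pow]
    rw [Ideal.zero_eq_bot, Ideal.map_eq_bot_iff_le_ker, Ideal.mk_ker]
    exact he
  rw [Module.length_eq_of_surjective (R := A ⧸ I) (S := A) Ideal.Quotient.mk_surjective]
  exact Module.length_ne_top

/-- Lattices of bounded size have bounded `h`-length. -/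
theorem IsHenselianGorenstein.exists_hLength_le (hA : IsHenselianGorenstein A)
    {G : ModuleCat.{u} A} (hG : IsLattice A G) (n : ℕ) :
    ∃ c : ℕ, ∀ (M : Type u) [AddCommGroup M] [Module A M], IsLattice A M → HasSizeLE A n M →
      hLength A G M ≤ c := by
  have := hA.isNoetherianRing
  have := hG.finite
  obtain ⟨D, hD⟩ := hA.exists_dim
  -- The sequence depends only on n: taken in the n-th power of the maximal ideal, it lies in the
  -- stable annihilator of every M of size at most n. This makes the bound uniform in M.
  obtain ⟨ys, hlen, hys, hreg⟩ := exists_isWeaklyRegular_of_extZero n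
    ((isMaximalCohenMacaulay_iff hD).mp hA.cohenMacaulay)
  obtain ⟨e, he⟩ := exists_pow_le_ofList hD ys hlen (fun y hy => (hys y hy).1) hreg
  have hfin := length_quotient_ne_top _ he
  obtain ⟨l, hl⟩ := ENat.ne_top_iff_exists.mp hfin
  refine ⟨n * ((n + minGenerators A G) * l), fun M _ _ hM hn => ?_⟩
  have := hM.finite
  have hMG := hA.isLattice_prod hM hG
  have h1 := length_stableHom_le_of_isWeaklyRegular ys (fun y hy => hn.2 (hys y hy).2) (M × G)
    (hMG.maximalCohenMacaulay.isWeaklyRegular hD ys hlen (fun y hy => (hys y hy).1) hreg)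
  refine h1.trans (length_linearMap_le.trans ?_)
  refine le_trans (mul_le_mul_right (length_quotient_smul_top_le _) _) ?_
  rw [minGenerators_prod, ← hl]
  push_cast
  have h2 : (minGenerators A M : ℕ∞) ≤ n := by exact_mod_cast hn.1
  gcongr

end Size
end LatticeType

/-! ### Indecomposable summands and transfer of unbounded families -/

namespace LatticeType

open IsLocalRing

section Summands

variable {A : Type u} [CommRing A]
variable {M N X Y Z : Type u} [AddCommGroup M] [Module A M] [AddCommGroup N] [Module A N]
  [AddCommGroup X] [Module A X] [AddCommGroup Y] [Module A Y] [AddCommGroup Z] [Module A Z]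

theorem IsRetract.congr_right (h : IsRetract A M N) (e : N ≃ₗ[A] X) : IsRetract A M X :=
  h.trans (.of_equiv e)

theorem IsRetract.exists_equiv_prod (h : IsRetract A M Y) :
    ∃ Z : ModuleCat.{u} A, Nonempty (Y ≃ₗ[A] M × Z) := by
  obtain ⟨i, p, hip⟩ := h
  have hip' : ∀ x, p (i x) = x := fun x => LinearMap.congr_fun hip x
  refine ⟨ModuleCat.of A (LinearMap.ker p), ⟨LinearEquiv.ofLinearMap
    (p.prod ((LinearMap.id - i ∘ₗ p).codRestrict _ fun y => by simp [hip']))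
    (i.coprod (LinearMap.ker p).subtype) ?_ ?_⟩⟩
  · refine LinearMap.ext fun ⟨x, z, hz⟩ => Prod.ext ?_ (Subtype.ext ?_)
    · simp [hip', LinearMap.mem_ker.mp hz]
    · simp [hip', LinearMap.mem_ker.mp hz]
  · ext y; simp

theorem IsRetract.nonempty_equiv_of_isIndecomposable (h : IsRetract A M N) [Nontrivial M]
    (hN : IsIndecomposable A N) : Nonempty (M ≃ₗ[A] N) := by
  obtain ⟨i, p, hip⟩ := h
  have hip' : ∀ x, p (i x) = x := fun x => LinearMap.congr_fun hip x
  rcases hN.eq_zero_or_eq_one (i ∘ₗ p) (by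
    change (i ∘ₗ p) ∘ₗ (i ∘ₗ p) = i ∘ₗ p
    ext x; simp [hip']) with h | h
  · obtain ⟨x, hx⟩ := exists_ne (0 : M)
    refine absurd ?_ hx
    have := congrArg p (LinearMap.congr_fun h (i x))
    simpa [hip'] using this
  · exact ⟨LinearEquiv.ofLinearMap i p h hip⟩

theorem IsRetract.not_of_subsingleton [Nontrivial M] [Subsingleton N] : ¬ IsRetract A M N := by
  rintro ⟨i, p, hip⟩
  obtain ⟨x, hx⟩ := exists_ne (0 : M)
  refine hx ?_
  have h : p (i x) = x := LinearMap.congr_fun hip x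
  rw [← h, Subsingleton.elim (i x) 0, map_zero]

variable [IsLocalRing A]

theorem IsRetract.hasSizeLE (h : IsRetract A M N) [Module.Finite A N] {n : ℕ}
    (hN : HasSizeLE A n N) : HasSizeLE A n M := by
  refine ⟨?_, hN.2.trans h.stableAnnihilator_le⟩
  obtain ⟨p, hp⟩ := h.surjective
  obtain ⟨π, hπ⟩ := exists_surjective_minGenerators (A := A) (M := N)
  exact (minGenerators_le (p ∘ₗ π) (hp.comp hπ)).trans hN.1

/-- An indecomposable finite module that is a summand of a direct sum is a summand of one of the
terms. -/
theorem IsRetract.of_prod (hA : IsHenselianGorenstein A) [Module.Finite A M]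
    (hM : IsIndecomposable A M) (h : IsRetract A M (X × Y)) :
    IsRetract A M X ∨ IsRetract A M Y := by
  obtain ⟨i, p, hip⟩ := h
  let p₁ := p ∘ₗ LinearMap.inl A X Y
  let p₂ := p ∘ₗ LinearMap.inr A X Y
  let i₁ := LinearMap.fst A X Y ∘ₗ i
  let i₂ := LinearMap.snd A X Y ∘ₗ i
  have hsum : p₁ ∘ₗ i₁ + p₂ ∘ₗ i₂ = LinearMap.id := by
    rw [← hip]
    ext x
    simp [p₁, p₂, i₁, i₂, ← map_add]
  rcases hM.bijective_or_bijective hA _ _ hsum with h | h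
  · let e := LinearEquiv.ofBijective _ h
    exact .inl ⟨i₁, e.symm.toLinearMap ∘ₗ p₁, LinearMap.ext fun x => e.symm_apply_apply x⟩
  · let e := LinearEquiv.ofBijective _ h
    exact .inr ⟨i₂, e.symm.toLinearMap ∘ₗ p₂, LinearMap.ext fun x => e.symm_apply_apply x⟩

/-- A finite module has only finitely many indecomposable summands up to isomorphism. -/
theorem IsHenselianGorenstein.finite_setOf_isRetract (hA : IsHenselianGorenstein A) {ι : Type*}
    (M : ι → ModuleCat.{u} A) (hfin : ∀ i, Module.Finite A (M i))
    (hind : ∀ i, IsIndecomposable A (M i)) (hM : ∀ i j, i ≠ j → IsEmpty (M i ≃ₗ[A] M j))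
    (n : ℕ) (Y : Type u) [AddCommGroup Y] [Module A Y] [Module.Finite A Y]
    (hn : minGenerators A Y ≤ n) : {i | IsRetract A (M i) Y}.Finite := by
  induction n generalizing Y with
  | zero =>
    have hs : Subsingleton Y := by
      by_contra h
      rw [not_subsingleton_iff_nontrivial] at h
      have := minGenerators_pos (A := A) (M := Y)
      omega
    convert Set.finite_empty
    ext i
    have := (hind i).1
    simpa using IsRetract.not_of_subsingleton
  | succ n ih =>
    by_cases h : ∃ i, IsRetract A (M i) Y
    · obtain ⟨i, hi⟩ := h
      obtain ⟨Z, ⟨e⟩⟩ := hi.exists_equiv_prod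
      have hZ : Module.Finite A Z := Module.Finite.of_surjective
        (LinearMap.snd A (M i) Z ∘ₗ e.toLinearMap) (by
          rw [LinearMap.coe_comp]
          exact LinearMap.snd_surjective.comp e.surjective)
      have := hfin i
      have := (hind i).1
      have h1 := minGenerators_congr e
      rw [minGenerators_prod] at h1
      have h2 := minGenerators_pos (A := A) (M := M i)
      -- Any M j that is a summand of M i × Z is M i itself or a summand of Z, and Z has fewer
      -- generators than Y.
      refine ((Set.finite_singleton i).union (ih Z (by omega))).subset fun j hj => ?_
      have := hfin j
      have := (hind j).1
      rcases IsRetract.of_prod hA (hind j) (IsRetract.congr_right hj e) with h | h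
      · left
        by_contra hne
        exact (hM j i hne).false (h.nonempty_equiv_of_isIndecomposable (hind i)).some
      · exact .inr h
    · push Not at h
      convert Set.finite_empty
      ext i
      simpa using h i

/-- A property of finite modules that is inherited by one of the terms of any direct sum is
inherited by some indecomposable summand. -/
theorem exists_isIndecomposable_isRetract
    (P : ∀ (X : Type u) [AddCommGroup X] [Module A X], Prop)
    (h0 : ∀ (X : Type u) [AddCommGroup X] [Module A X], Subsingleton X → ¬ P X)
    (hP : ∀ (X Y Z : Type u) [AddCommGroup X] [Module A X] [AddCommGroup Y] [Module A Y]
      [AddCommGroup Z] [Module A Z], Module.Finite A X → (X ≃ₗ[A] Y × Z) → P X → P Y ∨ P Z)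
    (n : ℕ) (X : Type u) [AddCommGroup X] [Module A X] [Module.Finite A X]
    (hn : minGenerators A X ≤ n) (hX : P X) :
    ∃ N : ModuleCat.{u} A, IsIndecomposable A N ∧ IsRetract A N X ∧ P N := by
  induction n generalizing X with
  | zero =>
    refine absurd hX (h0 X ?_)
    by_contra h
    rw [not_subsingleton_iff_nontrivial] at h
    have := minGenerators_pos (A := A) (M := X)
    omega
  | succ n ih =>
    have hnt : Nontrivial X := by
      rw [← not_subsingleton_iff_nontrivial]
      exact fun h => h0 X h hX
    by_cases hind : IsIndecomposable A X
    · exact ⟨ModuleCat.of A X, hind, .of_equiv (.refl A X), hX⟩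
    · unfold IsIndecomposable at hind
      push Not at hind
      obtain ⟨p, q, hpq, hp, hq⟩ := hind hnt
      let e := (Submodule.prodEquivOfIsCompl p q hpq).symm
      have hp' : Nontrivial p := Submodule.nontrivial_iff_ne_bot.mpr hp
      have hq' : Nontrivial q := Submodule.nontrivial_iff_ne_bot.mpr hq
      have hrp : IsRetract A p X := IsRetract.fst.congr_right e.symm
      have hrq : IsRetract A q X := IsRetract.snd.congr_right e.symm
      have := hrp.finite
      have := hrq.finite
      have h1 := minGenerators_congr e
      rw [minGenerators_prod] at h1
      have h2 := minGenerators_pos (A := A) (M := p)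
      have h3 := minGenerators_pos (A := A) (M := q)
      rcases hP X p q inferInstance e hX with h | h
      · obtain ⟨N, hN, hr, hPN⟩ := ih p (by omega) h
        exact ⟨N, hN, hr.trans hrp, hPN⟩
      · obtain ⟨N, hN, hr, hPN⟩ := ih q (by omega) h
        exact ⟨N, hN, hr.trans hrq, hPN⟩

end Summands

section Family

variable (A : Type u) [CommRing A] [IsLocalRing A]

/-- Infinitely many pairwise non-isomorphic indecomposable lattices of bounded size exist beyond any
given size. -/
def HasUnboundedFamilies : Prop :=
  ∀ b : ℕ, ∃ (b' : ℕ) (M : ℕ → ModuleCat.{u} A),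
    (∀ j, IsLattice A (M j) ∧ IsIndecomposable A (M j) ∧ ¬ HasSizeLE A b (M j) ∧
      HasSizeLE A b' (M j)) ∧ ∀ j j', j ≠ j' → IsEmpty (M j ≃ₗ[A] M j')

variable {A}

/-- Lattices of size at most n have bounded h-length, so a larger h-length forces a larger size.
Conversely, a family of bounded size takes only finitely many h-lengths and has an infinite
subfamily of constant h-length, which is large because the size is. -/
theorem IsHenselianGorenstein.hasStronglyUnboundedLatticeType_iff (hA : IsHenselianGorenstein A) :
    HasStronglyUnboundedLatticeType A ↔ HasUnboundedFamilies A := by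
  constructor
  · rintro ⟨G, α, hα, b, hb, hM⟩ n
    obtain ⟨c, hc⟩ := hA.exists_hLength_le hα.isLattice n
    obtain ⟨i, hi⟩ : ∃ i, c < b i := ⟨c + 1, (Nat.lt_succ_self c).trans_le (hb.le_apply)⟩
    obtain ⟨M, h1, h2⟩ := hM i
    refine ⟨max (b i) 1, M, fun j => ?_, h2⟩
    obtain ⟨hl, hind, hlen⟩ := h1 j
    refine ⟨hl, hind, fun h => ?_, hA.hasSizeLE_of_hLength_le hα hl hind hlen.le⟩
    have := hc (M j) hl h
    rw [hlen] at this
    have : b i ≤ c := by exact_mod_cast this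
    omega
  · intro h
    obtain ⟨G, α, hα⟩ := hA.exists_isMinimalLatApproximation
    refine ⟨G, α, hα, ?_⟩
    let Q : ℕ → Prop := fun b => ∃ M : ℕ → ModuleCat.{u} A,
      (∀ j, IsLattice A (M j) ∧ IsIndecomposable A (M j) ∧ hLength A G (M j) = (b : ℕ∞)) ∧
      ∀ j j', j ≠ j' → IsEmpty (M j ≃ₗ[A] M j')
    have hQ : ∃ᶠ b in Filter.atTop, Q b := by
      rw [Filter.frequently_atTop]
      intro n
      -- An h-length b below n would give size at most max b 1 ≤ max n 1, which is excluded.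
      obtain ⟨b', M, hM, hiso⟩ := h (max n 1)
      obtain ⟨c, hc⟩ := hA.exists_hLength_le hα.isLattice b'
      have hlt : ∀ j, ∃ l : ℕ, l < c + 1 ∧ hLength A G (M j) = l := fun j => by
        have := hc (M j) (hM j).1 (hM j).2.2.2
        obtain ⟨l, hl⟩ := ENat.ne_top_iff_exists.mp (ne_top_of_le_ne_top (ENat.natCast_ne_top c) this)
        rw [← hl] at this
        have : l ≤ c := by exact_mod_cast this
        exact ⟨l, by omega, hl.symm⟩
      choose l hl hl' using hlt
      obtain ⟨b, hb⟩ := Finite.exists_infinite_fiber fun j => (⟨l j, hl j⟩ : Fin (c + 1))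
      classical
      let φ := Nat.orderEmbeddingOfSet ((fun j => (⟨l j, hl j⟩ : Fin (c + 1))) ⁻¹' {b})
      have hφ : ∀ j, l (φ j) = b := fun j => by
        have : φ j ∈ ((fun j => (⟨l j, hl j⟩ : Fin (c + 1))) ⁻¹' {b}) := by
          rw [Nat.orderEmbeddingOfSet_apply]
          exact Subtype.prop _
        have := congrArg Fin.val (show (⟨l (φ j), hl (φ j)⟩ : Fin (c + 1)) = b from this)
        exact this
      refine ⟨b, ?_, fun j => M (φ j), fun j => ⟨(hM _).1, (hM _).2.1, ?_⟩,
        fun j j' hne => hiso _ _ (φ.injective.ne hne)⟩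
      · by_contra hlt
        push Not at hlt
        refine (hM (φ 0)).2.2.1 (HasSizeLE.mono (hA.hasSizeLE_of_hLength_le hα (hM _).1 (hM _).2.1
          (hl' (φ 0)).le) ?_)
        rw [hφ]
        omega
      · rw [hl', hφ]
    obtain ⟨b, hb, hbQ⟩ := Filter.extraction_of_frequently_atTop hQ
    exact ⟨b, hb, hbQ⟩

/-- Transfer of unbounded families along a correspondence between indecomposable lattices that is
finite-to-one and compatible with size. -/
theorem HasUnboundedFamilies.transfer (hA : IsHenselianGorenstein A)
    {B : Type u} [CommRing B] [IsLocalRing B] (c : ℕ → ℕ)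
    (r : ModuleCat.{u} A → ModuleCat.{u} B → Prop)
    (h : ∀ M : ModuleCat.{u} A, IsLattice A M → IsIndecomposable A M →
      ∃ N : ModuleCat.{u} B, IsLattice B N ∧ IsIndecomposable B N ∧ r M N ∧
        (∀ n, HasSizeLE A n M → HasSizeLE B (c n) N) ∧ ∀ n, HasSizeLE B n N → HasSizeLE A (c n) M)
    (hr : ∀ N : ModuleCat.{u} B, IsLattice B N → ∃ Y : ModuleCat.{u} A, Module.Finite A Y ∧
      ∀ (M : ModuleCat.{u} A) (N' : ModuleCat.{u} B), (N ≃ₗ[B] N') → r M N' → IsRetract A M Y)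
    (hfam : HasUnboundedFamilies A) : HasUnboundedFamilies B := by
  intro b
  obtain ⟨b', M, hM, hiso⟩ := hfam (c b)
  choose N hN hNind hrel hNM hMN using fun j => h (M j) (hM j).1 (hM j).2.1
  -- Different M j may yield isomorphic N j, but only finitely many do for each isomorphism class,
  -- so infinitely many classes remain; one representative is kept from each of infinitely many
  -- classes.
  let s : Setoid ℕ := ⟨fun i j => Nonempty (N i ≃ₗ[B] N j),
    ⟨fun i => ⟨.refl B (N i)⟩, fun ⟨e⟩ => ⟨e.symm⟩, fun ⟨e⟩ ⟨e'⟩ => ⟨e.trans e'⟩⟩⟩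
  have hfin : ∀ i, {j | Nonempty (N i ≃ₗ[B] N j)}.Finite := fun i => by
    obtain ⟨Y, hY, hYr⟩ := hr (N i) (hN i)
    refine (hA.finite_setOf_isRetract M (fun j => (hM j).1.finite) (fun j => (hM j).2.1) hiso _ Y
      le_rfl).subset ?_
    rintro j ⟨e⟩
    exact hYr (M j) (N j) e (hrel j)
  have hinf : Infinite (Quotient s) := by
    by_contra hf
    rw [not_infinite_iff_finite] at hf
    refine Set.infinite_univ (α := ℕ) ((Set.finite_iUnion fun q : Quotient s =>
      hfin q.out).subset fun j _ => ?_)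
    rw [Set.mem_iUnion]
    exact ⟨Quotient.mk s j, Quotient.exact (Quotient.out_eq (Quotient.mk s j))⟩
  let φ : ℕ ↪ Quotient s := Infinite.natEmbedding _
  refine ⟨c b', fun j => N (φ j).out, fun j => ⟨hN _, hNind _, fun hb => ?_,
    hNM _ _ (hM _).2.2.2⟩, fun j j' hne => ⟨fun e => hne (φ.injective ?_)⟩⟩
  · exact (hM _).2.2.1 (hMN _ _ hb)
  · rw [← Quotient.out_eq (φ j), ← Quotient.out_eq (φ j')]
    exact Quotient.sound ⟨e⟩

end Family

end LatticeType

/-! ### Complete local rings, regular parameters and change of rings -/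

namespace LatticeType

open IsLocalRing RingTheory.Sequence Pointwise

section Complete

variable {S : Type u} [CommRing S]

theorem isPrecomplete_of_finite (I : Ideal S) [IsPrecomplete I S] (M : Type u) [AddCommGroup M]
    [Module S M] [Module.Finite S M] : IsPrecomplete I M := by
  rw [← AdicCompletion.of_surjective_iff]
  obtain ⟨n, π, hπ⟩ := Module.Finite.exists_fin' S M
  intro y
  obtain ⟨z, rfl⟩ := AdicCompletion.map_surjective I hπ y
  choose a ha using fun i => AdicCompletion.of_surjective I S (AdicCompletion.piEquivFin I n z i)
  refine ⟨π a, ?_⟩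
  rw [← AdicCompletion.map_of]
  congr 1
  apply (AdicCompletion.piEquivFin I n).injective
  funext i
  rw [← ha, AdicCompletion.piEquivFin_apply]
  rfl

/-- The descending chain of the ideals cⁿD stabilizes, and e generates the stable one: if e = 1 then
c is a unit, if e = 0 then c is nilpotent. -/
theorem exists_isIdempotentElem_of_isArtinianRing {D : Type u} [CommRing D] [IsArtinianRing D]
    (c : D) : ∃ e : D, e * e = e ∧ (e = 1 → IsUnit c) ∧ (e = 0 → IsUnit (1 - c)) := by
  obtain ⟨n, a, ha⟩ := IsArtinian.exists_pow_succ_smul_dvd c (1 : D)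
  have ha' : c ^ (n + 1) * a = c ^ n := by simpa using ha
  have h : ∀ j, c ^ (n + j) * a ^ j = c ^ n := by
    intro j
    induction j with
    | zero => simp
    | succ j ih =>
      calc c ^ (n + (j + 1)) * a ^ (j + 1) = c ^ (n + 1) * a * (c ^ j * a ^ j) := by ring
        _ = c ^ (n + j) * a ^ j := by rw [ha']; ring
        _ = c ^ n := ih
  have hn := h (n + 1)
  refine ⟨c ^ (n + 1) * a ^ (n + 1), ?_, fun he => ?_, fun he => ?_⟩
  · calc _ = c * a * a ^ n * (c ^ (n + (n + 1)) * a ^ (n + 1)) := by ring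
      _ = c ^ (n + 1) * a ^ (n + 1) := by rw [hn]; ring
  · exact IsUnit.of_mul_eq_one (c ^ n * a ^ (n + 1)) (by rw [← he]; ring)
  · have h0 : c ^ n = 0 := by
      rw [← hn, pow_add, mul_assoc, he, mul_zero]
    exact IsNilpotent.isUnit_one_sub ⟨n, h0⟩

/-- A finite commutative algebra over a complete Noetherian local ring is local as soon as it has
only trivial idempotents. -/
theorem isLocalRing_of_idempotents_of_isAdicComplete [IsLocalRing S] [IsNoetherianRing S]
    [IsAdicComplete (maximalIdeal S) S] (C : Type u) [CommRing C] [Algebra S C] [Nontrivial C]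
    [Module.Finite S C] (hC : ∀ e : C, e * e = e → e = 0 ∨ e = 1) : IsLocalRing C := by
  let J := (maximalIdeal S).map (algebraMap S C)
  have h1 : IsHausdorff J C := by
    have : IsHausdorff (maximalIdeal S) C := inferInstance
    exact IsHausdorff.map_algebraMap_iff.mpr this
  have h2 : IsPrecomplete J C :=
    IsPrecomplete.map_algebraMap_iff.mpr (isPrecomplete_of_finite (maximalIdeal S) C)
  have h3 : IsAdicComplete J C := {}
  have h4 : HenselianRing C J := inferInstance
  have hloc := isLocalHom_of_le_jacobson_bot J h4.jac
  have hart : IsArtinianRing (C ⧸ J) := by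
    have : Module.Finite S (C ⧸ J) := inferInstance
    have hk : Module.length S (C ⧸ J) ≠ ⊤ := by
      obtain ⟨n, π, hπ⟩ := Module.Finite.exists_fin' S (C ⧸ J)
      have hm : ∀ s ∈ maximalIdeal S, ∀ x : C ⧸ J, s • x = 0 := by
        intro s hs x
        obtain ⟨x, rfl⟩ := Ideal.Quotient.mk_surjective x
        rw [← Ideal.Quotient.mkₐ_eq_mk S, ← map_smul, Ideal.Quotient.mkₐ_eq_mk,
          Ideal.Quotient.eq_zero_iff_mem, Algebra.smul_def]
        exact J.mul_mem_right _ (Ideal.mem_map_of_mem _ hs)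
      have h := length_quotient_smul_top_le (A := S) (W := C ⧸ J) (maximalIdeal S)
      have hbot : maximalIdeal S • (⊤ : Submodule S (C ⧸ J)) = ⊥ := by
        rw [eq_bot_iff, Submodule.smul_le]
        intro s hs x _
        exact hm s hs x
      rw [(Submodule.quotEquivOfEqBot _ hbot).length_eq] at h
      refine ne_top_of_le_ne_top (WithTop.mul_ne_top (ENat.natCast_ne_top _)
        (length_quotient_ne_top (maximalIdeal S) (e := 1) (by simp))) h
    have hfl := Module.length_ne_top_iff.mp hk
    have := (isFiniteLength_iff_isNoetherian_isArtinian.mp hfl).2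
    exact isArtinian_of_tower S this
  refine IsLocalRing.of_isUnit_or_isUnit_one_sub_self fun c => ?_
  obtain ⟨e, he, he1, he0⟩ := exists_isIdempotentElem_of_isArtinianRing (Ideal.Quotient.mk J c)
  obtain ⟨a, rfl⟩ := Ideal.Quotient.mk_surjective e
  -- An idempotent of C/J is a simple root of X² - X, as (2a - 1)² = 1 modulo J. Hensel's lemma
  -- lifts it to C, where it must be 0 or 1.
  open Polynomial in
  obtain ⟨b, hb, hba⟩ := h4.is_henselian (X ^ 2 - X) (by monicity!) a (by
      rw [← Ideal.Quotient.eq_zero_iff_mem]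
      simp [pow_two, he]) (by
      have : (Ideal.Quotient.mk J) (eval a (derivative (X ^ 2 - X))) =
          2 * Ideal.Quotient.mk J a - 1 := by
        rw [two_mul]; simp [add_mul]
      rw [this]
      exact IsUnit.of_mul_eq_one (2 * Ideal.Quotient.mk J a - 1) (by linear_combination 4 * he))
  have hb' : b * b = b := by
    have : b ^ 2 - b = 0 := by simpa using hb
    linear_combination this
  have hab : Ideal.Quotient.mk J b = Ideal.Quotient.mk J a := Ideal.Quotient.eq.mpr hba
  rcases hC b hb' with rfl | rfl
  · right
    have := he0 (by rw [← hab, map_zero])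
    rw [← map_one (Ideal.Quotient.mk J), ← map_sub] at this
    exact (isUnit_map_iff _ _).mp this
  · left
    exact (isUnit_map_iff _ _).mp (he1 (by rw [← hab, map_one]))

end Complete

section RegularParameters

variable {S : Type u} [CommRing S] [IsLocalRing S] [IsNoetherianRing S]

theorem ringKrullDim_eq_length_of_isWeaklyRegular (ys : List S)
    (hys : ∀ y ∈ ys, y ∈ maximalIdeal S) (hreg : IsWeaklyRegular S ys) {e : ℕ}
    (he : maximalIdeal S ^ e ≤ Ideal.ofList ys) : ringKrullDim S = (ys.length : ℕ) := by
  have hle : Ideal.ofList ys ≤ maximalIdeal S := by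
    rw [Ideal.ofList, Ideal.span_le]; exact hys
  have hR : IsRegular S ys := ⟨hreg, fun h => by
    rw [smul_eq_mul, Ideal.mul_top] at h
    exact (maximalIdeal.isMaximal S).ne_top (top_le_iff.mp (h.le.trans hle))⟩
  have hnt : Nontrivial (S ⧸ Ideal.ofList ys) := Ideal.Quotient.nontrivial_iff.mpr
    (ne_top_of_le_ne_top (maximalIdeal.isMaximal S).ne_top hle)
  have hfl := Module.length_ne_top_iff.mp (length_quotient_ne_top _ he)
  have hart := (isFiniteLength_iff_isNoetherian_isArtinian.mp hfl).2
  have : IsArtinianRing (S ⧸ Ideal.ofList ys) := isArtinian_of_tower S hart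
  rw [← ringKrullDim_add_length_eq_ringKrullDim_of_isRegular ys hR,
    ringKrullDimZero_iff_ringKrullDim_eq_zero.mp inferInstance, zero_add]

/-- A finite module over a regular local ring is free if a regular system of parameters is weakly
regular on it. -/
theorem free_of_isWeaklyRegular {S : Type u} [CommRing S] [IsLocalRing S] [IsNoetherianRing S]
    (xs : List S) (hxs : Ideal.ofList xs = maximalIdeal S) (K : Type u) [AddCommGroup K] [Module S K] [Module.Finite S K] (hK : IsWeaklyRegular K xs) :
    Module.Free S K := by
  -- The ring varies in the induction: dividing by the first parameter changes S, and freeness of K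
  -- modulo a K-regular element of the maximal ideal gives freeness of K.
  suffices ∀ (n : ℕ) (S : Type u) [CommRing S] [IsLocalRing S] [IsNoetherianRing S] (xs : List S)
      (K : Type u) [AddCommGroup K] [Module S K] [Module.Finite S K], xs.length = n →
      Ideal.ofList xs = maximalIdeal S → IsWeaklyRegular K xs → Module.Free S K from
    this _ S xs K rfl hxs hK
  clear! S
  intro n
  induction n with
  | zero =>
    intro S _ _ _ xs K _ _ _ hlen hxs hK
    rw [List.length_eq_zero_iff.mp hlen] at hxs
    rw [Ideal.ofList_nil] at hxs
    let := (IsLocalRing.isField_iff_maximalIdeal_eq.mpr hxs.symm).toField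
    exact Module.Free.of_divisionRing S K
  | succ n ih =>
    intro S _ _ _ xs K _ _ _ hlen hxs hK
    obtain ⟨x, xs, rfl⟩ := List.exists_cons_of_length_eq_add_one hlen
    have hx : x ∈ maximalIdeal S := hxs ▸ Ideal.subset_span List.mem_cons_self
    rw [isWeaklyRegular_cons_iff'] at hK
    have hne : Ideal.span {x} ≠ ⊤ := by
      rw [Ne, Ideal.span_singleton_eq_top]; exact hx
    have : Nontrivial (S ⧸ Ideal.span {x}) := Ideal.Quotient.nontrivial_iff.mpr hne
    have hloc : IsLocalRing (S ⧸ Ideal.span {x}) :=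
      IsLocalRing.of_surjective' (Ideal.Quotient.mk _) Ideal.Quotient.mk_surjective
    have hfp : Module.FinitePresentation S K := Module.finitePresentation_of_finite S K
    have hfin : Module.Finite (S ⧸ Ideal.span {x}) (QuotSMulTop x K) :=
      Module.Finite.of_restrictScalars_finite S _ _
    rw [← Module.free_quotSMulTop_iff_free S K (maximalIdeal_le_jacobson _ hx) hK.1]
    refine ih _ (xs.map (Ideal.Quotient.mk (Ideal.span {x}))) (QuotSMulTop x K)
      (by simpa using hlen) ?_ hK.2
    rw [← map_maximalIdeal_of_surjective (Ideal.Quotient.mk (Ideal.span {x}))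
      Ideal.Quotient.mk_surjective, ← hxs, Ideal.map_ofList, List.map_cons, Ideal.ofList_cons,
      Ideal.Quotient.mk_singleton_self]
    simp

end RegularParameters

section BaseChange

variable {S : Type u} [CommRing S] [IsLocalRing S] [IsNoetherianRing S]
variable {A : Type u} [CommRing A] [IsLocalRing A] [Algebra S A]
variable {M : Type u} [AddCommGroup M] [Module A M] [Module S M] [IsScalarTower S A M]

/-- Maximal Cohen-Macaulay modules over a quotient ring are characterized by the vanishing of Ext
over the ring. -/
theorem isMaximalCohenMacaulay_iff_extZero (hSA : Function.Surjective (algebraMap S A)) {D : ℕ}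
    (hD : ringKrullDim A = (D : ℕ)) [Module.Finite S M] :
    IsMaximalCohenMacaulay A M ↔ ∀ i < D, ExtZero S (ResidueField S) M i := by
  have hloc : IsLocalHom (algebraMap S A) := IsLocalHom.of_surjective _ hSA
  constructor
  · rintro ⟨rs, hrs, hreg, hlen⟩ i hi
    have hl : rs.length = D := by
      rw [hD] at hlen
      exact_mod_cast hlen
    obtain ⟨rs', rfl⟩ : ∃ rs', rs = List.map (algebraMap S A) rs' :=
      ⟨rs.map (Function.surjInv hSA), by
        rw [List.map_map]
        conv_lhs => rw [← List.map_id rs]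
        exact List.map_congr_left fun x _ => (Function.surjInv_eq hSA x).symm⟩
    rw [isWeaklyRegular_map_algebraMap_iff] at hreg
    rw [List.length_map] at hl
    refine ExtZero.of_isWeaklyRegular rs' (fun r hr => ?_) hreg (e := 1) ?_ i (hl ▸ hi)
    · have := hrs _ (List.mem_map_of_mem hr)
      rw [mem_maximalIdeal, mem_nonunits_iff] at this ⊢
      exact fun h => this (h.map _)
    · rw [pow_one]
      intro a ha
      rw [Module.mem_annihilator]
      intro x
      rw [Algebra.smul_def, ResidueField.algebraMap_eq, (residue_eq_zero_iff a).mpr ha, zero_mul]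
  · intro h
    obtain ⟨rs, hlen, hrs, hreg⟩ := exists_isWeaklyRegular_of_extZero 1 h
    refine ⟨rs.map (algebraMap S A), ?_, (isWeaklyRegular_map_algebraMap_iff _ _ rs).mpr hreg, ?_⟩
    · intro r hr
      obtain ⟨s, hs, rfl⟩ := List.mem_map.mp hr
      have := (hrs s hs).1
      rw [mem_maximalIdeal, mem_nonunits_iff] at this ⊢
      rwa [isUnit_map_iff]
    · rw [hD, List.length_map, hlen]; rfl

end BaseChange

end LatticeType

/-! ### Hypersurfaces: matrix factorizations and periodicity -/

namespace LatticeType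

open IsLocalRing RingTheory.Sequence

section RegularLocal

variable {S : Type u} [CommRing S] [IsLocalRing S] [IsNoetherianRing S]
variable {X Y Z : Type u} [AddCommGroup X] [Module S X] [AddCommGroup Y] [Module S Y]
  [AddCommGroup Z] [Module S Z]

variable (S) in
/-- The maximal ideal is generated by a regular sequence of length `n`. -/
def HasRegularParameters (n : ℕ) : Prop :=
  ∃ xs : List S, xs.length = n ∧ Ideal.ofList xs = maximalIdeal S ∧ IsWeaklyRegular S xs

theorem HasRegularParameters.ringKrullDim_eq {n : ℕ} (hS : HasRegularParameters S n) :
    ringKrullDim S = (n : ℕ) := by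
  obtain ⟨xs, rfl, hxs, hreg⟩ := hS
  exact ringKrullDim_eq_length_of_isWeaklyRegular xs
    (fun y hy => hxs ▸ Ideal.subset_span hy) hreg (e := 1) (by rw [pow_one, hxs])

theorem HasRegularParameters.isMaximalCohenMacaulay {n : ℕ} (hS : HasRegularParameters S n) :
    IsMaximalCohenMacaulay S S := by
  have hD := hS.ringKrullDim_eq
  obtain ⟨xs, rfl, hxs, hreg⟩ := hS
  exact ⟨xs, fun y hy => hxs ▸ Ideal.subset_span hy, hreg, hD.symm⟩

/-- Over a regular local ring, finite free modules are the finite modules of maximal depth. -/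
theorem HasRegularParameters.free_iff {n : ℕ} (hS : HasRegularParameters S n)
    [Module.Finite S X] : Module.Free S X ↔ ∀ i < n, ExtZero S (ResidueField S) X i := by
  have hD := hS.ringKrullDim_eq
  have hmcm := hS.isMaximalCohenMacaulay
  constructor
  · intro h i hi
    have := (isMaximalCohenMacaulay_iff hD).mp hmcm i hi
    exact (this.pi_right _).congr_right (Module.finBasis S X).equivFun.symm
  · intro h
    have h1 := (isMaximalCohenMacaulay_iff hD).mpr h
    obtain ⟨xs, hlen, hxs, hreg⟩ := hS
    exact free_of_isWeaklyRegular xs hxs X (h1.isWeaklyRegular hD xs hlen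
      (fun y hy => hxs ▸ Ideal.subset_span hy) hreg)

/-- A module of codepth one has a free first syzygy: the syzygy gains one unit of depth and reaches
the maximum. Applied to maximal Cohen-Macaulay modules over a hypersurface, this yields their matrix
factorizations. -/
theorem HasRegularParameters.free_of_exact {n : ℕ} (hS : HasRegularParameters S (n + 1))
    [Module.Finite S X] [Module.Finite S Y] [Module.Free S Y] (f : X →ₗ[S] Y) (g : Y →ₗ[S] Z)
    (hf : Function.Injective f) (hg : Function.Surjective g) (hfg : Function.Exact f g)
    (hZ : ∀ i < n, ExtZero S (ResidueField S) Z i) : Module.Free S X := by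
  rw [hS.free_iff]
  have hY := hS.free_iff.mp ‹Module.Free S Y›
  intro i hi
  cases i with
  | zero =>
    rw [extZero_zero_iff]
    intro φ
    have h0 := extZero_zero_iff.mp (hY 0 hi) (f ∘ₗ φ)
    ext x
    exact hf ((LinearMap.congr_fun h0 x).trans (map_zero f).symm)
  | succ i => exact ExtZero.covariant_left f g hf hg hfg (hZ i (by omega)) (hY _ hi)

theorem HasRegularParameters.extZero_of_exact {n : ℕ} (hS : HasRegularParameters S (n + 1))
    [Module.Finite S X] [Module.Finite S Y] [Module.Free S X] [Module.Free S Y] (f : X →ₗ[S] Y)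
    (g : Y →ₗ[S] Z) (hf : Function.Injective f) (hg : Function.Surjective g)
    (hfg : Function.Exact f g) : ∀ i < n, ExtZero S (ResidueField S) Z i := fun i hi =>
  ExtZero.covariant_right f g hf hg hfg (hS.free_iff.mp ‹Module.Free S Y› i (by omega))
    (hS.free_iff.mp ‹Module.Free S X› (i + 1) (by omega))

end RegularLocal

section Hypersurface

variable {S : Type u} [CommRing S] {R : Type u} [CommRing R] [Algebra S R]

/-- Coordinatewise reduction of free modules along an algebra. -/
abbrev reduction (S R : Type u) [CommRing S] [CommRing R] [Algebra S R] (n : ℕ) :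
    (Fin n → S) →ₗ[S] (Fin n → R) :=
  (Algebra.linearMap S R).compLeft (Fin n)

theorem reduction_surjective (hSR : Function.Surjective (algebraMap S R)) (n : ℕ) :
    Function.Surjective (reduction S R n) := fun v => by
  choose w hw using fun i => hSR (v i)
  exact ⟨w, funext hw⟩

theorem reduction_eq_zero_iff {f : S} (hker : RingHom.ker (algebraMap S R) = Ideal.span {f})
    {n : ℕ} (v : Fin n → S) : reduction S R n v = 0 ↔ ∃ w, v = f • w := by
  constructor
  · intro h
    have : ∀ i, ∃ c, f * c = v i := fun i => by
      have h1 : v i ∈ RingHom.ker (algebraMap S R) := congrFun h i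
      rw [hker, Ideal.mem_span_singleton] at h1
      obtain ⟨c, hc⟩ := h1
      exact ⟨c, hc.symm⟩
    choose w hw using this
    exact ⟨w, funext fun i => (hw i).symm⟩
  · rintro ⟨w, rfl⟩
    have h1 : f ∈ RingHom.ker (algebraMap S R) := hker ▸ Ideal.mem_span_singleton_self f
    funext i
    simp [RingHom.mem_ker.mp h1]

theorem exists_comp_reduction_eq {M : Type u} [AddCommGroup M] [Module R M] [Module S M]
    [IsScalarTower S R M] {n : ℕ} (h : (Fin n → S) →ₗ[S] M) :
    ∃ h' : (Fin n → R) →ₗ[R] M, ∀ v, h' (reduction S R n v) = h v := by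
  refine ⟨Fintype.linearCombination R fun i => h (Pi.single i 1), fun v => ?_⟩
  conv_rhs => rw [pi_eq_sum_univ' v]
  simp [Fintype.linearCombination_apply, map_sum]

variable [IsLocalRing S] [IsNoetherianRing S] [IsLocalRing R]
variable {f : S} {n : ℕ}

omit [IsLocalRing R] in
theorem ringKrullDim_hypersurface (hS : HasRegularParameters S (n + 1)) (hf : IsSMulRegular S f)
    (hfm : f ∈ maximalIdeal S) (hSR : Function.Surjective (algebraMap S R))
    (hker : RingHom.ker (algebraMap S R) = Ideal.span {f}) : ringKrullDim R = (n : ℕ) := by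
  have h1 := ringKrullDim_quotient_span_singleton_succ_eq_ringKrullDim hf hfm
  let e : (S ⧸ Ideal.span {f}) ≃+* R :=
    (Ideal.quotEquivOfEq hker.symm).trans (RingHom.quotientKerEquivOfSurjective hSR)
  rw [ringKrullDim_eq_of_ringEquiv e, hS.ringKrullDim_eq] at h1
  generalize ringKrullDim R = x at h1
  induction x with
  | bot => exact absurd h1 (by rw [WithBot.bot_add]; exact WithBot.bot_ne_coe)
  | coe x =>
    have h2 : x + 1 = (n : ℕ∞) + 1 := by exact_mod_cast h1
    have h3 : x = n := by
      have := (ENat.add_left_injective_of_ne_top (n := 1) (by simp)) h2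
      exact this
    rw [h3]; rfl

section Modules

variable {M : Type u} [AddCommGroup M] [Module R M] [Module S M] [IsScalarTower S R M]

theorem isMaximalCohenMacaulay_hypersurface (hS : HasRegularParameters S (n + 1))
    (hf : IsSMulRegular S f) (hfm : f ∈ maximalIdeal S)
    (hSR : Function.Surjective (algebraMap S R))
    (hker : RingHom.ker (algebraMap S R) = Ideal.span {f}) : IsMaximalCohenMacaulay R R := by
  have : Module.Finite S R := Module.Finite.of_surjective (Algebra.linearMap S R) hSR
  rw [isMaximalCohenMacaulay_iff_extZero hSR (ringKrullDim_hypersurface hS hf hfm hSR hker)]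
  refine hS.extZero_of_exact (LinearMap.lsmul S S f) (Algebra.linearMap S R) hf hSR fun s => ?_
  change algebraMap S R s = 0 ↔ _
  rw [← RingHom.mem_ker, hker, Ideal.mem_span_singleton']
  simp [mul_comm]

/-- The lift to the ambient regular ring of a presentation of a maximal Cohen-Macaulay module over a
hypersurface is a length one free resolution. -/
theorem free_ker_of_hypersurface (hS : HasRegularParameters S (n + 1)) (hf : IsSMulRegular S f)
    (hfm : f ∈ maximalIdeal S) (hSR : Function.Surjective (algebraMap S R))
    (hker : RingHom.ker (algebraMap S R) = Ideal.span {f}) [Module.Finite S M]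
    (hM : IsMaximalCohenMacaulay R M) {m : ℕ} (π : (Fin m → S) →ₗ[S] M)
    (hπ : Function.Surjective π) : Module.Free S (LinearMap.ker π) :=
  hS.free_of_exact (LinearMap.ker π).subtype π (LinearMap.ker π).subtype_injective hπ
    (LinearMap.exact_subtype_ker_map π) ((isMaximalCohenMacaulay_iff_extZero hSR
      (ringKrullDim_hypersurface hS hf hfm hSR hker)).mp hM)

/-- Over S the kernel K of Sᵐ → M is free, so a map φ : ker π → R lifts to φ' : K → S. Because f Sᵐ
lies in K, the map ψ(v) = φ'(fv)/f extends φ' to Sᵐ, and its reduction extends φ. -/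
theorem extZero_hypersurface (hS : HasRegularParameters S (n + 1)) (hf : IsSMulRegular S f)
    (hfm : f ∈ maximalIdeal S) (hSR : Function.Surjective (algebraMap S R))
    (hker : RingHom.ker (algebraMap S R) = Ideal.span {f}) [Module.Finite S M]
    (hM : IsMaximalCohenMacaulay R M) : ExtZero R M R 1 := by
  have : Module.Finite R M := Module.Finite.of_restrictScalars_finite S R M
  obtain ⟨m, π, hπ⟩ := Module.Finite.exists_fin' R M
  let πS : (Fin m → S) →ₗ[S] M := π.restrictScalars S ∘ₗ reduction S R m
  have hπS : Function.Surjective πS := hπ.comp (reduction_surjective hSR m)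
  have hfree := free_ker_of_hypersurface hS hf hfm hSR hker hM πS hπS
  refine ExtZero.of_exists_extend (LinearMap.ker π).subtype π (LinearMap.ker π).subtype_injective
    hπ (LinearMap.exact_subtype_ker_map π) fun φ => ?_
  let τ : LinearMap.ker πS →ₗ[S] LinearMap.ker π :=
    { toFun := fun v => ⟨reduction S R m v, v.2⟩
      map_add' := fun v w => Subtype.ext (map_add _ _ _)
      map_smul' := fun s v => Subtype.ext (map_smul _ _ _) }
  obtain ⟨φ', hφ'⟩ := Module.projective_lifting_property (Algebra.linearMap S R)
    (φ.restrictScalars S ∘ₗ τ) hSR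
  have hφ'' : ∀ v, algebraMap S R (φ' v) = φ (τ v) := fun v => LinearMap.congr_fun hφ' v
  have hred : ∀ v : Fin m → S, reduction S R m (f • v) = 0 := fun v =>
    (reduction_eq_zero_iff hker _).mpr ⟨v, rfl⟩
  let μ : (Fin m → S) →ₗ[S] LinearMap.ker πS := (f • LinearMap.id).codRestrict _ fun v => by
    change π (reduction S R m (f • v)) = 0
    rw [hred, map_zero]
  have hex : Function.Exact (LinearMap.lsmul S S f) (Algebra.linearMap S R) := fun s => by
    change algebraMap S R s = 0 ↔ _
    rw [← RingHom.mem_ker, hker, Ideal.mem_span_singleton']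
    simp [mul_comm]
  -- Division by f is possible because fv reduces to zero in ker π, so φ'(fv) vanishes in R.
  obtain ⟨ψ, hψ⟩ := exists_comp_eq_of_exact_left (f := LinearMap.lsmul S S f) hf hex (φ' ∘ₗ μ)
    fun v => by
      change algebraMap S R (φ' (μ v)) = 0
      have : τ (μ v) = 0 := Subtype.ext (hred v)
      rw [hφ'', this, map_zero]
  obtain ⟨ψ', hψ'⟩ := exists_comp_reduction_eq (R := R) (Algebra.linearMap S R ∘ₗ ψ)
  refine ⟨ψ', LinearMap.ext fun ⟨x, hx⟩ => ?_⟩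
  obtain ⟨v, rfl⟩ := reduction_surjective hSR m x
  have hv : v ∈ LinearMap.ker πS := hx
  change ψ' (reduction S R m v) = φ (τ ⟨v, hv⟩)
  rw [hψ', ← hφ'']
  change algebraMap S R (ψ v) = _
  congr 1
  have h1 := hψ v
  have h2 : μ v = f • ⟨v, hv⟩ := rfl
  rw [LinearMap.comp_apply, h2, map_smul] at h1
  exact hf h1

/-- Eisenbud's periodicity: with K as above, multiplication by f maps Sˡ into K ≅ Sᵐ and induces an
embedding M = Sˡ/K → K/fK ≅ Rᵐ. The cokernel K/fSˡ is ker π, so the R-syzygy of M also serves as its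
cosyzygy. -/
theorem exists_cosyzygy_hypersurface (hS : HasRegularParameters S (n + 1))
    (hf : IsSMulRegular S f) (hfm : f ∈ maximalIdeal S)
    (hSR : Function.Surjective (algebraMap S R))
    (hker : RingHom.ker (algebraMap S R) = Ideal.span {f}) [Module.Finite S M]
    (hM : IsMaximalCohenMacaulay R M) :
    ∃ (m : ℕ) (Z : ModuleCat.{u} R) (i : M →ₗ[R] (Fin m → R)) (p : (Fin m → R) →ₗ[R] Z),
      Function.Injective i ∧ Function.Surjective p ∧ Function.Exact i p ∧
      IsMaximalCohenMacaulay R Z := by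
  have : Module.Finite R M := Module.Finite.of_restrictScalars_finite S R M
  have hR : IsNoetherianRing R := isNoetherianRing_of_surjective S R _ hSR
  have hD := ringKrullDim_hypersurface hS hf hfm hSR hker
  obtain ⟨l, π, hπ⟩ := Module.Finite.exists_fin' R M
  let πS : (Fin l → S) →ₗ[S] M := π.restrictScalars S ∘ₗ reduction S R l
  have hπS : Function.Surjective πS := hπ.comp (reduction_surjective hSR l)
  have hfree := free_ker_of_hypersurface hS hf hfm hSR hker hM πS hπS
  let τ : LinearMap.ker πS →ₗ[S] LinearMap.ker π :=
    { toFun := fun v => ⟨reduction S R l v, v.2⟩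
      map_add' := fun v w => Subtype.ext (map_add _ _ _)
      map_smul' := fun s v => Subtype.ext (map_smul _ _ _) }
  have hτ : Function.Surjective τ := fun ⟨x, hx⟩ => by
    obtain ⟨v, rfl⟩ := reduction_surjective hSR l x
    exact ⟨⟨v, hx⟩, rfl⟩
  have hred : ∀ v : Fin l → S, reduction S R l (f • v) = 0 := fun v =>
    (reduction_eq_zero_iff hker _).mpr ⟨v, rfl⟩
  let μ : (Fin l → S) →ₗ[S] LinearMap.ker πS := (f • LinearMap.id).codRestrict _ fun v => by
    change π (reduction S R l (f • v)) = 0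
    rw [hred, map_zero]
  let m := Module.finrank S (LinearMap.ker πS)
  let e : LinearMap.ker πS ≃ₗ[S] (Fin m → S) := (Module.finBasis S _).equivFun
  have hμe : ∀ v : LinearMap.ker πS, reduction S R m (e (μ v)) = 0 := fun v => by
    have : μ v = f • v := rfl
    rw [this, map_smul, reduction_eq_zero_iff hker]
    exact ⟨_, rfl⟩
  obtain ⟨i₀, hi₀⟩ := exists_comp_eq_of_exact_right hπS (LinearMap.exact_subtype_ker_map πS)
    (reduction S R m ∘ₗ e.toLinearMap ∘ₗ μ) hμe
  obtain ⟨p, hp⟩ := exists_comp_reduction_eq (R := R) (τ ∘ₗ e.symm.toLinearMap)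
  have hreg : ∀ v w : Fin l → S, f • v = f • w → v = w := fun v w h =>
    funext fun i => hf (congrFun h i)
  refine ⟨m, ModuleCat.of R (LinearMap.ker π), i₀.extendScalarsOfSurjective hSR, p, ?_, ?_, ?_, ?_⟩
  · rw [injective_iff_map_eq_zero]
    intro x hx
    obtain ⟨v, rfl⟩ := hπS x
    have h1 : reduction S R m (e (μ v)) = 0 := (hi₀ v).symm.trans hx
    obtain ⟨w, hw⟩ := (reduction_eq_zero_iff hker _).mp h1
    have h2 : μ v = f • e.symm w := by rw [← map_smul, ← hw, e.symm_apply_apply]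
    have h3 : v = e.symm w := hreg _ _ (congrArg Subtype.val h2)
    rw [h3]
    exact (e.symm w).2
  · intro x
    obtain ⟨v, rfl⟩ := hτ x
    refine ⟨reduction S R m (e v), ?_⟩
    rw [hp]
    simp
  · intro y
    obtain ⟨w, rfl⟩ := reduction_surjective hSR m y
    rw [hp]
    constructor
    · intro h
      have h1 : reduction S R l (e.symm w) = 0 := congrArg Subtype.val h
      obtain ⟨v, hv⟩ := (reduction_eq_zero_iff hker _).mp h1
      refine ⟨πS v, (hi₀ v).trans ?_⟩
      have : μ v = e.symm w := Subtype.ext hv.symm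
      simp [this]
    · rintro ⟨x, hx⟩
      obtain ⟨v, rfl⟩ := hπS x
      have h1 : reduction S R m (e (μ v)) = reduction S R m w := (hi₀ v).symm.trans hx
      change (τ ∘ₗ e.symm.toLinearMap) w = 0
      rw [← hp, ← h1, hp]
      refine Subtype.ext ?_
      simp only [LinearMap.comp_apply, LinearEquiv.coe_coe, e.symm_apply_apply]
      exact hred v
  · have hcm := isMaximalCohenMacaulay_hypersurface hS hf hfm hSR hker
    refine isMaximalCohenMacaulay_of_exact hD (LinearMap.ker π).subtype π
      (LinearMap.ker π).subtype_injective hπ (LinearMap.exact_subtype_ker_map π) ?_ hM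
    rw [isMaximalCohenMacaulay_iff hD] at hcm ⊢
    exact fun i hi => (hcm i hi).pi_right l

end Modules

theorem isHenselianGorenstein_hypersurface [IsAdicComplete (maximalIdeal S) S]
    (hS : HasRegularParameters S (n + 1)) (hf : IsSMulRegular S f) (hfm : f ∈ maximalIdeal S)
    (hSR : Function.Surjective (algebraMap S R))
    (hker : RingHom.ker (algebraMap S R) = Ideal.span {f}) : IsHenselianGorenstein R where
  isNoetherianRing := isNoetherianRing_of_surjective S R _ hSR
  exists_dim := ⟨n, ringKrullDim_hypersurface hS hf hfm hSR hker⟩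
  cohenMacaulay := isMaximalCohenMacaulay_hypersurface hS hf hfm hSR hker
  extZero M _ _ _ hM := by
    let _ : Module S M := Module.compHom M (algebraMap S R)
    have : IsScalarTower S R M := .of_algebraMap_smul fun _ _ => rfl
    have : Module.Finite S R := Module.Finite.of_surjective (Algebra.linearMap S R) hSR
    have : Module.Finite S M := Module.Finite.trans R M
    exact extZero_hypersurface hS hf hfm hSR hker hM
  exists_cosyzygy M _ _ _ hM := by
    let _ : Module S M := Module.compHom M (algebraMap S R)
    have : IsScalarTower S R M := .of_algebraMap_smul fun _ _ => rfl
    have : Module.Finite S R := Module.Finite.of_surjective (Algebra.linearMap S R) hSR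
    have : Module.Finite S M := Module.Finite.trans R M
    exact exists_cosyzygy_hypersurface hS hf hfm hSR hker hM
  isLocalRing_of_idempotents C _ _ _ _ hC := by
    let _ : Algebra S C := Algebra.compHom C (algebraMap S R)
    have : IsScalarTower S R C := .of_algebraMap_smul fun _ _ => rfl
    have : Module.Finite S R := Module.Finite.of_surjective (Algebra.linearMap S R) hSR
    have : Module.Finite S C := Module.Finite.trans R C
    exact isLocalRing_of_idempotents_of_isAdicComplete (S := S) C hC

end Hypersurface

end LatticeType

/-! ### The double cover as a free algebra over the base -/

namespace LatticeType

open IsLocalRing RingTheory.Sequence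

/-- An algebra that is free on `1` and an element `root` with `root² = -f`. -/
structure DoubleCover (S : Type u) [CommRing S] (B : Type u) [CommRing B] [Algebra S B]
    (f : S) where
  root : B
  root_mul_root : root * root = -algebraMap S B f
  re : B →ₗ[S] S
  im : B →ₗ[S] S
  re_add_im : ∀ b, algebraMap S B (re b) + algebraMap S B (im b) * root = b
  re_one : re 1 = 1
  im_one : im 1 = 0
  re_root : re root = 0
  im_root : im root = 1

namespace DoubleCover

variable {S : Type u} [CommRing S] {B : Type u} [CommRing B] [Algebra S B] {f : S}
variable (C : DoubleCover S B f)
include C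

theorem re_algebraMap (s : S) : C.re (algebraMap S B s) = s := by
  rw [Algebra.algebraMap_eq_smul_one, map_smul, C.re_one, smul_eq_mul, mul_one]

theorem im_algebraMap (s : S) : C.im (algebraMap S B s) = 0 := by
  rw [Algebra.algebraMap_eq_smul_one, map_smul, C.im_one, smul_zero]

theorem re_mk (s t : S) : C.re (algebraMap S B s + algebraMap S B t * C.root) = s := by
  rw [map_add, C.re_algebraMap, ← Algebra.smul_def, map_smul, C.re_root, smul_zero, add_zero]

theorem im_mk (s t : S) : C.im (algebraMap S B s + algebraMap S B t * C.root) = t := by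
  rw [map_add, C.im_algebraMap, ← Algebra.smul_def, map_smul, C.im_root, smul_eq_mul, mul_one,
    zero_add]

theorem root_mul (b : B) :
    C.root * b = algebraMap S B (-(f * C.im b)) + algebraMap S B (C.re b) * C.root := by
  conv_lhs => rw [← C.re_add_im b]
  rw [map_neg, map_mul]
  linear_combination algebraMap S B (C.im b) * C.root_mul_root

theorem im_root_mul (b : B) : C.im (C.root * b) = C.re b := by rw [C.root_mul, C.im_mk]

theorem re_root_mul (b : B) : C.re (C.root * b) = -(f * C.im b) := by rw [C.root_mul, C.re_mk]

/-- The basis `1, root`. -/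
noncomputable def equivProd : B ≃ₗ[S] S × S :=
  LinearEquiv.ofLinearMap (C.re.prod C.im)
    ((Algebra.linearMap S B).coprod ((LinearMap.mulRight S C.root) ∘ₗ Algebra.linearMap S B))
    (by ext <;> simp [C.re_one, C.im_one, C.re_root, C.im_root])
    (by ext b; simpa using C.re_add_im b)

theorem finite : Module.Finite S B := Module.Finite.equiv C.equivProd.symm

theorem free : Module.Free S B := Module.Free.of_equiv C.equivProd.symm

theorem isSMulRegular_root (hf : IsSMulRegular S f) : IsSMulRegular B C.root := by
  intro a b hab
  have hab : C.root * a = C.root * b := hab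
  have h1 : C.re a = C.re b := by rw [← C.im_root_mul, hab, C.im_root_mul]
  have h2 : C.im a = C.im b := by
    have := congrArg C.re hab
    rw [C.re_root_mul, C.re_root_mul, neg_inj] at this
    exact hf this
  rw [← C.re_add_im a, ← C.re_add_im b, h1, h2]

theorem isUnit_of_isUnit_algebraMap {s : S} (h : IsUnit (algebraMap S B s)) : IsUnit s := by
  obtain ⟨c, hc⟩ := h.exists_right_inv
  have := congrArg C.re hc
  rw [← Algebra.smul_def, map_smul, C.re_one] at this
  exact IsUnit.of_mul_eq_one _ this

section Modules

variable {X : Type u} [AddCommGroup X] [Module B X] [Module S X] [IsScalarTower S B X]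

theorem smul_eq (b : B) (x : X) : b • x = C.re b • x + C.im b • C.root • x := by
  conv_lhs => rw [← C.re_add_im b]
  rw [add_smul, mul_smul, algebraMap_smul, algebraMap_smul]

theorem root_smul_root_smul (x : X) : C.root • C.root • x = -(f • x) := by
  rw [smul_smul, C.root_mul_root, neg_smul, algebraMap_smul]

/-- The linear map over the double cover whose `root`-component is a given `S`-linear map. -/
noncomputable def coind {n : ℕ} (ψ : X →ₗ[S] (Fin n → S)) : X →ₗ[B] (Fin n → B) where
  toFun x i := algebraMap S B (ψ (C.root • x) i) + algebraMap S B (ψ x i) * C.root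
  map_add' x y := by
    funext i
    simp only [smul_add, map_add, Pi.add_apply]
    ring
  map_smul' b x := by
    funext i
    have h1 : C.root • b • x = C.re b • C.root • x + C.im b • -(f • x) := by
      rw [C.smul_eq b x, smul_add, smul_comm C.root (C.re b), smul_comm C.root (C.im b),
        C.root_smul_root_smul]
    have h2 := C.smul_eq b x
    rw [h1, h2]
    simp only [map_add, map_smul, map_neg, Pi.add_apply, Pi.smul_apply, Pi.neg_apply, smul_eq_mul,
      map_mul, RingHom.id_apply]
    conv_rhs => rw [← C.re_add_im b]
    linear_combination -(algebraMap S B (C.im b) * algebraMap S B (ψ x i)) * C.root_mul_root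

theorem coind_apply {n : ℕ} (ψ : X →ₗ[S] (Fin n → S)) (x : X) (i : Fin n) :
    C.coind ψ x i = algebraMap S B (ψ (C.root • x) i) + algebraMap S B (ψ x i) * C.root := rfl

theorem im_coind {n : ℕ} (ψ : X →ₗ[S] (Fin n → S)) (x : X) (i : Fin n) :
    C.im (C.coind ψ x i) = ψ x i := by rw [coind_apply, im_mk]

theorem re_coind {n : ℕ} (ψ : X →ₗ[S] (Fin n → S)) (x : X) (i : Fin n) :
    C.re (C.coind ψ x i) = ψ (C.root • x) i := by rw [coind_apply, re_mk]

omit [Module S X] [IsScalarTower S B X] in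
-- The real part is recovered as re b = im (root · b). Thus `im` identifies Hom over B into B with
-- Hom over S into S, with inverse `coind`.
theorem eq_of_im_eq {φ φ' : X →ₗ[B] B} (h : ∀ x, C.im (φ x) = C.im (φ' x)) : φ = φ' := by
  ext x
  have h1 := h (C.root • x)
  rw [φ.map_smul, φ'.map_smul, smul_eq_mul, smul_eq_mul, C.im_root_mul, C.im_root_mul] at h1
  rw [← C.re_add_im (φ x), ← C.re_add_im (φ' x), h1, h x]

/-- Since X is S-free, ker π is an S-direct summand, so the S-linear form `im` ∘ φ extends along an
S-retraction; `coind` turns the extension into a B-linear one. -/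
theorem extZero [Module.Finite B X] [Module.Free S X] : ExtZero B X B 1 := by
  obtain ⟨m, π, hπ⟩ := Module.Finite.exists_fin' B X
  refine ExtZero.of_exists_extend (LinearMap.ker π).subtype π (LinearMap.ker π).subtype_injective
    hπ (LinearMap.exact_subtype_ker_map π) fun φ => ?_
  obtain ⟨σ, hσ⟩ := Module.projective_lifting_property (π.restrictScalars S)
    (LinearMap.id : X →ₗ[S] X) hπ
  have hσ' : ∀ x, π (σ x) = x := fun x => LinearMap.congr_fun hσ x
  let ρ : (Fin m → B) →ₗ[S] LinearMap.ker π :=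
    { toFun := fun y => ⟨y - σ (π y), by simp [hσ']⟩
      map_add' := fun y z => Subtype.ext (by simp only [map_add, Submodule.coe_add]; abel)
      map_smul' := fun s y => Subtype.ext (by
        have : π (s • y) = s • π y := (π.restrictScalars S).map_smul s y
        simp [this, smul_sub]) }
  let ψ : (Fin m → B) →ₗ[S] (Fin 1 → S) :=
    LinearMap.pi fun _ => C.im ∘ₗ φ.restrictScalars S ∘ₗ ρ
  refine ⟨LinearMap.proj 0 ∘ₗ C.coind ψ, C.eq_of_im_eq fun x => ?_⟩
  have h1 : ρ x = x := Subtype.ext (by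
    change (x : Fin m → B) - σ (π x) = x
    rw [LinearMap.mem_ker.mp x.2, map_zero, sub_zero])
  change C.im (C.coind ψ x 0) = _
  rw [im_coind]
  change C.im (φ (ρ x)) = _
  rw [h1]

/-- The embedding is coinduced from S-coordinates of X, so an element of its image is determined by
its imaginary part. -/
theorem exists_cosyzygy [Nontrivial S] [Module.Finite B X] [Module.Finite S X] [Module.Free S X] :
    ∃ (m : ℕ) (Z : ModuleCat.{u} B) (_ : Module S Z) (_ : IsScalarTower S B Z)
      (i : X →ₗ[B] (Fin m → B)) (p : (Fin m → B) →ₗ[B] Z), Function.Injective i ∧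
      Function.Surjective p ∧ Function.Exact i p ∧ Module.Free S Z := by
  let m := Module.finrank S X
  let e : X ≃ₗ[S] (Fin m → S) := (Module.finBasis S X).equivFun
  let i := C.coind e.toLinearMap
  refine ⟨m, ModuleCat.of B ((Fin m → B) ⧸ LinearMap.range i),
    inferInstanceAs (Module S ((Fin m → B) ⧸ LinearMap.range i)),
    inferInstanceAs (IsScalarTower S B ((Fin m → B) ⧸ LinearMap.range i)), i,
    (LinearMap.range i).mkQ, ?_, Submodule.mkQ_surjective _, LinearMap.exact_map_mkQ_range i, ?_⟩
  · intro x y hxy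
    refine e.injective (funext fun j => ?_)
    have := congrArg C.im (congrFun hxy j)
    rwa [C.im_coind, C.im_coind] at this
  -- The map q compares the real part with the one that the imaginary part would force on an element
  -- of the image. Its kernel is therefore the image, and the cokernel is Sᵐ.
  · let q : (Fin m → B) →ₗ[S] (Fin m → S) :=
      C.re.compLeft (Fin m) - e.toLinearMap ∘ₗ (LinearMap.lsmul B X C.root).restrictScalars S ∘ₗ
        e.symm.toLinearMap ∘ₗ C.im.compLeft (Fin m)
    have hq : ∀ y j, q y j = C.re (y j) - e (C.root • e.symm fun l => C.im (y l)) j :=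
      fun y j => rfl
    have hqs : Function.Surjective q := fun a => by
      refine ⟨fun j => algebraMap S B (a j), funext fun j => ?_⟩
      have h0 : (fun l => C.im (algebraMap S B (a l))) = 0 := funext fun l => C.im_algebraMap _
      rw [hq, h0, map_zero, smul_zero, map_zero, C.re_algebraMap]
      simp
    have hker : (LinearMap.range i).restrictScalars S = LinearMap.ker q := by
      ext y
      rw [Submodule.restrictScalars_mem, LinearMap.mem_ker]
      constructor
      · rintro ⟨x, rfl⟩
        have h0 : (e.symm fun l => C.im (i x l)) = x := by
          rw [e.symm_apply_eq]
          exact funext fun l => C.im_coind _ _ _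
        funext j
        rw [hq, h0, C.re_coind]
        exact sub_self _
      · intro h
        refine ⟨e.symm fun l => C.im (y l), funext fun j => ?_⟩
        rw [C.coind_apply, ← C.re_add_im (y j)]
        have h1 := congrFun h j
        rw [hq] at h1
        rw [sub_eq_zero.mp h1]
        simp
    exact Module.Free.of_equiv (((Submodule.Quotient.restrictScalarsEquiv S
      (LinearMap.range i)).symm.trans (Submodule.quotEquivOfEq _ _ hker)).trans
      (q.quotKerEquivOfSurjective hqs)).symm

end Modules

section Local

variable [IsLocalRing S] [IsNoetherianRing S] [IsLocalRing B] {n : ℕ}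

omit [IsLocalRing S] [IsNoetherianRing S] [IsLocalRing B] in
theorem isLocalHom_algebraMap : IsLocalHom (algebraMap S B) :=
  ⟨fun _ h => C.isUnit_of_isUnit_algebraMap h⟩

omit [IsNoetherianRing S] in
theorem root_mem (hfm : f ∈ maximalIdeal S) : C.root ∈ maximalIdeal B := by
  intro h
  refine hfm (C.isUnit_of_isUnit_algebraMap ?_)
  have := (h.mul h).neg
  rwa [C.root_mul_root, neg_neg] at this

omit [IsNoetherianRing S] in
-- The real part of a nonunit of B lies in the maximal ideal of S because `root` is a nonunit; the
-- remaining product of imaginary parts contributes `root`² = -f.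
theorem maximalIdeal_sq_le (hfm : f ∈ maximalIdeal S) :
    maximalIdeal B ^ 2 ≤ (maximalIdeal S).map (algebraMap S B) := by
  have hre : ∀ b ∈ maximalIdeal B, algebraMap S B (C.re b) ∈
      (maximalIdeal S).map (algebraMap S B) := by
    intro b hb
    refine Ideal.mem_map_of_mem _ fun h => ?_
    have h1 : algebraMap S B (C.re b) = b - algebraMap S B (C.im b) * C.root :=
      eq_sub_of_add_eq (C.re_add_im b)
    have h2 : algebraMap S B (C.re b) ∈ maximalIdeal B := by
      rw [h1]
      exact sub_mem hb (Ideal.mul_mem_left _ _ (C.root_mem hfm))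
    exact h2 (h.map _)
  rw [pow_two, Ideal.mul_le]
  intro a ha b hb
  have h : a * b = algebraMap S B (C.re a) * b + algebraMap S B (C.im a) * C.root *
      algebraMap S B (C.re b) - algebraMap S B (C.im a * C.im b) * algebraMap S B f := by
    rw [map_mul]
    linear_combination (-b) * C.re_add_im a - algebraMap S B (C.im a) * C.root * C.re_add_im b +
      algebraMap S B (C.im a) * algebraMap S B (C.im b) * C.root_mul_root
  rw [h]
  exact sub_mem (add_mem (Ideal.mul_mem_right _ _ (hre a ha)) (Ideal.mul_mem_left _ _ (hre b hb)))
    (Ideal.mul_mem_left _ _ (Ideal.mem_map_of_mem _ hfm))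

/-- Parameters of S stay regular on the free S-module B and generate an ideal containing the square
of the maximal ideal of B, which gives dim B = dim S. -/
theorem exists_parameters (hS : HasRegularParameters S n) (hfm : f ∈ maximalIdeal S) :
    ∃ xs : List S, xs.length = n ∧ Ideal.ofList xs = maximalIdeal S ∧ IsWeaklyRegular S xs ∧
      (∀ y ∈ xs.map (algebraMap S B), y ∈ maximalIdeal B) ∧
      IsWeaklyRegular B (xs.map (algebraMap S B)) ∧
      ringKrullDim B = (n : ℕ) := by
  have hB := C.finite
  have hBf := C.free
  have hBn : IsNoetherianRing B := isNoetherian_of_tower S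
    (isNoetherian_of_isNoetherianRing_of_finite S B)
  have hD := hS.ringKrullDim_eq
  have hmcm : IsMaximalCohenMacaulay S B :=
    (isMaximalCohenMacaulay_iff hD).mpr (hS.free_iff.mp hBf)
  obtain ⟨xs, hlen, hxs, hreg⟩ := hS
  have hloc := C.isLocalHom_algebraMap
  have hmem : ∀ x ∈ xs, x ∈ maximalIdeal S := fun y hy => hxs ▸ Ideal.subset_span hy
  have h1 : ∀ y ∈ xs.map (algebraMap S B), y ∈ maximalIdeal B := by
    intro y hy
    obtain ⟨x, hx, rfl⟩ := List.mem_map.mp hy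
    exact fun h => hmem x hx (C.isUnit_of_isUnit_algebraMap h)
  have h2 : IsWeaklyRegular B (xs.map (algebraMap S B)) :=
    (isWeaklyRegular_map_algebraMap_iff _ _ xs).mpr (hmcm.isWeaklyRegular hD xs hlen hmem hreg)
  refine ⟨xs, hlen, hxs, hreg, h1, h2, ?_⟩
  rw [ringKrullDim_eq_length_of_isWeaklyRegular _ h1 h2 (e := 2), List.length_map, hlen]
  rw [← Ideal.map_ofList, hxs]
  exact C.maximalIdeal_sq_le hfm

/-- Maximal Cohen-Macaulay modules over the double cover are the modules that are finite free over
the base. -/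
theorem isMaximalCohenMacaulay_iff_free (hS : HasRegularParameters S n) (hfm : f ∈ maximalIdeal S)
    {X : Type u} [AddCommGroup X] [Module B X] [Module S X] [IsScalarTower S B X]
    [Module.Finite B X] : IsMaximalCohenMacaulay B X ↔ Module.Free S X := by
  have hB := C.finite
  have hX : Module.Finite S X := Module.Finite.trans B X
  have hBn : IsNoetherianRing B := isNoetherian_of_tower S
    (isNoetherian_of_isNoetherianRing_of_finite S B)
  obtain ⟨xs, hlen, hxs, hreg, h1, h2, hD⟩ := C.exists_parameters hS hfm
  constructor
  · intro h
    have h3 := h.isWeaklyRegular hD _ (by rw [List.length_map, hlen]) h1 h2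
    exact free_of_isWeaklyRegular xs hxs X ((isWeaklyRegular_map_algebraMap_iff _ _ xs).mp h3)
  · intro h
    have h3 := (isMaximalCohenMacaulay_iff hS.ringKrullDim_eq).mpr (hS.free_iff.mp h)
    have h4 := h3.isWeaklyRegular hS.ringKrullDim_eq xs hlen
      (fun y hy => hxs ▸ Ideal.subset_span hy) hreg
    exact ⟨_, h1, (isWeaklyRegular_map_algebraMap_iff _ _ xs).mpr h4, by
      rw [hD, List.length_map, hlen]; rfl⟩

theorem isHenselianGorenstein [IsAdicComplete (maximalIdeal S) S]
    (hS : HasRegularParameters S n) (hfm : f ∈ maximalIdeal S) : IsHenselianGorenstein B where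
  isNoetherianRing := by
    have := C.finite
    exact isNoetherian_of_tower S (isNoetherian_of_isNoetherianRing_of_finite S B)
  exists_dim := by
    obtain ⟨xs, hlen, hxs, hreg, h1, h2, hD⟩ := C.exists_parameters hS hfm
    exact ⟨n, hD⟩
  cohenMacaulay := (C.isMaximalCohenMacaulay_iff_free hS hfm).mpr C.free
  extZero M _ _ _ hM := by
    let _ : Module S M := Module.compHom M (algebraMap S B)
    have : IsScalarTower S B M := .of_algebraMap_smul fun _ _ => rfl
    have := (C.isMaximalCohenMacaulay_iff_free hS hfm).mp hM
    exact C.extZero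
  exists_cosyzygy M _ _ _ hM := by
    let _ : Module S M := Module.compHom M (algebraMap S B)
    have : IsScalarTower S B M := .of_algebraMap_smul fun _ _ => rfl
    have := (C.isMaximalCohenMacaulay_iff_free hS hfm).mp hM
    have := C.finite
    have : Module.Finite S M := Module.Finite.trans B M
    obtain ⟨m, Z, _, _, i, p, hi, hp, hip, hZ⟩ := C.exists_cosyzygy (X := M)
    have : Module.Finite B Z := Module.Finite.of_surjective p hp
    exact ⟨m, Z, i, p, hi, hp, hip, (C.isMaximalCohenMacaulay_iff_free hS hfm).mpr hZ⟩
  isLocalRing_of_idempotents A _ _ _ _ hA := by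
    let _ : Algebra S A := Algebra.compHom A (algebraMap S B)
    have : IsScalarTower S B A := .of_algebraMap_smul fun _ _ => rfl
    have := C.finite
    have : Module.Finite S A := Module.Finite.trans B A
    exact isLocalRing_of_idempotents_of_isAdicComplete (S := S) A hA

end Local

end DoubleCover

end LatticeType

/-! ### The two functors: syzygy over the double cover and reduction modulo the root -/

namespace LatticeType

open IsLocalRing RingTheory.Sequence

namespace DoubleCover

variable {S R B : Type u} [CommRing S] [CommRing R] [CommRing B] [Algebra S B]
  [Algebra B R] {f : S} (C : DoubleCover S B f)
include C

theorem algebraMap_root (hker : RingHom.ker (algebraMap B R) = Ideal.span {C.root}) :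
    algebraMap B R C.root = 0 := by
  rw [← RingHom.mem_ker, hker]
  exact Ideal.mem_span_singleton_self _

theorem root_smul_eq_zero (hker : RingHom.ker (algebraMap B R) = Ideal.span {C.root})
    {M : Type u} [AddCommGroup M] [Module R M] [Module B M] [IsScalarTower B R M] (x : M) :
    C.root • x = 0 := by
  rw [← algebraMap_smul R, C.algebraMap_root hker, zero_smul]

theorem exact_root_reduction (hker : RingHom.ker (algebraMap B R) = Ideal.span {C.root}) (m : ℕ) :
    Function.Exact (LinearMap.lsmul B (Fin m → B) C.root) (reduction B R m) := fun v => by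
  rw [reduction_eq_zero_iff hker]
  exact ⟨fun ⟨w, hw⟩ => ⟨w, hw.symm⟩, fun ⟨w, hw⟩ => ⟨w, hw.symm⟩⟩

theorem lsmul_root_injective (hf : IsSMulRegular S f) {N : Type u} [AddCommGroup N] [Module B N]
    [Module S N] [IsScalarTower S B N] [Module.Free S N] :
    Function.Injective (LinearMap.lsmul B N C.root) := by
  rw [injective_iff_map_eq_zero]
  intro x hx
  have h1 : f • x = 0 := by
    have h2 : C.root • x = 0 := hx
    have := C.root_smul_root_smul x
    rw [h2, smul_zero] at this
    exact neg_eq_zero.mp this.symm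
  let b := Module.Free.chooseBasis S N
  refine b.repr.injective (Finsupp.ext fun i => hf ?_)
  have := congrArg (fun y => b.repr y i) h1
  simpa using this

section Syzygy

variable {M : Type u} [AddCommGroup M] [Module R M] [Module B M] [IsScalarTower B R M]

/-- Lift b = τσ on M to maps s : Bᵐ → Bᵖ and t : Bᵖ → Bᵐ. Then b - ts maps Bᵐ into ker π. On ker π
the map s is divisible by `root`, so ts factors through Bᵖ by way of `root`·t, which lands in ker π.
Both summands of b on ker π thus factor through free modules. -/
theorem mem_stableAnnihilator_ker (hf : IsSMulRegular S f)
    (hBR : Function.Surjective (algebraMap B R))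
    (hker : RingHom.ker (algebraMap B R) = Ideal.span {C.root}) [Module.Finite R M] {m : ℕ}
    (π : (Fin m → B) →ₗ[B] M) (hπ : Function.Surjective π) {b : B}
    (hb : algebraMap B R b ∈ stableAnnihilator R M) :
    b ∈ stableAnnihilator B (LinearMap.ker π) := by
  obtain ⟨p, τ, hτ⟩ := Module.Finite.exists_fin' R M
  obtain ⟨σ, hσ⟩ := (mem_stableAnnihilator_iff_exists_lift τ hτ).mp hb
  have hσ' : ∀ x, τ (σ x) = b • x := fun x => by
    rw [← algebraMap_smul R b x]; exact LinearMap.congr_fun hσ x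
  obtain ⟨t, ht⟩ := Module.projective_lifting_property π (τ.restrictScalars B ∘ₗ reduction B R p) hπ
  have ht' : ∀ w, π (t w) = τ (reduction B R p w) := fun w => LinearMap.congr_fun ht w
  obtain ⟨s, hs⟩ := Module.projective_lifting_property (reduction B R p)
    (σ.restrictScalars B ∘ₗ π) (reduction_surjective hBR p)
  have hs' : ∀ v, reduction B R p (s v) = σ (π v) := fun v => LinearMap.congr_fun hs v
  have hroot : Function.Injective (LinearMap.lsmul B (Fin p → B) C.root) := fun v w h =>
    funext fun i => C.isSMulRegular_root hf (congrFun h i)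
  obtain ⟨ω, hω⟩ := exists_comp_eq_of_exact_left hroot (C.exact_root_reduction hker p)
    (s ∘ₗ (LinearMap.ker π).subtype) fun x => by
      change reduction B R p (s x) = 0
      rw [hs', LinearMap.mem_ker.mp x.2, map_zero]
  let h : (Fin m → B) →ₗ[B] LinearMap.ker π := (b • LinearMap.id - t ∘ₗ s).codRestrict _ fun v => by
    rw [LinearMap.mem_ker]
    simp [ht', hs', hσ']
  let t' : (Fin p → B) →ₗ[B] LinearMap.ker π := (C.root • t).codRestrict _ fun w => by
    rw [LinearMap.mem_ker, LinearMap.smul_apply, map_smul, C.root_smul_eq_zero hker]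
  rw [mem_stableAnnihilator]
  have hsum : b • LinearMap.id = h ∘ₗ (LinearMap.ker π).subtype + t' ∘ₗ ω := by
    refine LinearMap.ext fun x => Subtype.ext ?_
    have h1 : C.root • t (ω x) = t (s x) := by
      rw [← map_smul]; exact congrArg t (hω x)
    change b • (x : Fin m → B) = (b • (x : Fin m → B) - t (s x)) + C.root • t (ω x)
    rw [h1, sub_add_cancel]
  rw [hsum]
  exact add_mem (mem_projectiveMaps_of_comp _ _) (mem_projectiveMaps_of_comp _ _)

/-- A module over the hypersurface is a summand of the reduction of its syzygy over the double
cover. -/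
theorem isRetract_reduction_ker [Module S M] [IsScalarTower S B M]
    (hBR : Function.Surjective (algebraMap B R))
    (hker : RingHom.ker (algebraMap B R) = Ideal.span {C.root}) {m : ℕ}
    (π : (Fin m → B) →ₗ[B] M) (hπ : Function.Surjective π)
    {Q : Type u} [AddCommGroup Q] [Module R Q] [Module B Q] [IsScalarTower B R Q]
    (q : LinearMap.ker π →ₗ[B] Q) (hq : Function.Surjective q)
    (hqe : Function.Exact (LinearMap.lsmul B (LinearMap.ker π) C.root) q) : IsRetract R M Q := by
  -- The inclusion M → Q sends π(v) to the class of `root`·v. The retraction is induced by x ↦ π(im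
  -- x), coordinatewise, which is B-linear on ker π because `root` kills M.
  let μ : (Fin m → B) →ₗ[B] LinearMap.ker π := (C.root • LinearMap.id).codRestrict _ fun v => by
    rw [LinearMap.mem_ker, LinearMap.smul_apply, map_smul, C.root_smul_eq_zero hker]
  obtain ⟨i, hi⟩ := exists_comp_eq_of_exact_right hπ (LinearMap.exact_subtype_ker_map π) (q ∘ₗ μ)
    fun x => (hqe _).mpr ⟨x, rfl⟩
  let ι : (B →ₗ[S] S) → (Fin m → B) →ₗ[S] (Fin m → B) := fun c =>
    (Algebra.linearMap S B ∘ₗ c).compLeft (Fin m)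
  have hre : ∀ v, π (ι C.re v) = π v := fun v => by
    have h1 : v = ι C.re v + C.root • ι C.im v := funext fun j => by
      conv_lhs => rw [← C.re_add_im (v j), mul_comm]
      rfl
    conv_rhs => rw [h1]
    rw [map_add, map_smul, C.root_smul_eq_zero hker, add_zero]
  -- The imaginary part of `root`·v is the real part of v, and π sees only real parts. This gives
  -- both p ∘ i = id and the vanishing of θ on multiples of `root`.
  have him : ∀ v, π (ι C.im (C.root • v)) = π v := fun v => by
    rw [← hre v]
    congr 1
    funext j
    exact congrArg (algebraMap S B) (C.im_root_mul _)
  let θ : LinearMap.ker π →ₗ[B] M :=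
    { toFun := fun x => π (ι C.im x)
      map_add' := fun x y => by rw [Submodule.coe_add, map_add, map_add]
      map_smul' := fun b x => by
        have h1 : ((b • x : LinearMap.ker π) : Fin m → B) =
            C.re b • (x : Fin m → B) + C.im b • C.root • (x : Fin m → B) := C.smul_eq b _
        have h2 : ∀ (s : S) (v : Fin m → B), π (s • v) = s • π v :=
          fun s v => (π.restrictScalars S).map_smul s v
        rw [h1, map_add, map_smul, map_smul, map_add, h2, h2, him, LinearMap.mem_ker.mp x.2,
          RingHom.id_apply, C.smul_eq b, C.root_smul_eq_zero hker] }
  obtain ⟨p, hp⟩ := exists_comp_eq_of_exact_right hq hqe θ fun x => by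
    change π (ι C.im (C.root • (x : Fin m → B))) = 0
    rw [him, LinearMap.mem_ker.mp x.2]
  refine ⟨i.extendScalarsOfSurjective hBR, p.extendScalarsOfSurjective hBR, ?_⟩
  ext x
  obtain ⟨v, rfl⟩ := hπ x
  change p (i (π v)) = π v
  rw [hi, LinearMap.comp_apply, hp]
  exact him v

variable [Algebra S R] [IsScalarTower S B R] [IsLocalRing S] [IsNoetherianRing S] [IsLocalRing R]
  [IsLocalRing B] {n : ℕ}

omit [Algebra B R] [IsScalarTower B R M] [IsScalarTower S B R] [IsLocalRing B] in
/-- The syzygy over the double cover of a maximal Cohen-Macaulay module over the hypersurface is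
free over the base. -/
theorem free_ker [Module S M] [IsScalarTower S B M] [IsScalarTower S R M]
    (hS : HasRegularParameters S (n + 1)) (hR : ringKrullDim R = (n : ℕ))
    (hSR : Function.Surjective (algebraMap S R)) [Module.Finite R M]
    (hM : IsMaximalCohenMacaulay R M) {m : ℕ} (π : (Fin m → B) →ₗ[B] M)
    (hπ : Function.Surjective π) : Module.Free S (LinearMap.ker π) := by
  have := C.finite
  have := C.free
  have : Module.Finite S R := Module.Finite.of_surjective (Algebra.linearMap S R) hSR
  have : Module.Finite S M := Module.Finite.trans R M
  have : Module.Finite S (LinearMap.ker π) := inferInstanceAs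
    (Module.Finite S (LinearMap.ker (π.restrictScalars S)))
  exact hS.free_of_exact (Y := Fin m → B) ((LinearMap.ker π).subtype.restrictScalars S)
    (π.restrictScalars S) (LinearMap.ker π).subtype_injective hπ
    (LinearMap.exact_subtype_ker_map π) ((isMaximalCohenMacaulay_iff_extZero hSR hR).mp hM)

omit [IsScalarTower S B R] in
theorem hasSizeLE_ker [Module S M] [IsScalarTower S B M] [IsScalarTower S R M]
    (hS : HasRegularParameters S (n + 1)) (hf : IsSMulRegular S f)
    (hR : ringKrullDim R = (n : ℕ)) (hSR : Function.Surjective (algebraMap S R))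
    (hBR : Function.Surjective (algebraMap B R))
    (hker : RingHom.ker (algebraMap B R) = Ideal.span {C.root}) [Module.Finite R M]
    (hM : IsMaximalCohenMacaulay R M) {m l : ℕ} (π : (Fin m → B) →ₗ[B] M)
    (hπ : Function.Surjective π) (hml : m ≤ l) (hl : HasSizeLE R l M) :
    HasSizeLE B (2 * l) (LinearMap.ker π) := by
  have hfree := C.free_ker hS hR hSR hM π hπ
  have := C.finite
  have := C.free
  have : Module.Finite S (LinearMap.ker π) := inferInstanceAs
    (Module.Finite S (LinearMap.ker (π.restrictScalars S)))
  constructor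
  -- The kernel is a free S-submodule of Bᵐ, so its rank is at most 2m, and an S-basis generates it
  -- over B. This is the source of the factor 2.
  · have h1 : Module.finrank S (LinearMap.ker π) ≤ Module.finrank S (Fin m → B) :=
      LinearMap.finrank_le_finrank_of_injective
        (f := (LinearMap.ker π).subtype.restrictScalars S) (LinearMap.ker π).subtype_injective
    have h2 : Module.finrank S (Fin m → B) = m * 2 := by
      rw [Module.finrank_pi_fintype, C.equivProd.finrank_eq, Module.finrank_prod,
        Module.finrank_self]
      simp
    let b := Module.finBasis S (LinearMap.ker π)
    have h3 : minGenerators B (LinearMap.ker π) ≤ Module.finrank S (LinearMap.ker π) := by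
      refine minGenerators_le (Fintype.linearCombination B b) ?_
      intro x
      refine ⟨fun j => algebraMap S B (b.repr x j), ?_⟩
      rw [Fintype.linearCombination_apply]
      simp only [algebraMap_smul]
      exact b.sum_repr x
    omega
  · refine (Ideal.pow_le_pow_right (show l ≤ 2 * l by omega)).trans fun a ha => ?_
    refine C.mem_stableAnnihilator_ker hf hBR hker π hπ (hl.2 ?_)
    rw [← map_maximalIdeal_of_surjective _ hBR, ← Ideal.map_pow]
    exact Ideal.mem_map_of_mem _ ha

omit [IsScalarTower S B R] in
theorem isLattice_ker [Module S M] [IsScalarTower S B M] [IsScalarTower S R M]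
    (hS : HasRegularParameters S (n + 1)) (hf : IsSMulRegular S f) (hfm : f ∈ maximalIdeal S)
    (hR : ringKrullDim R = (n : ℕ)) (hSR : Function.Surjective (algebraMap S R))
    (hBR : Function.Surjective (algebraMap B R))
    (hker : RingHom.ker (algebraMap B R) = Ideal.span {C.root}) (hM : IsLattice R M) {m : ℕ}
    (π : (Fin m → B) →ₗ[B] M) (hπ : Function.Surjective π) :
    IsLattice B (LinearMap.ker π) := by
  have hfin := hM.finite
  have hfree := C.free_ker hS hR hSR hM.maximalCohenMacaulay π hπ
  have hB := C.finite
  have hBn : IsNoetherianRing B := isNoetherian_of_tower S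
    (isNoetherian_of_isNoetherianRing_of_finite S B)
  have hRn : IsNoetherianRing R := isNoetherianRing_of_surjective S R _ hSR
  rw [isLattice_iff] at hM ⊢
  obtain ⟨-, -, e, he⟩ := hM
  refine ⟨inferInstance, (C.isMaximalCohenMacaulay_iff_free hS hfm).mpr hfree, e, fun a ha => ?_⟩
  refine C.mem_stableAnnihilator_ker hf hBR hker π hπ (he ?_)
  rw [← map_maximalIdeal_of_surjective _ hBR, ← Ideal.map_pow]
  exact Ideal.mem_map_of_mem _ ha

end Syzygy

section Reduction

variable {N : Type u} [AddCommGroup N] [Module B N]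
variable {Q : Type u} [AddCommGroup Q] [Module R Q] [Module B Q] [IsScalarTower B R Q]

theorem mem_stableAnnihilator_reduction (hBR : Function.Surjective (algebraMap B R))
    (hker : RingHom.ker (algebraMap B R) = Ideal.span {C.root}) [Module.Finite B N]
    (q : N →ₗ[B] Q) (hq : Function.Surjective q)
    (hqe : Function.Exact (LinearMap.lsmul B N C.root) q) {b : B}
    (hb : b ∈ stableAnnihilator B N) : algebraMap B R b ∈ stableAnnihilator R Q := by
  obtain ⟨m, π, hπ⟩ := Module.Finite.exists_fin' B N
  obtain ⟨s, hs⟩ := (mem_stableAnnihilator_iff_exists_lift π hπ).mp hb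
  obtain ⟨s', hs'⟩ := exists_comp_eq_of_exact_right hq hqe (reduction B R m ∘ₗ s) fun x => by
    change reduction B R m (s (C.root • x)) = 0
    rw [map_smul, map_smul, C.root_smul_eq_zero hker]
  obtain ⟨π', hπ'⟩ := exists_comp_reduction_eq (R := R) (q ∘ₗ π)
  rw [mem_stableAnnihilator]
  have h : algebraMap B R b • LinearMap.id = π' ∘ₗ s'.extendScalarsOfSurjective hBR := by
    ext y
    obtain ⟨x, rfl⟩ := hq y
    change algebraMap B R b • q x = π' (s' (q x))
    rw [hs', LinearMap.comp_apply, hπ', algebraMap_smul, ← map_smul]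
    exact congrArg q (LinearMap.congr_fun hs x).symm
  rw [h]
  exact mem_projectiveMaps_of_comp _ _

variable [IsLocalRing R] [IsLocalRing B]

theorem hasSizeLE_reduction (hBR : Function.Surjective (algebraMap B R))
    (hker : RingHom.ker (algebraMap B R) = Ideal.span {C.root}) [Module.Finite B N]
    (q : N →ₗ[B] Q) (hq : Function.Surjective q)
    (hqe : Function.Exact (LinearMap.lsmul B N C.root) q) {l : ℕ} (hl : HasSizeLE B l N) :
    HasSizeLE R l Q := by
  constructor
  · obtain ⟨π, hπ⟩ := exists_surjective_minGenerators (A := B) (M := N)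
    obtain ⟨π', hπ'⟩ := exists_comp_reduction_eq (R := R) (q ∘ₗ π)
    refine (minGenerators_le π' fun y => ?_).trans hl.1
    obtain ⟨x, rfl⟩ := hq y
    obtain ⟨v, rfl⟩ := hπ x
    exact ⟨_, hπ' v⟩
  · rw [← map_maximalIdeal_of_surjective _ hBR, ← Ideal.map_pow]
    intro r hr
    obtain ⟨b, hb, rfl⟩ := (Ideal.mem_map_iff_of_surjective _ hBR).mp hr
    exact C.mem_stableAnnihilator_reduction hBR hker q hq hqe (hl.2 hb)

/-- A lattice over the double cover is a summand of every syzygy of its reduction. -/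
theorem isRetract_ker_reduction [Module S N] [IsScalarTower S B N] [Module.Free S N]
    [IsLocalRing S] (hf : IsSMulRegular S f) (hfm : f ∈ maximalIdeal S) (h2 : IsUnit (2 : B))
    [Module.Finite B N] (q : N →ₗ[B] Q) (hq : Function.Surjective q)
    (hqe : Function.Exact (LinearMap.lsmul B N C.root) q) {m : ℕ} (π : (Fin m → B) →ₗ[B] Q)
    (hπ : Function.Surjective π) : IsRetract B N (LinearMap.ker π) := by
  obtain ⟨ρ, hρ⟩ := Module.projective_lifting_property q π hq
  have hρ' : ∀ v, q (ρ v) = π v := fun v => LinearMap.congr_fun hρ v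
  have hroot := C.lsmul_root_injective hf (N := N)
  have hρs : Function.Surjective ρ := by
    -- Nakayama's lemma: ρ is onto modulo `root`·N, and `root` lies in the maximal ideal.
    rw [← LinearMap.range_eq_top, eq_top_iff]
    refine Submodule.le_of_le_smul_of_le_jacobson_bot (I := maximalIdeal B) Module.Finite.fg_top
      (maximalIdeal_le_jacobson _) fun x _ => ?_
    obtain ⟨v, hv⟩ := hπ (q x)
    obtain ⟨y, hy⟩ := (hqe (x - ρ v)).mp (by rw [map_sub, hρ', hv, sub_self])
    have hx : x = ρ v + C.root • y := by
      change C.root • y = x - ρ v at hy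
      rw [hy, add_sub_cancel]
    rw [hx]
    exact add_mem (Submodule.mem_sup_left ⟨v, rfl⟩) (Submodule.mem_sup_right
      (Submodule.smul_mem_smul (C.root_mem hfm) trivial))
  obtain ⟨τ, hτ⟩ := Module.projective_lifting_property (ρ.restrictScalars S)
    (LinearMap.id : N →ₗ[S] N) hρs
  have hτ' : ∀ x, ρ (τ x) = x := fun x => LinearMap.congr_fun hτ x
  -- Symmetrizing the S-linear splitting τ: `root`·τ + τ·`root` commutes with `root` because `root`²
  -- = -f is a scalar from S.
  let s : N →ₗ[B] (Fin m → B) :=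
    { toFun := fun x => C.root • τ x + τ (C.root • x)
      map_add' := fun x y => by rw [smul_add, map_add, map_add, smul_add]; abel
      map_smul' := fun b x => by
        have h1 : C.root • b • x = C.re b • C.root • x + C.im b • -(f • x) := by
          rw [C.smul_eq b x, smul_add, smul_comm C.root (C.re b), smul_comm C.root (C.im b),
            C.root_smul_root_smul]
        rw [h1, C.smul_eq b x, RingHom.id_apply, C.smul_eq b]
        simp only [map_add, map_smul, map_neg, smul_add, smul_neg]
        rw [C.root_smul_root_smul, smul_comm C.root (C.re b), smul_comm C.root (C.im b)]
        simp only [smul_neg]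
        abel }
  have hs : ∀ x, ρ (s x) = C.root • (2 : B) • x := fun x => by
    change ρ (C.root • τ x + τ (C.root • x)) = _
    rw [map_add, map_smul, hτ', hτ', two_smul, smul_add]
  obtain ⟨p, hp⟩ := exists_comp_eq_of_exact_left hroot hqe (ρ ∘ₗ (LinearMap.ker π).subtype)
    fun x => (hρ' x).trans x.2
  -- Since ρ ∘ s = 2·`root`, the map s lands in ker π. Dividing ρ by `root` on ker π gives p with p
  -- ∘ i = 2, which is invertible.
  let i : N →ₗ[B] LinearMap.ker π := s.codRestrict _ fun x => by
    rw [LinearMap.mem_ker, ← hρ', hs]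
    exact (hqe _).mpr ⟨_, rfl⟩
  obtain ⟨c, hc⟩ := h2.exists_left_inv
  refine ⟨i, c • p, ?_⟩
  ext x
  have h3 : p (i x) = (2 : B) • x := hroot ((hp (i x)).trans (hs x))
  rw [LinearMap.comp_apply, LinearMap.smul_apply, h3, smul_smul, hc, one_smul, LinearMap.id_apply]

theorem isLattice_reduction [IsLocalRing S] [IsNoetherianRing S] [Algebra S R]
    [IsScalarTower S B R] [Module S N] [IsScalarTower S B N] [Module S Q] [IsScalarTower S R Q]
    [IsScalarTower S B Q] {n : ℕ} (hS : HasRegularParameters S (n + 1)) (hf : IsSMulRegular S f)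
    (hfm : f ∈ maximalIdeal S) (hR : ringKrullDim R = (n : ℕ))
    (hSR : Function.Surjective (algebraMap S R)) (hBR : Function.Surjective (algebraMap B R))
    (hker : RingHom.ker (algebraMap B R) = Ideal.span {C.root}) (hN : IsLattice B N)
    (q : N →ₗ[B] Q) (hq : Function.Surjective q)
    (hqe : Function.Exact (LinearMap.lsmul B N C.root) q) : IsLattice R Q := by
  have hfin := hN.finite
  have hB := C.finite
  have hNS : Module.Finite S N := Module.Finite.trans B N
  have hBn : IsNoetherianRing B := isNoetherian_of_tower S
    (isNoetherian_of_isNoetherianRing_of_finite S B)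
  have hRn : IsNoetherianRing R := isNoetherianRing_of_surjective S R _ hSR
  have hfree := (C.isMaximalCohenMacaulay_iff_free hS hfm).mp hN.maximalCohenMacaulay
  have hQS : Module.Finite S Q := Module.Finite.of_surjective (q.restrictScalars S) hq
  rw [isLattice_iff] at hN ⊢
  obtain ⟨-, -, e, he⟩ := hN
  refine ⟨Module.Finite.of_restrictScalars_finite S R Q, ?_, e, ?_⟩
  · rw [isMaximalCohenMacaulay_iff_extZero hSR hR]
    exact hS.extZero_of_exact ((LinearMap.lsmul B N C.root).restrictScalars S)
      (q.restrictScalars S) (C.lsmul_root_injective hf) hq hqe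
  · rw [← map_maximalIdeal_of_surjective _ hBR, ← Ideal.map_pow]
    intro r hr
    obtain ⟨b, hb, rfl⟩ := (Ideal.mem_map_iff_of_surjective _ hBR).mp hr
    exact C.mem_stableAnnihilator_reduction hBR hker q hq hqe (he hb)

end Reduction

end DoubleCover

end LatticeType

/-! ### Transfer of unbounded families between the two rings -/

namespace LatticeType

open IsLocalRing TensorProduct

section ProdLift

variable {R B : Type u} [CommRing R] [CommRing B] [Algebra B R] {X Y Z : Type u}
  [AddCommGroup X] [Module R X] [AddCommGroup Y] [Module R Y] [AddCommGroup Z] [Module R Z]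
  {m₁ m₂ : ℕ}

/-- The decomposition of a finite free module of rank `m₁ + m₂`. -/
noncomputable def finAddEquivProd (B : Type u) [CommRing B] (m₁ m₂ : ℕ) :
    (Fin (m₁ + m₂) → B) ≃ₗ[B] (Fin m₁ → B) × (Fin m₂ → B) :=
  (LinearEquiv.funCongrLeft B B finSumFinEquiv).trans
    (LinearEquiv.sumArrowLequivProdArrow (Fin m₁) (Fin m₂) B B)

/-- The direct sum of two semilinear presentations, followed by an isomorphism. -/
noncomputable def prodLift (π₁ : (Fin m₁ → B) →ₛₗ[algebraMap B R] Y)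
    (π₂ : (Fin m₂ → B) →ₛₗ[algebraMap B R] Z) (e : (Y × Z) ≃ₗ[R] X) :
    (Fin (m₁ + m₂) → B) →ₛₗ[algebraMap B R] X where
  toFun v := e (π₁ (finAddEquivProd B m₁ m₂ v).1, π₂ (finAddEquivProd B m₁ m₂ v).2)
  map_add' v w := by
    rw [map_add, Prod.fst_add, Prod.snd_add, map_add, map_add, ← Prod.mk_add_mk, map_add]
  map_smul' b v := by
    rw [map_smul, Prod.smul_fst, Prod.smul_snd, map_smulₛₗ, map_smulₛₗ, ← Prod.smul_mk, map_smul]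

variable {π₁ : (Fin m₁ → B) →ₛₗ[algebraMap B R] Y} {π₂ : (Fin m₂ → B) →ₛₗ[algebraMap B R] Z}

theorem prodLift_surjective (h₁ : Function.Surjective π₁) (h₂ : Function.Surjective π₂)
    (e : (Y × Z) ≃ₗ[R] X) : Function.Surjective (prodLift π₁ π₂ e) := fun x => by
  obtain ⟨⟨y, z⟩, rfl⟩ := e.surjective x
  obtain ⟨v, rfl⟩ := h₁ y
  obtain ⟨w, rfl⟩ := h₂ z
  refine ⟨(finAddEquivProd B m₁ m₂).symm (v, w), ?_⟩
  change e (π₁ (finAddEquivProd B m₁ m₂ _).1, π₂ (finAddEquivProd B m₁ m₂ _).2) = _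
  rw [LinearEquiv.apply_symm_apply]

theorem isRetract_ker_prodLift {e : (Y × Z) ≃ₗ[R] X} :
    IsRetract B (LinearMap.ker (prodLift π₁ π₂ e)) (LinearMap.ker π₁ × LinearMap.ker π₂) := by
  let ε := finAddEquivProd B m₁ m₂
  have h : ∀ v : LinearMap.ker (prodLift π₁ π₂ e), π₁ (ε v).1 = 0 ∧ π₂ (ε v).2 = 0 := fun v => by
    have h1 : e (π₁ (ε v).1, π₂ (ε v).2) = 0 := v.2
    rw [LinearEquiv.map_eq_zero_iff, Prod.mk_eq_zero] at h1
    exact h1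
  refine ⟨((LinearMap.fst B _ _ ∘ₗ ε.toLinearMap ∘ₗ Submodule.subtype _).codRestrict _
      fun v => (h v).1).prod ((LinearMap.snd B _ _ ∘ₗ ε.toLinearMap ∘ₗ
        Submodule.subtype _).codRestrict _ fun v => (h v).2),
    (ε.symm.toLinearMap ∘ₗ (LinearMap.ker π₁).subtype.prodMap
      (LinearMap.ker π₂).subtype).codRestrict _ fun v => ?_, ?_⟩
  · change e (π₁ (ε (ε.symm (v.1, v.2))).1, π₂ (ε (ε.symm (v.1, v.2))).2) = 0
    rw [LinearEquiv.apply_symm_apply, LinearMap.mem_ker.mp v.1.2, LinearMap.mem_ker.mp v.2.2]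
    exact map_zero e
  · refine LinearMap.ext fun v => Subtype.ext ?_
    exact ε.symm_apply_apply v

end ProdLift

namespace DoubleCover

section Tensor

variable {S R B : Type u} [CommRing S] [CommRing R] [CommRing B] [Algebra S B]
  [Algebra B R] {f : S} (C : DoubleCover S B f)
include C

/-- This identifies R ⊗ N with N/uN; the tensor product has the advantage of commuting visibly with
isomorphisms and direct sums. -/
theorem exact_mk_tensor (hBR : Function.Surjective (algebraMap B R))
    (hker : RingHom.ker (algebraMap B R) = Ideal.span {C.root}) (N : Type u) [AddCommGroup N]
    [Module B N] : Function.Exact (LinearMap.lsmul B N C.root) (TensorProduct.mk B R N 1) := by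
  have hex : Function.Exact (LinearMap.lsmul B B C.root) (Algebra.linearMap B R) := fun b => by
    change algebraMap B R b = 0 ↔ _
    rw [← RingHom.mem_ker, hker, Ideal.mem_span_singleton']
    simp [mul_comm]
  have h := rTensor_exact N hex hBR
  have hmul : (LinearMap.lsmul B B C.root).rTensor N = C.root • LinearMap.id := by
    have : LinearMap.lsmul B B C.root = C.root • LinearMap.id := rfl
    rw [this, LinearMap.rTensor_smul, LinearMap.rTensor_id]
  intro x
  have h1 := h ((TensorProduct.lid B N).symm x)
  have h2 : (Algebra.linearMap B R).rTensor N ((TensorProduct.lid B N).symm x) =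
      TensorProduct.mk B R N 1 x := by simp
  rw [h2] at h1
  rw [h1]
  constructor
  · rintro ⟨y, hy⟩
    refine ⟨TensorProduct.lid B N y, ?_⟩
    have := congrArg (TensorProduct.lid B N) hy
    rw [LinearEquiv.apply_symm_apply] at this
    rw [← this]
    rw [hmul, LinearMap.smul_apply, map_smul]
    rfl
  · rintro ⟨y, rfl⟩
    refine ⟨(TensorProduct.lid B N).symm y, ?_⟩
    rw [hmul, LinearMap.smul_apply, LinearMap.id_apply, ← map_smul]
    rfl

end Tensor

section Transfer

variable {S R B : Type u} [CommRing S] [IsLocalRing S] [IsNoetherianRing S]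
  [IsAdicComplete (maximalIdeal S) S] [CommRing R] [IsLocalRing R]
  [CommRing B] [IsLocalRing B] [Algebra S B] [Algebra B R] [Algebra S R] [IsScalarTower S B R]
  {f : S} (C : DoubleCover S B f)
include C

theorem hasUnboundedFamilies_of_hypersurface {n : ℕ} (hS : HasRegularParameters S (n + 1))
    (hf : IsSMulRegular S f) (hfm : f ∈ maximalIdeal S)
    (hSR : Function.Surjective (algebraMap S R))
    (hSRker : RingHom.ker (algebraMap S R) = Ideal.span {f})
    (hBR : Function.Surjective (algebraMap B R))
    (hker : RingHom.ker (algebraMap B R) = Ideal.span {C.root})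
    (h : HasUnboundedFamilies R) : HasUnboundedFamilies B := by
  have hR := isHenselianGorenstein_hypersurface hS hf hfm hSR hSRker
  have hB := C.isHenselianGorenstein hS hfm
  have hD := ringKrullDim_hypersurface hS hf hfm hSR hSRker
  -- An indecomposable M is matched with an indecomposable summand N of its syzygy for which M is a
  -- summand of R ⊗ N. All M matched with N are summands of the single module R ⊗ N.
  refine h.transfer hR (fun n => 2 * n) (fun M N => IsRetract R M (R ⊗[B] N)) ?_ ?_
  · intro M hM hind
    let _ : Module B M := Module.compHom M (algebraMap B R)
    have : IsScalarTower B R M := .of_algebraMap_smul fun _ _ => rfl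
    let _ : Module S M := Module.compHom M (algebraMap S R)
    have : IsScalarTower S R M := .of_algebraMap_smul fun _ _ => rfl
    have : IsScalarTower S B M := .of_algebraMap_smul fun s x => by
      rw [← algebraMap_smul R (algebraMap S B s), ← IsScalarTower.algebraMap_apply]; rfl
    have hfin := hM.finite
    obtain ⟨π, hπ⟩ := exists_surjective_minGenerators (A := R) (M := M)
    let π' := π.restrictScalars B ∘ₗ reduction B R (minGenerators R M)
    have hπ' : Function.Surjective π' := hπ.comp (reduction_surjective hBR _)
    have hK := C.isLattice_ker hS hf hfm hD hSR hBR hker hM π' hπ'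
    have hKfin := hK.finite
    have hMK : IsRetract R M (R ⊗[B] LinearMap.ker π') :=
      C.isRetract_reduction_ker hBR hker π' hπ' (TensorProduct.mk B R _ 1)
        (TensorProduct.mk_surjective B _ R hBR) (C.exact_mk_tensor hBR hker _)
    have := hind.1
    obtain ⟨N, hN, hNK, hMN⟩ := exists_isIndecomposable_isRetract (A := B)
      (fun X _ _ => IsRetract R M (R ⊗[B] X))
      (fun X _ _ hX => IsRetract.not_of_subsingleton)
      (fun X Y Z _ _ _ _ _ _ hX e h => IsRetract.of_prod hR hind
        (h.congr_right ((e.baseChange B R X (Y × Z)).trans (TensorProduct.prodRight B R R Y Z))))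
      _ (LinearMap.ker π') le_rfl hMK
    have hNlat := hB.isLattice_of_isRetract hK hNK
    have hNfin := hNlat.finite
    refine ⟨N, hNlat, hN, hMN, fun l hl => ?_, fun l hl => ?_⟩
    · exact hNK.hasSizeLE (C.hasSizeLE_ker hS hf hD hSR hBR hker hM.maximalCohenMacaulay π' hπ'
        hl.1 hl)
    · refine (hMN.hasSizeLE (C.hasSizeLE_reduction hBR hker (TensorProduct.mk B R N 1)
        (TensorProduct.mk_surjective B _ R hBR) (C.exact_mk_tensor hBR hker _) hl)).mono ?_
      omega
  · intro N hN
    have := hN.finite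
    exact ⟨ModuleCat.of R (R ⊗[B] N), inferInstanceAs (Module.Finite R (R ⊗[B] N)),
      fun M N' e h => h.congr_right (e.symm.baseChange B R N' N)⟩

theorem hasUnboundedFamilies_of_doubleCover {n : ℕ} (hS : HasRegularParameters S (n + 1))
    (hf : IsSMulRegular S f) (hfm : f ∈ maximalIdeal S) (h2 : IsUnit (2 : B))
    (hSR : Function.Surjective (algebraMap S R))
    (hSRker : RingHom.ker (algebraMap S R) = Ideal.span {f})
    (hBR : Function.Surjective (algebraMap B R))
    (hker : RingHom.ker (algebraMap B R) = Ideal.span {C.root})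
    (h : HasUnboundedFamilies B) : HasUnboundedFamilies R := by
  have hR := isHenselianGorenstein_hypersurface hS hf hfm hSR hSRker
  have hB := C.isHenselianGorenstein hS hfm
  have hD := ringKrullDim_hypersurface hS hf hfm hSR hSRker
  -- Presentations are semilinear along B → R, so that X needs only its R-structure. Asking for all
  -- of them makes the relation pass to a term of a direct sum.
  refine h.transfer hB (fun n => 2 * n) (fun N X => ∀ (m : ℕ)
    (π : (Fin m → B) →ₛₗ[algebraMap B R] X), Function.Surjective π →
    IsRetract B N (LinearMap.ker π)) ?_ ?_
  · intro N hN hind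
    let _ : Module S N := Module.compHom N (algebraMap S B)
    have : IsScalarTower S B N := .of_algebraMap_smul fun _ _ => rfl
    have : IsScalarTower S B (R ⊗[B] N) := .of_algebraMap_smul fun s x => by
      rw [← algebraMap_smul R (algebraMap S B s), ← IsScalarTower.algebraMap_apply,
        algebraMap_smul]
    have hfin := hN.finite
    have hfree := (C.isMaximalCohenMacaulay_iff_free hS hfm).mp hN.maximalCohenMacaulay
    have hQ := C.isLattice_reduction hS hf hfm hD hSR hBR hker hN (TensorProduct.mk B R N 1)
      (TensorProduct.mk_surjective B _ R hBR) (C.exact_mk_tensor hBR hker _)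
    have hQfin := hQ.finite
    have := hind.1
    obtain ⟨X, hX, hXQ, hNX⟩ := exists_isIndecomposable_isRetract (A := R)
      (fun X _ _ => ∀ (m : ℕ) (π : (Fin m → B) →ₛₗ[algebraMap B R] X), Function.Surjective π →
        IsRetract B N (LinearMap.ker π))
      (fun X _ _ hX h => by
        have := h 0 0 fun x => ⟨0, Subsingleton.elim _ _⟩
        exact IsRetract.not_of_subsingleton this)
      (fun X Y Z _ _ _ _ _ _ hX e h => by
        -- If a presentation of Y and one of Z both fail, their sum presents X, and N would be a
        -- summand of the product of the two kernels, hence of one of them.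
        by_contra hYZ
        push Not at hYZ
        obtain ⟨⟨m₁, π₁, hπ₁, h₁⟩, m₂, π₂, hπ₂, h₂⟩ := hYZ
        rcases IsRetract.of_prod hB hind ((h _ _ (prodLift_surjective hπ₁ hπ₂ e.symm)).trans
          isRetract_ker_prodLift) with h | h
        · exact h₁ h
        · exact h₂ h)
      _ (R ⊗[B] N) le_rfl (fun m π hπ => by
        let π' : (Fin m → B) →ₗ[B] (R ⊗[B] N) :=
          { toFun := π
            map_add' := map_add π
            map_smul' := fun b v => by rw [π.map_smulₛₗ, algebraMap_smul]; rfl }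
        exact C.isRetract_ker_reduction hf hfm h2 (TensorProduct.mk B R N 1)
          (TensorProduct.mk_surjective B _ R hBR) (C.exact_mk_tensor hBR hker _) π' hπ)
    have hXlat := hR.isLattice_of_isRetract hQ hXQ
    have hXfin := hXlat.finite
    refine ⟨X, hXlat, hX, hNX, fun l hl => ?_, fun l hl => ?_⟩
    · refine (hXQ.hasSizeLE (C.hasSizeLE_reduction hBR hker (TensorProduct.mk B R N 1)
        (TensorProduct.mk_surjective B _ R hBR) (C.exact_mk_tensor hBR hker _) hl)).mono ?_
      omega
    · let _ : Module B X := Module.compHom X (algebraMap B R)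
      have : IsScalarTower B R X := .of_algebraMap_smul fun _ _ => rfl
      let _ : Module S X := Module.compHom X (algebraMap S R)
      have : IsScalarTower S R X := .of_algebraMap_smul fun _ _ => rfl
      have : IsScalarTower S B X := .of_algebraMap_smul fun s x => by
        rw [← algebraMap_smul R (algebraMap S B s), ← IsScalarTower.algebraMap_apply]; rfl
      obtain ⟨π, hπ⟩ := exists_surjective_minGenerators (A := R) (M := X)
      let π' := π.restrictScalars B ∘ₗ reduction B R (minGenerators R X)
      have hπ' : Function.Surjective π' := hπ.comp (reduction_surjective hBR _)
      have hK := C.isLattice_ker hS hf hfm hD hSR hBR hker hXlat π' hπ'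
      have hKfin := hK.finite
      let π'' : (Fin (minGenerators R X) → B) →ₛₗ[algebraMap B R] X :=
          { toFun := π'
            map_add' := map_add π'
            map_smul' := fun b v => by rw [map_smul, algebraMap_smul] }
      have hret : IsRetract B N (LinearMap.ker π') := hNX _ π'' hπ'
      exact hret.hasSizeLE (C.hasSizeLE_ker hS hf hD hSR hBR hker hXlat.maximalCohenMacaulay π' hπ'
        hl.1 hl)
  · intro X hX
    have := hX.finite
    have hBn := hB.isNoetherianRing
    obtain ⟨m, π, hπ⟩ := Module.Finite.exists_fin' R X
    let π' : (Fin m → B) →ₛₗ[algebraMap B R] X :=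
      { toFun := fun v => π (reduction B R m v)
        map_add' := fun v w => by rw [map_add, map_add]
        map_smul' := fun b v => by rw [map_smul, ← algebraMap_smul R b, map_smul] }
    refine ⟨ModuleCat.of B (LinearMap.ker π'), inferInstanceAs (Module.Finite B (LinearMap.ker π')),
      fun N X' e h => ?_⟩
    have h1 := h m (e.toLinearMap.comp π') (e.surjective.comp
      (hπ.comp (reduction_surjective hBR m)))
    have h2 : LinearMap.ker (e.toLinearMap.comp π') = LinearMap.ker π' := by
      ext v; simp
    exact h1.congr_right (LinearEquiv.ofEq _ _ h2)

end Transfer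

end DoubleCover

end LatticeType

/-! ### Power series rings and the concrete double branched cover -/

namespace LatticeType

open IsLocalRing

section RegularParameters

theorem mem_span_X_image {σ R : Type*} [CommRing R] (s : Finset σ) (φ : MvPowerSeries σ R) :
    φ ∈ Ideal.span (MvPowerSeries.X '' (s : Set σ)) ↔
      ∀ m : σ →₀ ℕ, (∀ j ∈ s, m j = 0) → MvPowerSeries.coeff m φ = 0 := by
  classical
  constructor
  · intro h m hm
    induction h using Submodule.span_induction with
    | mem x hx =>
      obtain ⟨i, hi, rfl⟩ := hx
      exact (MvPowerSeries.X_dvd_iff.1 dvd_rfl) m (hm i hi)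
    | zero => simp
    | add x y _ _ hx hy => rw [map_add, hx, hy, add_zero]
    | smul a x hx' hx =>
      clear hx
      rw [smul_eq_mul]
      revert a
      induction hx' using Submodule.span_induction with
      | mem x hx =>
        obtain ⟨i, hi, rfl⟩ := hx
        exact fun a => MvPowerSeries.X_dvd_iff.1 (dvd_mul_left _ a) m (hm i hi)
      | zero => simp
      | add x y _ _ hx hy => intro a; rw [mul_add, map_add, hx, hy, add_zero]
      | smul b x _ hx => intro a; rw [smul_eq_mul, ← mul_assoc]; exact hx _
  · induction s using Finset.induction_on generalizing φ with
    | empty =>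
      intro h
      have : φ = 0 := MvPowerSeries.ext fun m => by simpa using h m (by simp)
      simp [this]
    | insert a s ha ih =>
      intro h
      -- The part of φ made of the monomials that involve the new variable is divisible by it; the
      -- rest is covered by induction.
      let φ₁ : MvPowerSeries σ R := fun m => if m a = 0 then 0 else MvPowerSeries.coeff m φ
      have h₁ : ∀ m, MvPowerSeries.coeff m φ₁ = if m a = 0 then 0 else MvPowerSeries.coeff m φ :=
        fun m => rfl
      have hX : MvPowerSeries.X a ∣ φ₁ := MvPowerSeries.X_dvd_iff.2 fun m hm => by simp [h₁, hm]
      have hs : φ - φ₁ ∈ Ideal.span (MvPowerSeries.X '' (s : Set σ)) := by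
        refine ih _ fun m hm => ?_
        rw [map_sub, h₁]
        split_ifs with h0
        · rw [sub_zero]
          exact h m fun j hj => by
            rcases Finset.mem_insert.1 hj with rfl | hj
            exacts [h0, hm j hj]
        · exact sub_self _
      rw [← sub_add_cancel φ φ₁]
      refine add_mem (Ideal.span_mono (Set.image_mono (by simp)) hs) ?_
      exact Ideal.mem_of_dvd _ hX (Ideal.subset_span ⟨a, by simp, rfl⟩)

variable (k : Type u) [Field k]

theorem variablesIdeal_eq_maximalIdeal (d : ℕ) :
    variablesIdeal k d = maximalIdeal (MvPowerSeries (Fin (d + 1)) k) := by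
  ext φ
  have h := mem_span_X_image (Finset.univ : Finset (Fin (d + 1))) φ
  rw [Finset.coe_univ, Set.image_univ] at h
  rw [variablesIdeal, h, mem_maximalIdeal, mem_nonunits_iff, MvPowerSeries.isUnit_iff_constantCoeff,
    isUnit_iff_ne_zero, not_not]
  constructor
  · intro h
    exact h 0 (by simp)
  · intro h m hm
    obtain rfl : m = 0 := Finsupp.ext fun j => hm j (Finset.mem_univ j)
    exact h

instance isAdicComplete_mvPowerSeries (d : ℕ) :
    IsAdicComplete (maximalIdeal (MvPowerSeries (Fin (d + 1)) k))
      (MvPowerSeries (Fin (d + 1)) k) := by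
  rw [← variablesIdeal_eq_maximalIdeal, variablesIdeal]
  infer_instance

theorem hasRegularParameters_mvPowerSeries (d : ℕ) :
    HasRegularParameters (MvPowerSeries (Fin (d + 1)) k) (d + 1) := by
  refine ⟨List.ofFn MvPowerSeries.X, List.length_ofFn, ?_, ⟨fun i hi => ?_⟩⟩
  · rw [← variablesIdeal_eq_maximalIdeal, variablesIdeal, Ideal.ofList]
    congr 1
    ext φ
    exact List.mem_ofFn.trans Iff.rfl
  · have hi' : i < d + 1 := by simpa using hi
    have hspan : (Ideal.ofList ((List.ofFn (MvPowerSeries.X (σ := Fin (d + 1)) (R := k))).take i) •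
        (⊤ : Submodule (MvPowerSeries (Fin (d + 1)) k) (MvPowerSeries (Fin (d + 1)) k))) =
        Ideal.span (MvPowerSeries.X '' ((Finset.Iio (⟨i, hi'⟩ : Fin (d + 1)) : Finset _) :
          Set (Fin (d + 1)))) := by
      rw [smul_eq_mul, Ideal.mul_top, Ideal.ofList]
      congr 1
      ext φ
      simp only [Set.mem_ofPred_eq, List.mem_take_iff_getElem, List.getElem_ofFn, List.length_ofFn,
        Finset.coe_Iio, Set.mem_image, Set.mem_Iio]
      constructor
      · rintro ⟨j, hj, rfl⟩
        exact ⟨⟨j, by omega⟩, Fin.mk_lt_mk.2 (by omega), rfl⟩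
      · rintro ⟨j, hj, rfl⟩
        have : (j : ℕ) < i := hj
        exact ⟨j, by omega, rfl⟩
    rw [hspan, List.getElem_ofFn, isSMulRegular_iff_right_eq_zero_of_smul]
    intro x hx
    obtain ⟨φ, rfl⟩ := Submodule.Quotient.mk_surjective _ x
    rw [← Submodule.Quotient.mk_smul, Submodule.Quotient.mk_eq_zero, smul_eq_mul,
      mem_span_X_image] at hx
    rw [Submodule.Quotient.mk_eq_zero, mem_span_X_image]
    intro m hm
    -- The coefficient of x at m reappears in Xᵢx at m + eᵢ, and m + eᵢ still avoids the variables
    -- before the i-th.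
    have := hx (Finsupp.single ⟨i, hi'⟩ 1 + m) fun j hj => by
      rw [Finsupp.add_apply, hm j hj, add_zero, Finsupp.single_eq_of_ne]
      exact (Finset.mem_Iio.1 hj).ne
    rwa [MvPowerSeries.X, MvPowerSeries.coeff_add_monomial_mul, one_mul] at this

end RegularParameters

namespace DoubleCover

/-- Transport of the structure of a double cover along an isomorphism of algebras. -/
def congr {S B B' : Type u} [CommRing S] [CommRing B] [Algebra S B] [CommRing B'] [Algebra S B']
    {f : S} (C : DoubleCover S B f) (e : B ≃ₐ[S] B') : DoubleCover S B' f where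
  root := e C.root
  root_mul_root := by rw [← map_mul, C.root_mul_root, map_neg, e.commutes]
  re := C.re ∘ₗ e.symm.toLinearMap
  im := C.im ∘ₗ e.symm.toLinearMap
  re_add_im b := by
    apply e.symm.injective
    simpa using C.re_add_im (e.symm b)
  re_one := by simp [C.re_one]
  im_one := by simp [C.im_one]
  re_root := by simp [C.re_root]
  im_root := by simp [C.im_root]

open Polynomial in
/-- The double cover defined by the polynomial `X ^ 2 + f`. -/
noncomputable def adjoinRoot {S : Type u} [CommRing S] [Nontrivial S] (f : S) :
    DoubleCover S (AdjoinRoot (X ^ 2 + C f)) f :=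
  have hg : (X ^ 2 + C f : S[X]).Monic := monic_X_pow_add_C f two_ne_zero
  have hdeg : (X ^ 2 + C f : S[X]).degree = 2 := degree_X_pow_add_C two_pos f
  have hroot : AdjoinRoot.root (X ^ 2 + C f) ^ 2 + AdjoinRoot.of (X ^ 2 + C f) f = 0 := by
    have := AdjoinRoot.eval₂_root (X ^ 2 + C f)
    rwa [eval₂_add, eval₂_X_pow, eval₂_C] at this
  have hlow {p : S[X]} (hp : p.degree < 2) :
      AdjoinRoot.modByMonicHom hg (AdjoinRoot.mk _ p) = p := by
    rw [AdjoinRoot.modByMonicHom_mk, (modByMonic_eq_self_iff hg).2 (hdeg ▸ hp)]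
  have hone : AdjoinRoot.modByMonicHom hg 1 = 1 := by
    rw [← map_one (AdjoinRoot.mk _)]
    exact hlow (degree_one_le.trans_lt (by norm_num))
  have hX : AdjoinRoot.modByMonicHom hg (AdjoinRoot.root _) = X :=
    hlow (degree_X_le.trans_lt (by norm_num))
  { root := AdjoinRoot.root _
    root_mul_root := by
      rw [← sq]
      exact eq_neg_of_add_eq_zero_left hroot
    re := lcoeff S 0 ∘ₗ AdjoinRoot.modByMonicHom hg
    im := lcoeff S 1 ∘ₗ AdjoinRoot.modByMonicHom hg
    re_add_im b := by
      obtain ⟨p, rfl⟩ := AdjoinRoot.mk_surjective b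
      have hp := AdjoinRoot.mk_leftInverse hg (AdjoinRoot.mk _ p)
      rw [AdjoinRoot.modByMonicHom_mk] at hp
      have hp' : p %ₘ (X ^ 2 + C f) = C ((p %ₘ (X ^ 2 + C f)).coeff 1) * X +
          C ((p %ₘ (X ^ 2 + C f)).coeff 0) :=
        eq_X_add_C_of_degree_le_one
          (Order.le_of_lt_succ ((degree_modByMonic_lt p hg).trans_eq hdeg))
      conv_rhs => rw [← hp, hp']
      simp only [LinearMap.comp_apply, lcoeff_apply, AdjoinRoot.modByMonicHom_mk, map_add, map_mul,
        AdjoinRoot.mk_C, AdjoinRoot.mk_X, AdjoinRoot.algebraMap_eq]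
      exact add_comm _ _
    re_one := by simp [hone]
    im_one := by simp [hone, coeff_one]
    re_root := by simp [hX]
    im_root := by simp [hX] }

open Polynomial in
-- Weierstrass division by a distinguished polynomial identifies S[X]/(X² + f) with S⟦X⟧/(X² + f),
-- so the power series quotient is free on 1 and X.
theorem isDistinguishedAt {S : Type u} [CommRing S] [Nontrivial S] {I : Ideal S} {f : S}
    (hf : f ∈ I) : (X ^ 2 + C f : S[X]).IsDistinguishedAt I where
  monic := monic_X_pow_add_C f two_ne_zero
  mem {n} hn := by
    rw [natDegree_X_pow_add_C] at hn
    interval_cases n <;> simp [coeff_C, hf]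

end DoubleCover

section BranchedCover

variable {S : Type u} [CommRing S] (f : S)

open PowerSeries in
/-- The quotient of `S⟦X⟧` by `f + X ^ 2` is a double cover of `S`. -/
noncomputable def doubleCoverPowerSeries [Nontrivial S] {I : Ideal S} [IsAdicComplete I S]
    (hf : f ∈ I) : DoubleCover S (S⟦X⟧ ⧸ Ideal.span {C f + (X : S⟦X⟧) ^ 2}) f :=
  (DoubleCover.adjoinRoot f).congr
    ((DoubleCover.isDistinguishedAt hf).algEquivQuotient.trans
      (Ideal.quotientEquivAlgOfEq S (by simp [add_comm])))

theorem doubleCoverPowerSeries_root [Nontrivial S] {I : Ideal S} [IsAdicComplete I S]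
    (hf : f ∈ I) : (doubleCoverPowerSeries f hf).root = Ideal.Quotient.mk _ PowerSeries.X := by
  change Ideal.quotientEquivAlgOfEq S (by simp [add_comm])
    ((DoubleCover.isDistinguishedAt hf).algEquivQuotient
      (Ideal.Quotient.mk _ Polynomial.X)) = _
  rw [Polynomial.IsDistinguishedAt.algEquivQuotient_apply]
  simp

open PowerSeries in
/-- The hypersurface is the quotient of its double branched cover by the class of `X`. -/
noncomputable def quotientOfPowerSeriesQuotient :
    S⟦X⟧ ⧸ Ideal.span {C f + (X : S⟦X⟧) ^ 2} →+* S ⧸ Ideal.span {f} :=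
  Ideal.Quotient.lift _ ((Ideal.Quotient.mk _).comp PowerSeries.constantCoeff) fun a ha => by
    obtain ⟨b, rfl⟩ := Ideal.mem_span_singleton'.1 ha
    simp

theorem quotientOfPowerSeriesQuotient_algebraMap (s : S) :
    quotientOfPowerSeriesQuotient f (algebraMap S _ s) = Ideal.Quotient.mk _ s := by
  change Ideal.Quotient.mk _ (PowerSeries.constantCoeff (PowerSeries.C s)) = _
  rw [PowerSeries.constantCoeff_C]

/-- If the real part of b is cf, then b = (im b - c·`root`)·`root`, because f = -`root`². -/
theorem DoubleCover.ker_eq_span_root {B : Type u} [CommRing B] [Algebra S B] {f : S}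
    (D : DoubleCover S B f) (φ : B →+* S ⧸ Ideal.span {f})
    (hφ : ∀ s, φ (algebraMap S B s) = Ideal.Quotient.mk _ s) (hroot : φ D.root = 0) :
    RingHom.ker φ = Ideal.span {D.root} := by
  refine le_antisymm (fun b hb => ?_) ?_
  · rw [RingHom.mem_ker, ← D.re_add_im b, map_add, map_mul, hroot, mul_zero, add_zero, hφ,
      Ideal.Quotient.eq_zero_iff_mem] at hb
    obtain ⟨c, hc⟩ := Ideal.mem_span_singleton'.1 hb
    rw [Ideal.mem_span_singleton', ← D.re_add_im b, ← hc]
    refine ⟨algebraMap S B (D.im b) - algebraMap S B c * D.root, ?_⟩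
    rw [map_mul]
    linear_combination -algebraMap S B c * D.root_mul_root
  · rw [Ideal.span_singleton_le_iff_mem, RingHom.mem_ker, hroot]

end BranchedCover

end LatticeType

open LatticeType in
theorem mainTheorem4 {k : Type u} [Field k] [CharZero k] (d : ℕ)
    (f : MvPowerSeries (Fin (d + 1)) k) (hf0 : f ≠ 0)
    (hf : f ∈ LatticeType.variablesIdeal k d ^ 2) :
    haveI : IsLocalRing (LatticeType.Hypersurface f) := LatticeType.isLocalRing_hypersurface hf
    haveI : IsLocalRing (LatticeType.DoubleBranchedCover f) :=
      LatticeType.isLocalRing_doubleBranchedCover hf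
    LatticeType.HasStronglyUnboundedLatticeType (LatticeType.Hypersurface f) ↔
      LatticeType.HasStronglyUnboundedLatticeType (LatticeType.DoubleBranchedCover f) := by
  have : IsLocalRing (Hypersurface f) := isLocalRing_hypersurface hf
  have : IsLocalRing (DoubleBranchedCover f) := isLocalRing_doubleBranchedCover hf
  have hS := hasRegularParameters_mvPowerSeries k d
  have hfm : f ∈ IsLocalRing.maximalIdeal (MvPowerSeries (Fin (d + 1)) k) :=
    variablesIdeal_eq_maximalIdeal k d ▸ Ideal.pow_le_self two_ne_zero hf
  have hreg : IsSMulRegular (MvPowerSeries (Fin (d + 1)) k) f :=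
    fun a b hab => mul_left_cancel₀ hf0 hab
  let D := doubleCoverPowerSeries f hfm
  let : Algebra (DoubleBranchedCover f) (Hypersurface f) :=
    (quotientOfPowerSeriesQuotient f).toAlgebra
  have : IsScalarTower (MvPowerSeries (Fin (d + 1)) k) (DoubleBranchedCover f)
      (Hypersurface f) :=
    IsScalarTower.of_algebraMap_eq fun s => (quotientOfPowerSeriesQuotient_algebraMap f s).symm
  have hSR : Function.Surjective
      (algebraMap (MvPowerSeries (Fin (d + 1)) k) (Hypersurface f)) :=
    Ideal.Quotient.mk_surjective
  have hSRker : RingHom.ker (algebraMap (MvPowerSeries (Fin (d + 1)) k) (Hypersurface f)) =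
      Ideal.span {f} := Ideal.mk_ker
  have hBR : Function.Surjective (algebraMap (DoubleBranchedCover f) (Hypersurface f)) := by
    intro r
    obtain ⟨s, rfl⟩ := hSR r
    exact ⟨algebraMap _ _ s, quotientOfPowerSeriesQuotient_algebraMap f s⟩
  have hker : RingHom.ker (algebraMap (DoubleBranchedCover f) (Hypersurface f)) =
      Ideal.span {D.root} := by
    refine D.ker_eq_span_root _ (quotientOfPowerSeriesQuotient_algebraMap f) ?_
    rw [doubleCoverPowerSeries_root]
    change Ideal.Quotient.mk _ (PowerSeries.constantCoeff PowerSeries.X) = _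
    simp
  -- The characteristic enters only here.
  have h2 : IsUnit (2 : DoubleBranchedCover f) := by
    have h : IsUnit (2 : k) := isUnit_iff_ne_zero.2 two_ne_zero
    have := (h.map (MvPowerSeries.C (σ := Fin (d + 1)) (R := k))).map
      (algebraMap _ (DoubleBranchedCover f))
    rwa [map_ofNat, map_ofNat] at this
  have hR : IsHenselianGorenstein (Hypersurface f) :=
    isHenselianGorenstein_hypersurface hS hreg hfm hSR hSRker
  have hB : IsHenselianGorenstein (DoubleBranchedCover f) := D.isHenselianGorenstein hS hfm
  rw [hR.hasStronglyUnboundedLatticeType_iff, hB.hasStronglyUnboundedLatticeType_iff]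
  exact ⟨D.hasUnboundedFamilies_of_hypersurface hS hreg hfm hSR hSRker hBR hker,
    D.hasUnboundedFamilies_of_doubleCover hS hreg hfm h2 hSR hSRker hBR hker⟩
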